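/- Let $F$ be a field and let $(V,q)$ be a nonsingular quadratic space over $F$ (i.e. the polar form $b_q(x,y)=q(x+y)-q(x)-q(y)$ is nondegenerate) of finite dimension $2m\ge 8$, with $m$ even, and with $m\equiv 0 \bmod 4$ if $\operatorname{char}F\neq 2$. Let $e,e'\in V$ satisfy $b_q(e,e')=1$. Notation. For an algebra $C$ whose centre $Z$ is étale over $F$ and which is central simple of some degree $n$ over $Z$ (Azumaya of constant degree $n$), $\operatorname{Trd}_C:C\to Z$ is the reduced trace. A quadratic pair on $C$ is a pair $(\sigma,f)$ where $\sigma$ is an $F$-linear involution on $C$ that is the identity on $Z$, such that $\operatorname{Sym}(C,\sigma)=\{s:\sigma(s)=s\}$ is free of rank $n(n+1)/2$ over $Z$, and $f:\operatorname{Sym}(C,\sigma)\to Z$ is a semi-trace, i.e. a $Z$-linear map with $f(x+\sigma(x))=\operatorname{Trd}_C(x)$ for all $x\in C$. An isomorphism $(C,\sigma,f)\simeq(C',\sigma',f')$ is an $F$-algebra isomorphism $\Phi:C\to C'$ with $\Phi\circ\sigma=\sigma'\circ\Phi$ and $f'(\Phi(s))=\Phi(f(s))$ for all $s\in\operatorname{Sym}(C,\sigma)$.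 * $\mathcal C_0(q)$ is the even Clifford algebra, $\underline{\sigma_q}$ is the involution induced by the identity of $V$, and $f_{e,e'}(s)=\operatorname{Trd}_{\mathcal C_0(q)}(ee's)$ for $s\in\operatorname{Sym}(\mathcal C_0(q),\underline{\sigma_q})$. * $\varphi_q:V\otimes V\to \operatorname{End}_F(V)$ is the isomorphism $\varphi_q(v\otimes w)(x)=v\,b_q(w,x)$, and $\operatorname{Ad}_q=(\operatorname{End}_F(V),\sigma_q,f_q)$, where $\sigma_q$ is the involution adjoint to $b_q$ and $f_q:\operatorname{Sym}(\operatorname{End}_F(V),\sigma_q)\to F$ is the unique linear form with $f_q(x+\sigma_q(x))=\operatorname{tr}(x)$ for all $x\in\operatorname{End}_F(V)$ and $f_q(\varphi_q(v\otimes v))=q(v)$ for all $v\in V$. * For $(A,\sigma,f)=\operatorname{Ad}_q$ choose $\ell\in A$ with $\ell+\sigma(\ell)=1$ and $f(s)=\operatorname{Trd}_A(\ell s)$ for all $s\in \operatorname{Sym}(A,\sigma)$. Let $\operatorname{Sand}(a\otimes b)(x)=axb$, and define $\sigma_2$ on $A\otimes A$ by $\operatorname{Sand}(\sigma_2(u))(x)=\operatorname{Sand}(u)(\sigma(x))$.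 Then $\mathcal C(\operatorname{Ad}_q)$ is the quotient of the tensor algebra $T(A)$ by the two-sided ideal generated by all $s-f(s)\cdot 1$ with $s\in A$, $\sigma(s)=s$, and all $u-\operatorname{Sand}(u)(\ell)$ with $u\in A\otimes A$, $\sigma_2(u)=u$ (it does not depend on $\ell$). Let $c:A\to\mathcal C(\operatorname{Ad}_q)$ be the canonical map, and let $\underline{\sigma_q}$ also denote the canonical involution of $\mathcal C(\operatorname{Ad}_q)$, determined by $\underline{\sigma_q}(c(a))=c(\sigma_q(a))$. * The canonical semi-trace $\underline{f_q}$ on $(\mathcal C(\operatorname{Ad}_q),\underline{\sigma_q})$ is $\underline{f_q}(s)=\operatorname{Trd}_{\mathcal C(\operatorname{Ad}_q)}(c(\lambda)s)$, for any $\lambda\in\operatorname{End}_F(V)$ of trace $1$. Claim. Elements $\lambda$ of trace $1$ exist, the form $\underline{f_q}$ does not depend on the choice of $\lambda$, the pairs $(\underline{\sigma_q},f_{e,e'})$ and $(\underline{\sigma_q},\underline{f_q})$ are quadratic pairs on $\mathcal C_0(q)$ and $\mathcal C(\operatorname{Ad}_q)$ respectively (whose centres are étale over $F$ and over whose centres they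 are central simple), and $\varphi_q$ induces an isomorphism of algebras with quadratic pairs $$\bigl(\mathcal C_0(q),\underline{\sigma_q},f_{e,e'}\bigr)\simeq\bigl(\mathcal C(\operatorname{Ad}_q),\underline{\sigma_q},\underline{f_q}\bigr),$$ namely one that maps $vw\in\mathcal C_0(q)$ to $c(\varphi_q(v\otimes w))$ for all $v,w\in V$. -/

import Mathlib

open scoped TensorProduct

noncomputable section

namespace QuadPair

universe u v

/-! ### Reduced traces -/

/-- `t` is the reduced trace of `A`, an algebra which is central simple of degree `n` over `R`:
over every geometric point `R → K` the algebra `A` becomes a full matrix algebra `Mₙ(K)`, in such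
a way that `t` becomes the trace of matrices.  If `R` is a field this says that `A` is a central
simple `R`-algebra of degree `n` and that `t` is its reduced trace; if `R` is a product of fields,
it says the same of each of the components of `A`. -/
def IsReducedTrace (R : Type u) (A : Type v) [CommRing R] [Ring A] [Algebra R A]
    (n : ℕ) (t : A →ₗ[R] R) : Prop :=
  ∀ (K : Type u) [Field K] [IsAlgClosed K] [Algebra R K],
    ∃ φ : K ⊗[R] A ≃ₐ[K] Matrix (Fin n) (Fin n) K,
      ∀ a : A, (φ (1 ⊗ₜ[R] a)).trace = algebraMap R K (t a)

/-- Over a reduced base ring the reduced trace is unique. -/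
theorem IsReducedTrace.unique {R : Type u} {A : Type v} [CommRing R] [IsReduced R] [Ring A]
    [Algebra R A] {n n' : ℕ} {t t' : A →ₗ[R] R} (h : IsReducedTrace R A n t)
    (h' : IsReducedTrace R A n' t') : t = t' := by
  ext a
  rw [← sub_eq_zero]
  refine IsReduced.eq_zero _ (mem_nilradical.mp ?_)
  rw [nilradical_eq_sInf, Ideal.mem_sInf]
  intro P hP
  have hP' : P.IsPrime := hP
  let k := P.ResidueField
  let _ : Algebra R (AlgebraicClosure k) :=
    ((algebraMap k (AlgebraicClosure k)).comp (algebraMap R k)).toAlgebra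
  obtain ⟨φ, hφ⟩ := h (AlgebraicClosure k)
  obtain ⟨φ', hφ'⟩ := h' (AlgebraicClosure k)
  let ψ : Module.End (AlgebraicClosure k) (Fin n → AlgebraicClosure k) ≃ₐ[AlgebraicClosure k]
      Module.End (AlgebraicClosure k) (Fin n' → AlgebraicClosure k) :=
    (Matrix.toLinAlgEquiv'.symm.trans (φ.symm.trans φ')).trans Matrix.toLinAlgEquiv'
  obtain ⟨T, hT⟩ := ψ.eq_linearEquivConjAlgEquiv
  have key : (φ (1 ⊗ₜ[R] a)).trace = (φ' (1 ⊗ₜ[R] a)).trace := by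
    have h1 := AlgEquiv.congr_fun hT (Matrix.toLinAlgEquiv' (φ (1 ⊗ₜ[R] a)))
    have h2 : ψ (Matrix.toLinAlgEquiv' (φ (1 ⊗ₜ[R] a)))
        = Matrix.toLinAlgEquiv' (φ' (1 ⊗ₜ[R] a)) := by simp [ψ]
    rw [h2] at h1
    have h3 := congrArg (LinearMap.trace _ _) h1
    have h4 : LinearMap.trace _ _ (T.conjAlgEquiv (AlgebraicClosure k)
        (Matrix.toLinAlgEquiv' (φ (1 ⊗ₜ[R] a)))) =
        LinearMap.trace _ _ (Matrix.toLinAlgEquiv' (φ (1 ⊗ₜ[R] a))) :=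
      LinearMap.trace_conj' _ T
    rw [h4] at h3
    have e1 := Matrix.trace_toLin'_eq (φ (1 ⊗ₜ[R] a))
    have e2 := Matrix.trace_toLin'_eq (φ' (1 ⊗ₜ[R] a))
    rw [← e1, ← e2]
    exact h3.symm
  rw [hφ, hφ'] at key
  have key' : algebraMap R k (t a) = algebraMap R k (t' a) :=
    (algebraMap k (AlgebraicClosure k)).injective key
  have : algebraMap R k (t a - t' a) = 0 := by rw [map_sub, key', sub_self]
  exact (Ideal.algebraMap_residueField_eq_zero).mp this

open Classical in
/-- The reduced trace `Trd_A : A → R` (and `0` if `A` has none). -/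
def reducedTrace (R : Type u) (A : Type v) [CommRing R] [Ring A] [Algebra R A] : A →ₗ[R] R :=
  if h : ∃ t : A →ₗ[R] R, ∃ n, IsReducedTrace R A n t then h.choose else 0

theorem IsReducedTrace.reducedTrace_eq {R : Type u} {A : Type v} [CommRing R] [IsReduced R]
    [Ring A] [Algebra R A] {n : ℕ} {t : A →ₗ[R] R} (h : IsReducedTrace R A n t) :
    reducedTrace R A = t := by
  have hex : ∃ t : A →ₗ[R] R, ∃ n, IsReducedTrace R A n t := ⟨t, n, h⟩
  rw [reducedTrace, dif_pos hex]
  exact hex.choose_spec.choose_spec.unique h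

theorem isReducedTrace_end (F : Type u) (V : Type v) [Field F] [AddCommGroup V] [Module F V]
    [FiniteDimensional F V] :
    IsReducedTrace F (Module.End F V) (Module.finrank F V) (LinearMap.trace F V) := by
  intro K _ _ _
  let b := Module.finBasis F V
  let e : Module.End F V ≃ₐ[F] Matrix (Fin (Module.finrank F V)) (Fin (Module.finrank F V)) F :=
    LinearMap.toMatrixAlgEquiv b
  let μ : K ⊗[F] Matrix (Fin (Module.finrank F V)) (Fin (Module.finrank F V)) F ≃ₐ[K]
      Matrix (Fin (Module.finrank F V)) (Fin (Module.finrank F V)) K :=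
    { (matrixEquivTensor (Fin (Module.finrank F V)) F K).symm with
      commutes' := fun r => by
        change (matrixEquivTensor (Fin (Module.finrank F V)) F K).symm (r ⊗ₜ 1) = _
        rw [matrixEquivTensor_apply_symm, Matrix.map_one _ (map_zero _) (map_one _),
          Algebra.algebraMap_eq_smul_one] }
  refine ⟨(Algebra.TensorProduct.congr AlgEquiv.refl e).trans μ, fun a => ?_⟩
  have h1 : ((Algebra.TensorProduct.congr AlgEquiv.refl e).trans μ) ((1 : K) ⊗ₜ[F] a) =
      (e a).map (algebraMap F K) := by
    change (matrixEquivTensor (Fin (Module.finrank F V)) F K).symm (1 ⊗ₜ e a) = _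
    rw [matrixEquivTensor_apply_symm, one_smul]
  rw [h1, LinearMap.trace_eq_matrix_trace F b]
  simp only [Matrix.trace, Matrix.diag_apply, Matrix.map_apply, map_sum]
  rfl

/-- The reduced trace of the split algebra `End_F(V)` is the usual trace. -/
theorem reducedTrace_end (F : Type u) (V : Type v) [Field F] [AddCommGroup V] [Module F V]
    [FiniteDimensional F V] : reducedTrace F (Module.End F V) = LinearMap.trace F V :=
  (isReducedTrace_end F V).reducedTrace_eq

/-! ### Involutions and quadratic pairs -/

/-- An `F`-linear involution of an `F`-algebra. -/
structure AlgInvolution (F : Type u) (A : Type v) [Field F] [Ring A] [Algebra F A] extends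
    A →ₗ[F] A where
  map_mul_rev' : ∀ x y, toFun (x * y) = toFun y * toFun x
  involutive' : ∀ x, toFun (toFun x) = x

section Involutions

variable {F : Type u} {A : Type v} [Field F] [Ring A] [Algebra F A]

instance : CoeFun (AlgInvolution F A) (fun _ => A → A) := ⟨fun σ => σ.toLinearMap⟩

theorem AlgInvolution.map_mul_rev (σ : AlgInvolution F A) (x y : A) : σ (x * y) = σ y * σ x :=
  σ.map_mul_rev' x y

theorem AlgInvolution.apply_apply (σ : AlgInvolution F A) (x : A) : σ (σ x) = x :=
  σ.involutive' x

/-- The space `Sym(A, σ)` of symmetric elements. -/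
def symElts (σ : AlgInvolution F A) : Submodule F A :=
  LinearMap.eqLocus σ.toLinearMap LinearMap.id

theorem mem_symElts {σ : AlgInvolution F A} {x : A} : x ∈ symElts σ ↔ σ x = x := Iff.rfl

theorem add_mem_symElts (σ : AlgInvolution F A) (x : A) : x + σ x ∈ symElts σ := by
  rw [mem_symElts, map_add, σ.apply_apply, add_comm]

/-- An algebra is an algebra over its centre. -/
instance centerAlgebra : Algebra (Subalgebra.center F A) A where
  algebraMap := (Subalgebra.center F A).val.toRingHom
  commutes' r x := (Subalgebra.mem_center_iff.1 r.2 x).symm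
  smul_def' _ _ := rfl

/-- `(σ, f)` is a quadratic pair on `A`, where `A` has centre `Z` étale over `F` and is central
simple (Azumaya) over `Z`: the involution `σ` is the identity on `Z`, the symmetric elements form a
free `Z`-module of rank `n(n+1)/2`, with `n` the degree of `A`, and `f` is a semi-trace, i.e. a
`Z`-linear map `Sym(A, σ) → Z` such that `f(x + σ(x)) = Trd_A(x)` for all `x`. -/
structure IsQuadraticPair (σ : AlgInvolution F A)
    (f : symElts σ →ₗ[F] Subalgebra.center F A) : Prop where
  center_etale : Algebra.Etale F (Subalgebra.center F A)
  map_center : ∀ z ∈ Subalgebra.center F A, σ z = z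
  degree : ∃ n : ℕ,
    IsReducedTrace (Subalgebra.center F A) A n (reducedTrace (Subalgebra.center F A) A) ∧
    ∃ b : Fin (n * (n + 1) / 2) → A, LinearIndependent (Subalgebra.center F A) b ∧
      ∀ x : A, x ∈ Submodule.span (Subalgebra.center F A) (Set.range b) ↔ σ x = x
  map_smul_center : ∀ (z : Subalgebra.center F A) (s : symElts σ) (h : (z : A) * s ∈ symElts σ),
    f ⟨(z : A) * s, h⟩ = z * f s
  semitrace : ∀ x : A,
    f ⟨x + σ x, add_mem_symElts σ x⟩ = reducedTrace (Subalgebra.center F A) A x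

/-- The map `s ↦ Trd_A(u s)` on `Sym(A, σ)`, with values in the centre of `A`. -/
def semitraceOf (σ : AlgInvolution F A) (u : A) : symElts σ →ₗ[F] Subalgebra.center F A :=
  ((reducedTrace (Subalgebra.center F A) A).restrictScalars F).comp
    ((LinearMap.mulLeft F u).comp (symElts σ).subtype)

theorem semitraceOf_apply (σ : AlgInvolution F A) (u : A) (s : symElts σ) :
    semitraceOf σ u s = reducedTrace (Subalgebra.center F A) A (u * s) := rfl

/-- An algebra isomorphism `Φ` is an isomorphism `(A, σ, f) ≃ (B, τ, g)` of algebras with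
quadratic pair: `Φ ∘ σ = τ ∘ Φ` and `g ∘ Φ = Φ ∘ f` on `Sym(A, σ)`. -/
structure PreservesQuadraticPair {B : Type*} [Ring B] [Algebra F B] (Φ : A ≃ₐ[F] B)
    (σ : AlgInvolution F A) (f : symElts σ →ₗ[F] Subalgebra.center F A)
    (τ : AlgInvolution F B) (g : symElts τ →ₗ[F] Subalgebra.center F B) : Prop where
  involution : ∀ x, Φ (σ x) = τ (Φ x)
  semitrace : ∀ (s : symElts σ) (s' : symElts τ), Φ s = s' → Φ (f s : A) = (g s' : B)

/-! ### The Clifford algebra of a central simple algebra with quadratic pair -/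

/-- The sandwich map `Sand(a ⊗ b)(x) = a x b`. -/
def sand (F : Type u) (A : Type v) [Field F] [Ring A] [Algebra F A] :
    A ⊗[F] A →ₗ[F] (A →ₗ[F] A) :=
  TensorProduct.lift (LinearMap.mk₂ F
    (fun a b => (LinearMap.mulRight F b).comp (LinearMap.mulLeft F a))
    (fun _ _ _ => by ext; simp [add_mul]) (fun _ _ _ => by ext; simp)
    (fun _ _ _ => by ext; simp [mul_add]) (fun _ _ _ => by ext; simp))

@[simp]
theorem sand_tmul (a b x : A) : sand F A (a ⊗ₜ b) x = a * x * b := rfl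

/-- `u' = σ₂(u)`, where `σ₂` is defined by `Sand(σ₂(u))(x) = Sand(u)(σ(x))`. -/
def IsSigmaTwo (σ : AlgInvolution F A) (u u' : A ⊗[F] A) : Prop :=
  ∀ x : A, sand F A u' x = sand F A u (σ x)

/-- `ℓ` determines the semi-trace `f`. -/
def Determines (σ : AlgInvolution F A) (f : symElts σ →ₗ[F] F) (l : A) : Prop :=
  l + σ l = 1 ∧ ∀ s : symElts σ, f s = reducedTrace F A (l * s)

/-- The inclusion of `A ⊗ A` in the tensor algebra of `A`. -/
def degreeTwo (F : Type u) (A : Type v) [Field F] [Ring A] [Algebra F A] :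
    A ⊗[F] A →ₗ[F] TensorAlgebra F A :=
  TensorProduct.lift ((LinearMap.mul F (TensorAlgebra F A)).compl₁₂
    (TensorAlgebra.ι F) (TensorAlgebra.ι F))

@[simp]
theorem degreeTwo_tmul (a b : A) :
    degreeTwo F A (a ⊗ₜ b) = TensorAlgebra.ι F a * TensorAlgebra.ι F b := rfl

/-- The relations defining the Clifford algebra of `(A, σ, f)`.  In the second one the value
`Sand(u)(ℓ)` is the same for all elements `ℓ` which determine `f`. -/
inductive CliffordRel (σ : AlgInvolution F A) (f : symElts σ →ₗ[F] F) :
    TensorAlgebra F A → TensorAlgebra F A → Prop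
  | symmetric (s : symElts σ) :
      CliffordRel σ f (TensorAlgebra.ι F (s : A)) (algebraMap F (TensorAlgebra F A) (f s))
  | sandwich (l : A) (hl : Determines σ f l) (u : A ⊗[F] A) (hu : IsSigmaTwo σ u u) :
      CliffordRel σ f (degreeTwo F A u) (TensorAlgebra.ι F (sand F A u l))

/-- The Clifford algebra `C(A, σ, f)`: the quotient of the tensor algebra of the vector space `A`
by the two-sided ideal generated by the relations. -/
abbrev PairClifford (σ : AlgInvolution F A) (f : symElts σ →ₗ[F] F) : Type (max u v) :=
  RingQuot (CliffordRel σ f)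

/-- The canonical map `c : A → C(A, σ, f)`. -/
def canonicalMap (σ : AlgInvolution F A) (f : symElts σ →ₗ[F] F) : A →ₗ[F] PairClifford σ f :=
  (RingQuot.mkAlgHom F (CliffordRel σ f)).toLinearMap.comp (TensorAlgebra.ι F)

/-- The anti-automorphism of the tensor algebra that extends `σ`. -/
def tensorReverse (σ : AlgInvolution F A) :
    TensorAlgebra F A →ₐ[F] (TensorAlgebra F A)ᵐᵒᵖ :=
  TensorAlgebra.lift F
    ((MulOpposite.opLinearEquiv F).toLinearMap.comp ((TensorAlgebra.ι F).comp σ.toLinearMap))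

theorem tensorReverse_ι (σ : AlgInvolution F A) (a : A) :
    tensorReverse σ (TensorAlgebra.ι F a) = MulOpposite.op (TensorAlgebra.ι F (σ a)) := by
  simp [tensorReverse]

/-- `a ⊗ b ↦ σ(b) ⊗ σ(a)`. -/
def flipSigma (σ : AlgInvolution F A) : A ⊗[F] A →ₗ[F] A ⊗[F] A :=
  (TensorProduct.map σ.toLinearMap σ.toLinearMap).comp (TensorProduct.comm F A A).toLinearMap

theorem tensorReverse_degreeTwo (σ : AlgInvolution F A) (u : A ⊗[F] A) :
    tensorReverse σ (degreeTwo F A u) = MulOpposite.op (degreeTwo F A (flipSigma σ u)) := by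
  induction u with
  | zero => simp
  | tmul a b => simp [tensorReverse_ι, flipSigma]
  | add x y hx hy => simp only [map_add, hx, hy, MulOpposite.op_add]

theorem sand_flipSigma (σ : AlgInvolution F A) (u : A ⊗[F] A) (x : A) :
    sand F A (flipSigma σ u) x = σ (sand F A u (σ x)) := by
  induction u with
  | zero => simp
  | tmul a b => simp [flipSigma, σ.map_mul_rev, σ.apply_apply, mul_assoc]
  | add y z hy hz => simp only [map_add, LinearMap.add_apply, hy, hz]

theorem tensorReverse_rel (σ : AlgInvolution F A) (f : symElts σ →ₗ[F] F)
    ⦃x y : TensorAlgebra F A⦄ (h : CliffordRel σ f x y) :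
    (((RingQuot.mkAlgHom F (CliffordRel σ f)).op).comp (tensorReverse σ)) x =
      (((RingQuot.mkAlgHom F (CliffordRel σ f)).op).comp (tensorReverse σ)) y := by
  rw [AlgHom.comp_apply, AlgHom.comp_apply]
  cases h with
  | symmetric s =>
    rw [tensorReverse_ι, mem_symElts.1 s.2, AlgHom.commutes (tensorReverse σ),
      AlgHom.commutes ((RingQuot.mkAlgHom F (CliffordRel σ f)).op)]
    exact congrArg MulOpposite.op ((RingQuot.mkAlgHom_rel F (CliffordRel.symmetric s)).trans
      (AlgHom.commutes (RingQuot.mkAlgHom F (CliffordRel σ f)) (f s)))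
  | sandwich l hl u hu =>
    have hu' : IsSigmaTwo σ (flipSigma σ u) (flipSigma σ u) := fun x => by
      rw [sand_flipSigma, sand_flipSigma, ← hu (σ x)]
    rw [tensorReverse_ι, tensorReverse_degreeTwo]
    have := RingQuot.mkAlgHom_rel F (CliffordRel.sandwich (f := f) l hl _ hu')
    rw [sand_flipSigma, ← hu l] at this
    exact congrArg MulOpposite.op this

/-- The canonical involution of `C(A, σ, f)` as a homomorphism to the opposite algebra. -/
def cliffordReverse (σ : AlgInvolution F A) (f : symElts σ →ₗ[F] F) :
    PairClifford σ f →ₐ[F] (PairClifford σ f)ᵐᵒᵖ :=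
  RingQuot.liftAlgHom F ⟨((RingQuot.mkAlgHom F (CliffordRel σ f)).op).comp (tensorReverse σ),
    tensorReverse_rel σ f⟩

theorem cliffordReverse_canonicalMap (σ : AlgInvolution F A) (f : symElts σ →ₗ[F] F) (a : A) :
    cliffordReverse σ f (canonicalMap σ f a) = MulOpposite.op (canonicalMap σ f (σ a)) := by
  refine (RingQuot.liftAlgHom_mkAlgHom_apply F _ (tensorReverse_rel σ f) _).trans ?_
  rw [AlgHom.comp_apply, tensorReverse_ι]
  rfl

theorem cliffordReverse_cliffordReverse (σ : AlgInvolution F A) (f : symElts σ →ₗ[F] F)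
    (x : PairClifford σ f) :
    (cliffordReverse σ f (cliffordReverse σ f x).unop).unop = x := by
  let ψ : PairClifford σ f →ₐ[F] PairClifford σ f :=
    (AlgEquiv.opOp F (PairClifford σ f)).symm.toAlgHom.comp
      ((cliffordReverse σ f).op.comp (cliffordReverse σ f))
  have : ψ = AlgHom.id F _ := by
    refine RingQuot.ringQuot_ext' F _ _ (TensorAlgebra.hom_ext (LinearMap.ext fun a => ?_))
    change ((cliffordReverse σ f)
      (cliffordReverse σ f (canonicalMap σ f a)).unop).unop = canonicalMap σ f a
    rw [cliffordReverse_canonicalMap, MulOpposite.unop_op, cliffordReverse_canonicalMap,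
      MulOpposite.unop_op, σ.apply_apply]
  exact AlgHom.congr_fun this x

/-- The canonical involution of `C(A, σ, f)`, induced by the involution
`a₁ ⊗ ⋯ ⊗ aᵣ ↦ σ(aᵣ) ⊗ ⋯ ⊗ σ(a₁)` of the tensor algebra. -/
def cliffordInvolution (σ : AlgInvolution F A) (f : symElts σ →ₗ[F] F) :
    AlgInvolution F (PairClifford σ f) where
  toLinearMap := (MulOpposite.opLinearEquiv F).symm.toLinearMap.comp
    (cliffordReverse σ f).toLinearMap
  map_mul_rev' x y := by
    change (cliffordReverse σ f (x * y)).unop = _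
    rw [map_mul]
    rfl
  involutive' x := cliffordReverse_cliffordReverse σ f x

theorem cliffordInvolution_canonicalMap (σ : AlgInvolution F A) (f : symElts σ →ₗ[F] F) (a : A) :
    cliffordInvolution σ f (canonicalMap σ f a) = canonicalMap σ f (σ a) :=
  congrArg MulOpposite.unop (cliffordReverse_canonicalMap σ f a)

/-- `g` is the canonical semi-trace of `C(A, σ, f)`: it is given by `c(a)` for some, and for every,
`a` in `A` of reduced trace `1`. -/
def IsCanonicalSemitrace (σ : AlgInvolution F A) (f : symElts σ →ₗ[F] F)
    (g : symElts (cliffordInvolution σ f) →ₗ[F] Subalgebra.center F (PairClifford σ f)) : Prop :=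
  (∃ a : A, reducedTrace F A a = 1) ∧
    ∀ a : A, reducedTrace F A a = 1 →
      g = semitraceOf (cliffordInvolution σ f) (canonicalMap σ f a)

end Involutions

/-! ### Quadratic spaces -/

section QuadraticSpace

variable {F : Type u} {V : Type v} [Field F] [AddCommGroup V] [Module F V]

/-- The canonical involution of the even Clifford algebra, induced by the identity of `V`. -/
def evenInvolution (q : QuadraticForm F V) : AlgInvolution F (CliffordAlgebra.even q) where
  toLinearMap := (CliffordAlgebra.reverse (Q := q)).restrict
    (p := Subalgebra.toSubmodule (CliffordAlgebra.even q))
    (q := Subalgebra.toSubmodule (CliffordAlgebra.even q))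
    fun _ hx => (CliffordAlgebra.reverse_mem_evenOdd_iff q).2 hx
  map_mul_rev' x y := Subtype.ext (CliffordAlgebra.reverse.map_mul (x : CliffordAlgebra q) y)
  involutive' x := Subtype.ext (CliffordAlgebra.reverse_reverse (x : CliffordAlgebra q))

theorem coe_evenInvolution (q : QuadraticForm F V) (x : CliffordAlgebra.even q) :
    (evenInvolution q x : CliffordAlgebra q) = CliffordAlgebra.reverse (x : CliffordAlgebra q) :=
  rfl

/-- The element `v w` of the even Clifford algebra. -/
def evenMul (q : QuadraticForm F V) (v w : V) : CliffordAlgebra.even q :=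
  (CliffordAlgebra.even.ι q).bilin v w

theorem coe_evenMul (q : QuadraticForm F V) (v w : V) :
    (evenMul q v w : CliffordAlgebra q) = CliffordAlgebra.ι q v * CliffordAlgebra.ι q w := rfl

/-- The form `f_{e,e'}`, given by the element `e e'`. -/
def evenSemitrace (q : QuadraticForm F V) (e e' : V) :
    symElts (evenInvolution q) →ₗ[F] Subalgebra.center F (CliffordAlgebra.even q) :=
  semitraceOf (evenInvolution q) (evenMul q e e')

variable [FiniteDimensional F V]

/-- The standard identification `φ_q : V ⊗ V → End V`, `φ_q(v ⊗ w)(x) = v b_q(w, x)`. -/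
def stdIdent (q : QuadraticForm F V) (hq : LinearMap.BilinForm.Nondegenerate q.polarBilin) :
    V ⊗[F] V ≃ₗ[F] Module.End F V :=
  (TensorProduct.comm F V V).trans
    ((TensorProduct.congr (LinearMap.BilinForm.toDual q.polarBilin hq)
      (LinearEquiv.refl F V)).trans (dualTensorHomEquiv F V V))

theorem stdIdent_tmul (q : QuadraticForm F V)
    (hq : LinearMap.BilinForm.Nondegenerate q.polarBilin) (v w x : V) :
    stdIdent q hq (v ⊗ₜ w) x = QuadraticMap.polar q w x • v := by
  simp [stdIdent, dualTensorHomEquiv, LinearMap.BilinForm.toDual_def]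

/-- The linear map `a ↦ σ_q(a)`, the adjoint with respect to the polar form. -/
def adjointMap (q : QuadraticForm F V) (hq : LinearMap.BilinForm.Nondegenerate q.polarBilin) :
    Module.End F V →ₗ[F] Module.End F V where
  toFun a := LinearMap.BilinForm.leftAdjointOfNondegenerate q.polarBilin hq a
  map_add' a b := by
    refine ((LinearMap.BilinForm.isAdjointPair_iff_eq_of_nondegenerate _ hq _ _).1 ?_).symm
    exact (LinearMap.BilinForm.isAdjointPairLeftAdjointOfNondegenerate _ hq a).add
      (LinearMap.BilinForm.isAdjointPairLeftAdjointOfNondegenerate _ hq b)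
  map_smul' c a := by
    refine ((LinearMap.BilinForm.isAdjointPair_iff_eq_of_nondegenerate _ hq _ _).1 ?_).symm
    exact (LinearMap.BilinForm.isAdjointPairLeftAdjointOfNondegenerate _ hq a).smul c

theorem polar_adjointMap (q : QuadraticForm F V)
    (hq : LinearMap.BilinForm.Nondegenerate q.polarBilin) (a : Module.End F V) (x y : V) :
    QuadraticMap.polar q (adjointMap q hq a x) y = QuadraticMap.polar q x (a y) :=
  LinearMap.BilinForm.isAdjointPairLeftAdjointOfNondegenerate _ hq a x y

theorem eq_adjointMap (q : QuadraticForm F V)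
    (hq : LinearMap.BilinForm.Nondegenerate q.polarBilin) (a a' : Module.End F V)
    (h : ∀ x y, QuadraticMap.polar q (a' x) y = QuadraticMap.polar q x (a y)) :
    adjointMap q hq a = a' :=
  ((LinearMap.BilinForm.isAdjointPair_iff_eq_of_nondegenerate _ hq a' a).1 h).symm

/-- The involution `σ_q` of `End V` adjoint to the polar form of `q`. -/
def adjointInvolution (q : QuadraticForm F V)
    (hq : LinearMap.BilinForm.Nondegenerate q.polarBilin) :
    AlgInvolution F (Module.End F V) where
  toLinearMap := adjointMap q hq
  map_mul_rev' a b := eq_adjointMap q hq _ _ fun x y => by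
    rw [Module.End.mul_apply, Module.End.mul_apply]
    exact (polar_adjointMap q hq b _ y).trans (polar_adjointMap q hq a x _)
  involutive' a := eq_adjointMap q hq _ _ fun x y => by
    rw [QuadraticMap.polar_comm, QuadraticMap.polar_comm q x]
    exact (polar_adjointMap q hq a y x).symm

/-- Under the standard identification, `σ_q` is the exchange `v ⊗ w ↦ w ⊗ v`. -/
theorem adjointInvolution_stdIdent (q : QuadraticForm F V)
    (hq : LinearMap.BilinForm.Nondegenerate q.polarBilin) (v w : V) :
    adjointInvolution q hq (stdIdent q hq (v ⊗ₜ w)) = stdIdent q hq (w ⊗ₜ v) :=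
  eq_adjointMap q hq _ _ fun x y => by
    rw [stdIdent_tmul, stdIdent_tmul, QuadraticMap.polar_smul_left, QuadraticMap.polar_smul_right,
      QuadraticMap.polar_comm q x v, smul_eq_mul, smul_eq_mul, mul_comm]

/-- The semi-trace `f_q` on `(End V, σ_q)`: any bilinear form `β` with `β(v, v) = q(v)` defines a
linear form on `V ⊗ V ≃ End V`, and `f_q` is its restriction to the symmetric elements.  It is the
semi-trace characterized by `f_q(φ_q(v ⊗ v)) = q(v)`. -/
def adjointSemitrace (q : QuadraticForm F V)
    (hq : LinearMap.BilinForm.Nondegenerate q.polarBilin) :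
    symElts (adjointInvolution q hq) →ₗ[F] F :=
  (TensorProduct.lift (LinearMap.BilinMap.toQuadraticMap_surjective q).choose).comp
    ((stdIdent q hq).symm.toLinearMap.comp (symElts (adjointInvolution q hq)).subtype)

theorem adjointSemitrace_stdIdent (q : QuadraticForm F V)
    (hq : LinearMap.BilinForm.Nondegenerate q.polarBilin) (v : V) :
    adjointSemitrace q hq ⟨stdIdent q hq (v ⊗ₜ v), adjointInvolution_stdIdent q hq v v⟩ = q v := by
  have h := (LinearMap.BilinMap.toQuadraticMap_surjective q).choose_spec
  simp only [adjointSemitrace, LinearMap.comp_apply, Submodule.subtype_apply,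
    LinearEquiv.coe_coe, LinearEquiv.symm_apply_apply, TensorProduct.lift.tmul]
  conv_rhs => rw [← h]
  rfl

theorem adjointSemitrace_add (q : QuadraticForm F V)
    (hq : LinearMap.BilinForm.Nondegenerate q.polarBilin) (a : Module.End F V) :
    adjointSemitrace q hq ⟨a + adjointInvolution q hq a, add_mem_symElts _ a⟩ =
      reducedTrace F (Module.End F V) a := by
  rw [reducedTrace_end]
  obtain ⟨t, rfl⟩ := (stdIdent q hq).surjective a
  have h := (LinearMap.BilinMap.toQuadraticMap_surjective q).choose_spec
  set β := (LinearMap.BilinMap.toQuadraticMap_surjective q).choose with hβ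
  change TensorProduct.lift β ((stdIdent q hq).symm
    (stdIdent q hq t + adjointInvolution q hq (stdIdent q hq t))) = _
  induction t with
  | zero => simp
  | add x y hx hy =>
    simp only [map_add] at hx hy ⊢
    rw [← hx, ← hy]
    abel
  | tmul v w =>
    rw [adjointInvolution_stdIdent, ← map_add, LinearEquiv.symm_apply_apply, map_add,
      TensorProduct.lift.tmul, TensorProduct.lift.tmul]
    have h1 : stdIdent q hq (v ⊗ₜ w) = dualTensorHom F V V
        ((q.polarBilin w) ⊗ₜ v) := by
      ext x
      rw [stdIdent_tmul, dualTensorHom_apply]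
      rfl
    rw [h1, LinearMap.trace_eq_contract_apply, contractLeft_apply]
    conv_rhs => rw [← h]
    simp [QuadraticMap.polar]
    abel

end QuadraticSpace

end QuadPair

end

/-! Splitting. Over an algebraic closure `K` the space becomes hyperbolic, and its half-spin
representations, built one hyperbolic plane at a time (`exists_halfSpin`), send C₀(q) to a
K-spanning subset of Mₙ(K) × Mₙ(K), with n = 2^(m-1). Adjoining vectors one by one bounds dim C₀(q)
by 2^(2m-1), so this product is K ⊗ C₀(q) (`exists_splitPair_even`). The intrinsic data are read off
from the splitting, without Galois descent: the centre Z has dimension 2, it is étale because its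
two characters differ, and the traces in the two blocks come from elements of Z
(`exists_center_trace`), which gives Trd.

Involution. For even m each half-spin space carries a bilinear form of sign (-1)^(m/2) adjoint to
the canonical involution; the condition on m and the characteristic makes the sign 1. In terms of
symmetric Gram matrices the involution is transposition, so Sym has dimension 2 · n(n+1)/2 over F.
Conjugation by an anisotropic vector commutes with the involution and exchanges the characters of Z;
its fixed symmetric elements form an F-structure on Sym, and an F-basis of them is a Z-basis of Sym
(`exists_basis`). Whenever u + σ(u) = 1, the map s ↦ Trd(us) is a semi-trace; u = ee' qualifies
because ee' + e'e = b_q(e, e') = 1.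

Isomorphism. Under φ_q a linear map on symmetric elements is tested on the v ⊗ v, and one on
σ₂-symmetric elements on the (a ⊗ v) ⊗ (v ⊗ d). There the relations of C(Ad_q) read v·v = q(v) and
(av)(vd) = q(v)·ad, which are the defining relations of C₀(q).

Semi-traces. Let s be symmetric. If v and w are orthogonal, choose x, y orthogonal to both with
b_q(x, y) = 1, which is possible in dimension above 4. Then vw = z - σ(z) for z = vwxy, so Trd(vws)
= 0. A bilinear map vanishing on orthogonal pairs is a multiple of b_q, hence Trd(c(λ)s) corresponds
to tr(λ) · Trd(ee's) (`reducedTrace_evenLinear_mul`). This yields both the independence of λ and the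
agreement with f_{e,e'}. -/

noncomputable section

namespace QuadPair

universe u v w

/-! ### Algebras split by two matrix blocks -/

/-- A splitting of an `F`-algebra `A` over `K` as a product of two copies of a matrix algebra,
with the two characters by which the centre acts. -/
structure SplitData (F : Type u) (K : Type w) (ι : Type) (A : Type v) [Field F] [Field K]
    [Algebra F K] [Fintype ι] [DecidableEq ι] [Ring A] [Algebra F A] where
  ψ₁ : A →ₐ[F] Matrix ι ι K
  ψ₂ : A →ₐ[F] Matrix ι ι K
  E : K ⊗[F] A ≃ₐ[K] Matrix ι ι K × Matrix ι ι K
  hE : ∀ a, E (1 ⊗ₜ a) = (ψ₁ a, ψ₂ a)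
  χ₁ : Subalgebra.center F A →ₐ[F] K
  χ₂ : Subalgebra.center F A →ₐ[F] K
  hχ₁ : ∀ z : Subalgebra.center F A, ψ₁ z = χ₁ z • (1 : Matrix ι ι K)
  hχ₂ : ∀ z : Subalgebra.center F A, ψ₂ z = χ₂ z • (1 : Matrix ι ι K)

/-- Differentiating the equation of `z₀` gives (2z₀ - T) dz₀ = 0, so the differentials vanish once
the derivative of the polynomial at `z₀` is invertible. A finite unramified algebra over a field is
étale. -/
theorem etale_of_quadratic {F Z : Type*} [Field F] [CommRing Z] [Algebra F Z] [Module.Finite F Z]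
    (z₀ : Z) (hgen : ∀ z : Z, ∃ a b : F, z = algebraMap F Z a + b • z₀) {T N : F}
    (hz : z₀ * z₀ = T • z₀ - algebraMap F Z N) (hu : IsUnit (2 * z₀ - algebraMap F Z T)) :
    Algebra.Etale F Z := by
  have hD : KaehlerDifferential.D F Z z₀ = 0 := by
    have h1 := congrArg (KaehlerDifferential.D F Z) hz
    rw [Derivation.leibniz, map_sub, Derivation.map_smul, Derivation.map_algebraMap, sub_zero] at h1
    have h2 : (2 * z₀ - algebraMap F _ T) • KaehlerDifferential.D F Z z₀
        = 0 := by
      rw [sub_smul, two_mul, add_smul, h1, algebraMap_smul, sub_self]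
    exact (hu.smul_eq_zero).1 h2
  have : Algebra.FormallyUnramified F Z := by
    rw [Algebra.formallyUnramified_iff, ← not_nontrivial_iff_subsingleton]
    intro hn
    have htop := KaehlerDifferential.span_range_derivation F Z
    have hbot : Submodule.span Z
        (Set.range (KaehlerDifferential.D F Z)) = ⊥ := by
      rw [Submodule.span_eq_bot]
      rintro _ ⟨z, rfl⟩
      obtain ⟨a, b, rfl⟩ := hgen z
      rw [map_add, Derivation.map_smul, Derivation.map_algebraMap, hD, smul_zero, add_zero]
    exact bot_ne_top (hbot.symm.trans htop)
  have h1 : Algebra.FormallyEtale F Z := .of_formallyUnramified_of_field _ _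
  have h2 : Algebra.FinitePresentation F Z :=
    Algebra.FinitePresentation.of_finiteType.1 inferInstance
  exact { }

section Construction

variable {F : Type u} {K : Type w} {ι : Type} {A : Type v} [Field F] [Field K]
    [Algebra F K] [Fintype ι] [DecidableEq ι] [Ring A] [Algebra F A]

/-- Because the image spans all matrices over `K`, a central element goes to a matrix commuting with
everything, hence to a scalar. -/
theorem exists_centralCharacter [Nonempty ι] (ψ : A →ₐ[F] Matrix ι ι K)
    (h : ∀ M : Matrix ι ι K, M ∈ Submodule.span K (Set.range ψ)) :
    ∃ χ : Subalgebra.center F A →ₐ[F] K,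
      ∀ z : Subalgebra.center F A, ψ z = χ z • (1 : Matrix ι ι K) := by
  have key : ∀ z : Subalgebra.center F A, ∃ k : K, ψ z = k • (1 : Matrix ι ι K) := by
    intro z
    have hc : ∀ M : Matrix ι ι K, M * ψ z = ψ z * M := by
      intro M
      induction h M using Submodule.span_induction with
      | mem x hx =>
        obtain ⟨a, rfl⟩ := hx
        rw [← map_mul, ← map_mul, Subalgebra.mem_center_iff.1 z.2 a]
      | zero => simp
      | add x y _ _ hx hy => rw [add_mul, mul_add, hx, hy]
      | smul c x _ hx => rw [smul_mul_assoc, mul_smul_comm, hx]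
    obtain ⟨k, hk⟩ := Matrix.mem_range_scalar_of_commute_single (M := ψ z)
      (fun i j _ => hc _)
    exact ⟨k, by rw [← hk, Matrix.smul_one_eq_diagonal]; rfl⟩
  choose χ hχ using key
  have inj : ∀ k l : K, k • (1 : Matrix ι ι K) = l • (1 : Matrix ι ι K) → k = l := by
    intro k l hkl
    obtain ⟨i⟩ := ‹Nonempty ι›
    simpa using congrFun (congrFun hkl i) i
  refine ⟨AlgHom.ofLinearMap
    { toFun := χ, map_add' := fun x y => inj _ _ ?_, map_smul' := fun c x => inj _ _ ?_ }
    (inj _ _ ?_) (fun x y => inj _ _ ?_), hχ⟩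
  · rw [← hχ, add_smul, ← hχ, ← hχ, ← map_add]; rfl
  · rw [← hχ, RingHom.id_apply, smul_assoc, ← hχ, ← map_smul]; rfl
  · change χ 1 • _ = _
    rw [← hχ, one_smul]; exact map_one ψ
  · change χ (x * y) • _ = (χ x * χ y) • _
    rw [← hχ, mul_smul, ← hχ y, ← one_mul (ψ y), ← smul_mul_assoc, ← hχ, ← map_mul]; rfl

/-- Two representations over `K` whose joint image spans, in the right dimension, are a
splitting. -/
theorem exists_splitting [Module.Finite F A] (ψ₁ ψ₂ : A →ₐ[F] Matrix ι ι K)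
    (hspan : ∀ p : Matrix ι ι K × Matrix ι ι K,
      p ∈ Submodule.span K (Set.range fun a => (ψ₁ a, ψ₂ a)))
    (hdim : Module.finrank F A ≤ 2 * Fintype.card ι ^ 2) :
    ∃ E : K ⊗[F] A ≃ₐ[K] Matrix ι ι K × Matrix ι ι K, ∀ a, E (1 ⊗ₜ a) = (ψ₁ a, ψ₂ a) := by
  let L : K ⊗[F] A →ₐ[K] Matrix ι ι K × Matrix ι ι K :=
    Algebra.TensorProduct.lift (Algebra.ofId K _) (ψ₁.prod ψ₂) (fun k a => Algebra.commutes k _)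
  have hL : ∀ a, L (1 ⊗ₜ a) = (ψ₁ a, ψ₂ a) := fun a =>
    (Algebra.TensorProduct.lift_tmul _ _ _ _ _).trans (by rw [map_one, one_mul]; rfl)
  have hsurj : Function.Surjective L.toLinearMap := by
    rw [← LinearMap.range_eq_top, eq_top_iff]
    intro p _
    refine Submodule.span_le.2 ?_ (hspan p)
    rintro _ ⟨a, rfl⟩
    exact ⟨1 ⊗ₜ a, hL a⟩
  have hinj : Function.Injective L.toLinearMap := by
    -- Surjectivity already bounds the dimension from below, so an upper bound for dim A is enough.
    have hle : Module.finrank K (K ⊗[F] A) ≤ Module.finrank K (Matrix ι ι K × Matrix ι ι K) := by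
      rw [Module.finrank_baseChange, Module.finrank_prod, Module.finrank_matrix]
      simp only [Module.finrank_self]
      nlinarith
    have hge := LinearMap.finrank_le_finrank_of_surjective hsurj
    exact (LinearMap.injective_iff_surjective_of_finrank_eq_finrank
      (le_antisymm hle hge)).2 hsurj
  exact ⟨AlgEquiv.ofBijective L ⟨hinj, hsurj⟩, hL⟩

theorem mem_span_range_fst {ψ₁ ψ₂ : A →ₐ[F] Matrix ι ι K}
    (hspan : ∀ p : Matrix ι ι K × Matrix ι ι K,
      p ∈ Submodule.span K (Set.range fun a => (ψ₁ a, ψ₂ a))) (M : Matrix ι ι K) :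
    M ∈ Submodule.span K (Set.range ψ₁) := by
  have := Submodule.mem_map_of_mem (f := LinearMap.fst K _ _) (hspan (M, 0))
  rw [Submodule.map_span, ← Set.range_comp] at this
  exact this

theorem mem_span_range_snd {ψ₁ ψ₂ : A →ₐ[F] Matrix ι ι K}
    (hspan : ∀ p : Matrix ι ι K × Matrix ι ι K,
      p ∈ Submodule.span K (Set.range fun a => (ψ₁ a, ψ₂ a))) (M : Matrix ι ι K) :
    M ∈ Submodule.span K (Set.range ψ₂) := by
  have := Submodule.mem_map_of_mem (f := LinearMap.snd K _ _) (hspan (0, M))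
  rw [Submodule.map_span, ← Set.range_comp] at this
  exact this

theorem exists_splitData [Nonempty ι] [Module.Finite F A] (ψ₁ ψ₂ : A →ₐ[F] Matrix ι ι K)
    (hspan : ∀ p : Matrix ι ι K × Matrix ι ι K,
      p ∈ Submodule.span K (Set.range fun a => (ψ₁ a, ψ₂ a)))
    (hdim : Module.finrank F A ≤ 2 * Fintype.card ι ^ 2) :
    ∃ D : SplitData F K ι A, D.ψ₁ = ψ₁ ∧ D.ψ₂ = ψ₂ := by
  obtain ⟨E, hE⟩ := exists_splitting ψ₁ ψ₂ hspan hdim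
  obtain ⟨χ₁, h₁⟩ := exists_centralCharacter ψ₁ (mem_span_range_fst hspan)
  obtain ⟨χ₂, h₂⟩ := exists_centralCharacter ψ₂ (mem_span_range_snd hspan)
  exact ⟨⟨ψ₁, ψ₂, E, hE, χ₁, χ₂, h₁, h₂⟩, rfl, rfl⟩

end Construction

/-! ### The centre is a quadratic étale algebra -/

namespace SplitData

variable {F : Type u} {K : Type w} {ι : Type} {A : Type v} [Field F] [Field K]
    [Algebra F K] [Fintype ι] [DecidableEq ι] [Ring A] [Algebra F A] (D : SplitData F K ι A)

/-- Exchange of the two factors. -/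
def swap : SplitData F K ι A where
  ψ₁ := D.ψ₂
  ψ₂ := D.ψ₁
  E := D.E.trans (AlgEquiv.ofRingEquiv (f := RingEquiv.prodComm) fun _ => rfl)
  hE a := (congrArg Prod.swap (D.hE a) :)
  χ₁ := D.χ₂
  χ₂ := D.χ₁
  hχ₁ := D.hχ₂
  hχ₂ := D.hχ₁

theorem mem_span (p : Matrix ι ι K × Matrix ι ι K) :
    p ∈ Submodule.span K (Set.range fun a => (D.ψ₁ a, D.ψ₂ a)) := by
  obtain ⟨t, rfl⟩ := D.E.surjective p
  induction t with
  | zero => simp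
  | add x y hx hy => rw [map_add]; exact add_mem hx hy
  | tmul k a =>
    have : k ⊗ₜ[F] a = k • ((1 : K) ⊗ₜ[F] a) := by simp [TensorProduct.smul_tmul']
    rw [this, map_smul, D.hE]
    exact Submodule.smul_mem _ _ (Submodule.subset_span ⟨a, rfl⟩)

theorem ext_of_eq {a b : A} (h₁ : D.ψ₁ a = D.ψ₁ b) (h₂ : D.ψ₂ a = D.ψ₂ b) : a = b := by
  have h : D.E (1 ⊗ₜ a) = D.E (1 ⊗ₜ b) := by rw [D.hE, D.hE, h₁, h₂]
  exact (Algebra.TensorProduct.includeRight_injective (algebraMap F K).injective)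
    (D.E.injective h)

theorem center_ext {z z' : Subalgebra.center F A} (h₁ : D.χ₁ z = D.χ₁ z')
    (h₂ : D.χ₂ z = D.χ₂ z') : z = z' :=
  Subtype.ext (D.ext_of_eq (by rw [D.hχ₁, D.hχ₁, h₁]) (by rw [D.hχ₂, D.hχ₂, h₂]))

/-- The two characters of the centre, extended to `K`. -/
def centerLift : K ⊗[F] Subalgebra.center F A →ₗ[K] K × K :=
  LinearMap.liftBaseChange K (D.χ₁.toLinearMap.prod D.χ₂.toLinearMap)

theorem E_map_center (t : K ⊗[F] Subalgebra.center F A) :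
    D.E (Algebra.TensorProduct.map (AlgHom.id F K) (Subalgebra.center F A).val t) =
      ((D.centerLift t).1 • 1, (D.centerLift t).2 • 1) := by
  induction t with
  | zero => simp only [map_zero, Prod.fst_zero, Prod.snd_zero, zero_smul]; rfl
  | add x y hx hy => rw [map_add, map_add, hx, hy]; simp [add_smul]
  | tmul k a =>
    have : k ⊗ₜ[F] (a : A) = k • ((1 : K) ⊗ₜ[F] (a : A)) := by simp [TensorProduct.smul_tmul']
    simp only [Algebra.TensorProduct.map_tmul, AlgHom.coe_id, id_eq, Subalgebra.coe_val]
    rw [this, map_smul, D.hE, D.hχ₁, D.hχ₂]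
    simp [centerLift, smul_smul]

/-- A pair of scalars commutes with everything, so it corresponds to an element of K ⊗ A
centralizing A, and that centralizer is K ⊗ Z. With injectivity, which is flatness, this identifies
K ⊗ Z with K × K. -/
theorem centerLift_surjective [Nonempty ι] : Function.Surjective D.centerLift := by
  rintro ⟨k, l⟩
  have hmem : D.E.symm (k • 1, l • 1) ∈ Subalgebra.centralizer F
      ((Algebra.TensorProduct.includeRight : A →ₐ[F] K ⊗[F] A).range : Set (K ⊗[F] A)) := by
    rw [Subalgebra.mem_centralizer_iff]
    intro x _
    apply D.E.injective
    rw [map_mul, map_mul, AlgEquiv.apply_symm_apply]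
    simp [Prod.ext_iff]
  rw [Subalgebra.centralizer_range_includeRight_eq_center_tensorProduct] at hmem
  obtain ⟨t, ht⟩ := hmem
  refine ⟨t, ?_⟩
  have h := D.E_map_center t
  rw [show Algebra.TensorProduct.map (AlgHom.id F K) (Subalgebra.center F A).val t = _ from ht,
    AlgEquiv.apply_symm_apply] at h
  obtain ⟨i⟩ := ‹Nonempty ι›
  have h1 := congrFun (congrFun (congrArg Prod.fst h) i) i
  have h2 := congrFun (congrFun (congrArg Prod.snd h) i) i
  simp at h1 h2
  exact Prod.ext h1.symm h2.symm

theorem centerLift_injective : Function.Injective D.centerLift := by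
  intro s t h
  have h' : D.E (Algebra.TensorProduct.map (AlgHom.id F K) (Subalgebra.center F A).val s) =
      D.E (Algebra.TensorProduct.map (AlgHom.id F K) (Subalgebra.center F A).val t) := by
    rw [E_map_center, E_map_center, h]
  exact Module.Flat.lTensor_preserves_injective_linearMap (M := K)
    (Subalgebra.center F A).val.toLinearMap Subtype.val_injective (D.E.injective h')

theorem finrank_center [Nonempty ι] (D : SplitData F K ι A) : Module.finrank F (Subalgebra.center F A) = 2 := by
  rw [← Module.finrank_baseChange (R := K),
    (LinearEquiv.ofBijective _ ⟨D.centerLift_injective, D.centerLift_surjective⟩).finrank_eq]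
  simp

/-- Equal characters would confine `centerLift` to the diagonal of K × K. -/
theorem exists_ne [Nonempty ι] : ∃ z, D.χ₁ z ≠ D.χ₂ z := by
  by_contra! h
  have key : ∀ t, (D.centerLift t).1 = (D.centerLift t).2 := by
    intro t
    induction t with
    | zero => simp
    | add x y hx hy => simp [hx, hy]
    | tmul k a => simp [centerLift, h]
  obtain ⟨t, ht⟩ := D.centerLift_surjective (1, 0)
  have := key t
  simp [ht] at this

theorem eq_add_smul [Nonempty ι] {z₀ : Subalgebra.center F A} (h : D.χ₁ z₀ ≠ D.χ₂ z₀)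
    (z : Subalgebra.center F A) : ∃ a b : F, z = algebraMap F _ a + b • z₀ := by
  have hli : LinearIndependent F ![1, z₀] := by
    rw [LinearIndependent.pair_iff]
    intro s t hst
    have h1 := congrArg D.χ₁ hst
    have h2 := congrArg D.χ₂ hst
    simp only [map_add, map_smul, map_one, map_zero] at h1 h2
    have h3 : t • (D.χ₁ z₀ - D.χ₂ z₀) = 0 := by
      rw [smul_sub, sub_eq_zero]
      exact add_left_cancel (h1.trans h2.symm)
    have ht : t = 0 := (smul_eq_zero.1 h3).resolve_right (sub_ne_zero.2 h)
    refine ⟨?_, ht⟩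
    rw [ht, zero_smul, add_zero] at h1
    exact (smul_eq_zero.1 h1).resolve_right one_ne_zero
  have htop := hli.span_eq_top_of_card_eq_finrank (by simp [D.finrank_center])
  have hz : z ∈ Submodule.span F (Set.range ![1, z₀]) := htop ▸ Submodule.mem_top
  rw [Matrix.range_cons, Matrix.range_cons, Matrix.range_empty, Set.union_empty,
    Set.singleton_union, Submodule.mem_span_pair] at hz
  obtain ⟨a, b, hab⟩ := hz
  exact ⟨a, b, by rw [← hab, Algebra.algebraMap_eq_smul_one]⟩

/-- A generator of the centre is a root of a quadratic polynomial over `F`, with roots the values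
of the two characters. -/
theorem exists_quadratic [Nonempty ι] {z₀ : Subalgebra.center F A} (h : D.χ₁ z₀ ≠ D.χ₂ z₀) :
    ∃ T N : F, z₀ * z₀ = T • z₀ - algebraMap F _ N ∧
      algebraMap F K T = D.χ₁ z₀ + D.χ₂ z₀ ∧ algebraMap F K N = D.χ₁ z₀ * D.χ₂ z₀ := by
  obtain ⟨a, b, hab⟩ := D.eq_add_smul h (z₀ * z₀)
  have h1 := congrArg D.χ₁ hab
  have h2 := congrArg D.χ₂ hab
  simp only [map_add, map_mul, AlgHom.commutes, Algebra.smul_def] at h1 h2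
  have hb : algebraMap F K b = D.χ₁ z₀ + D.χ₂ z₀ := by
    refine mul_right_cancel₀ (sub_ne_zero.2 h) ?_
    linear_combination h2 - h1
  refine ⟨b, -a, ?_, hb, ?_⟩
  · rw [hab, map_neg, sub_neg_eq_add, add_comm]
  · rw [map_neg]
    linear_combination h1 + (D.χ₁ z₀) * hb

theorem center_finite [Nonempty ι] (D : SplitData F K ι A) : Module.Finite F (Subalgebra.center F A) :=
  Module.finite_of_finrank_pos (by rw [D.finrank_center]; norm_num)

theorem center_reduced (D : SplitData F K ι A) : IsReduced (Subalgebra.center F A) where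
  eq_zero z hz := D.center_ext
    (by rw [map_zero]; exact (hz.map D.χ₁).eq_zero) (by rw [map_zero]; exact (hz.map D.χ₂).eq_zero)

theorem isUnit_of_ne_zero [Nonempty ι] (D : SplitData F K ι A) {z : Subalgebra.center F A} (h₁ : D.χ₁ z ≠ 0)
    (h₂ : D.χ₂ z ≠ 0) : IsUnit z := by
  have := D.center_finite
  have hinj : Function.Injective (LinearMap.mulLeft F z) := by
    rw [← LinearMap.ker_eq_bot, LinearMap.ker_eq_bot']
    intro y hy
    have e1 := congrArg D.χ₁ hy
    have e2 := congrArg D.χ₂ hy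
    simp only [LinearMap.mulLeft_apply, map_mul, map_zero, mul_eq_zero, h₁, h₂,
      false_or] at e1 e2
    exact D.center_ext (by rw [e1, map_zero]) (by rw [e2, map_zero])
  obtain ⟨y, hy⟩ := (LinearMap.injective_iff_surjective.1 hinj) 1
  exact IsUnit.of_mul_eq_one y hy

theorem center_etale [Nonempty ι] (D : SplitData F K ι A) : Algebra.Etale F (Subalgebra.center F A) := by
  have := D.center_finite
  obtain ⟨z₀, h⟩ := D.exists_ne
  obtain ⟨T, N, hz, hT, -⟩ := D.exists_quadratic h
  -- T is the sum of the two values of `z₀`, so the characters take 2z₀ - T to χ₁(z₀) - χ₂(z₀) and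
  -- to its negative, both nonzero.
  have hu : IsUnit (2 * z₀ - algebraMap F _ T) := by
    apply D.isUnit_of_ne_zero
    · rw [map_sub, map_mul, map_ofNat, AlgHom.commutes, hT]
      intro h0
      exact h (by linear_combination h0)
    · rw [map_sub, map_mul, map_ofNat, AlgHom.commutes, hT]
      intro h0
      exact h (by linear_combination -h0)
  exact etale_of_quadratic z₀ (D.eq_add_smul h) hz hu

end SplitData

/-! ### Traces of matrices -/

section MatrixTrace

variable {K : Type*} [Field K] {ι : Type*} [Fintype ι] [DecidableEq ι]

/-- Modulo commutators, a matrix is determined by its trace. -/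
theorem sub_trace_smul_single_mem (S : Submodule K (Matrix ι ι K))
    (hS : ∀ M N : Matrix ι ι K, M * N - N * M ∈ S) (i₀ : ι) (M : Matrix ι ι K) :
    M - M.trace • Matrix.single i₀ i₀ 1 ∈ S := by
  -- This difference is the commutator of the elementary matrices at (i, i₀) and (i₀, j).
  have key : ∀ i j : ι, Matrix.single i j (1 : K) -
      (if i = j then (1 : K) else 0) • Matrix.single i₀ i₀ 1 ∈ S := by
    intro i j
    have h := hS (Matrix.single i i₀ 1) (Matrix.single i₀ j 1)
    rw [Matrix.single_mul_single_same, mul_one] at h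
    rcases eq_or_ne i j with rfl | hij
    · rw [Matrix.single_mul_single_same, mul_one] at h
      simpa using h
    · rw [Matrix.single_mul_single_of_ne _ _ _ _ hij.symm, sub_zero] at h
      simpa [hij] using h
  have h2 : M - M.trace • Matrix.single i₀ i₀ 1 = ∑ i, ∑ j, M i j • (Matrix.single i j (1 : K) -
      (if i = j then (1 : K) else 0) • Matrix.single i₀ i₀ 1) := by
    simp only [smul_sub, Finset.sum_sub_distrib]
    congr 1
    · conv_lhs => rw [Matrix.matrix_eq_sum_single M]
      simp [Matrix.smul_single]
    · simp [Matrix.trace, Finset.sum_smul]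
  rw [h2]
  exact Submodule.sum_mem _ fun i _ => Submodule.sum_mem _ fun j _ => S.smul_mem _ (key i j)

/-- In both double sums the terms off the diagonal cancel in pairs, and the diagonal terms agree.
This replaces division by the degree, which may vanish in characteristic 2. -/
theorem trace_mul_self_of_char_two (h2 : (2 : K) = 0) (M : Matrix ι ι K) :
    (M * M).trace = M.trace * M.trace := by
  have : CharP K 2 := CharTwo.of_one_ne_zero_of_two_eq_zero one_ne_zero h2
  have hsym : ∀ i j : ι, M i j * M j i = M j i * M i j := fun i j => mul_comm _ _
  have h1 : (M * M).trace = ∑ p : ι × ι, M p.1 p.2 * M p.2 p.1 := by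
    rw [Fintype.sum_prod_type]
    simp [Matrix.trace, Matrix.mul_apply]
  have h3 : M.trace * M.trace = ∑ p : ι × ι, M p.1 p.1 * M p.2 p.2 := by
    rw [Fintype.sum_prod_type]
    simp [Matrix.trace, Finset.sum_mul_sum]
  have hd : ∀ f : ι × ι → K, (∀ p, f p.swap = f p) → ∑ p, f p = ∑ i, f (i, i) := by
    intro f hf
    rw [← Finset.sum_filter_add_sum_filter_not Finset.univ (fun p : ι × ι => p.1 = p.2)]
    have ho : ∑ p with ¬ (p : ι × ι).1 = p.2, f p = 0 := by
      refine Finset.sum_involution (fun p _ => p.swap) ?_ ?_ ?_ ?_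
      · intro p _
        rw [hf, ← two_mul, h2, zero_mul]
      · rintro ⟨i, j⟩ hp _ h
        simp only [Finset.mem_filter] at hp
        exact hp.2 (Prod.ext_iff.1 h).2
      · rintro ⟨i, j⟩ hp
        simpa [eq_comm] using hp
      · simp
    rw [ho, add_zero]
    refine Finset.sum_nbij' (fun p => p.1) (fun i => (i, i)) ?_ ?_ ?_ ?_ ?_
    · simp
    · simp
    · rintro ⟨i, j⟩ h
      simp at h
      simp [h]
    · simp
    · rintro ⟨i, j⟩ h
      simp at h
      simp [h]
  rw [h1, h3, hd _ (fun p => by simp [mul_comm]), hd _ (fun p => by simp [mul_comm])]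

end MatrixTrace

/-! ### Traces with values in the centre -/

namespace SplitData

variable {F : Type u} {K : Type w} {ι : Type} {A : Type v} [Field F] [Field K]
    [Algebra F K] [Fintype ι] [DecidableEq ι] [Ring A] [Algebra F A] (D : SplitData F K ι A)

theorem finrank_eq (D : SplitData F K ι A) : Module.finrank F A = 2 * Fintype.card ι ^ 2 := by
  rw [← Module.finrank_baseChange (R := K), D.E.toLinearEquiv.finrank_eq, Module.finrank_prod,
    Module.finrank_matrix]
  simp only [Module.finrank_self]
  ring

theorem module_finite [Nonempty ι] (D : SplitData F K ι A) : Module.Finite F A :=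
  Module.finite_of_finrank_pos (by rw [D.finrank_eq]; have := Fintype.card_pos (α := ι); positivity)

/-- A subspace of `A` whose image spans over `K` is everything. -/
theorem eq_top_of_span_eq_top [Nonempty ι] (W : Submodule F A)
    (h : Submodule.span K ((fun a => (D.ψ₁ a, D.ψ₂ a)) '' W) = ⊤) : W = ⊤ := by
  have := D.module_finite
  apply Submodule.eq_top_of_finrank_eq
  apply le_antisymm (Submodule.finrank_le W)
  rw [D.finrank_eq]
  let f : K ⊗[F] W →ₗ[K] Matrix ι ι K × Matrix ι ι K :=
    LinearMap.liftBaseChange K ((D.ψ₁.toLinearMap.prod D.ψ₂.toLinearMap).comp W.subtype)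
  have hf : Function.Surjective f := by
    rw [← LinearMap.range_eq_top, eq_top_iff, ← h, Submodule.span_le]
    rintro _ ⟨a, ha, rfl⟩
    exact ⟨1 ⊗ₜ ⟨a, ha⟩, by simp [f]⟩
  have := LinearMap.finrank_le_finrank_of_surjective hf
  rw [Module.finrank_baseChange, Module.finrank_prod, Module.finrank_matrix] at this
  simp only [Module.finrank_self] at this
  linarith

/-- The trace of every element is a multiple by the centre of the trace of `x₀`. -/
theorem exists_trace_eq [Nonempty ι] {x₀ : A} (h₁ : (D.ψ₁ x₀).trace ≠ 0)
    (h₂ : (D.ψ₂ x₀).trace ≠ 0) (a : A) :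
    ∃ z : Subalgebra.center F A, (D.ψ₁ a).trace = D.χ₁ z * (D.ψ₁ x₀).trace ∧
      (D.ψ₂ a).trace = D.χ₂ z * (D.ψ₂ x₀).trace := by
  -- `W` contains all commutators (with z = 0) and Z·x₀. Modulo commutators a pair of matrices is
  -- determined by its two traces, and those of `x₀` are nonzero, so `W` spans both blocks over `K`.
  let W : Submodule F A :=
    { carrier := {a | ∃ z : Subalgebra.center F A, (D.ψ₁ a).trace = D.χ₁ z * (D.ψ₁ x₀).trace ∧
        (D.ψ₂ a).trace = D.χ₂ z * (D.ψ₂ x₀).trace}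
      zero_mem' := ⟨0, by simp⟩
      add_mem' := by
        rintro a b ⟨z, hz₁, hz₂⟩ ⟨z', hz₁', hz₂'⟩
        exact ⟨z + z', by simp [add_mul, hz₁, hz₁'], by simp [add_mul, hz₂, hz₂']⟩
      smul_mem' := by
        rintro c a ⟨z, hz₁, hz₂⟩
        exact ⟨c • z, by simp [hz₁], by simp [hz₂]⟩ }
  suffices hW : W = ⊤ by
    have : a ∈ W := hW ▸ Submodule.mem_top
    exact this
  apply D.eq_top_of_span_eq_top
  set S := Submodule.span K ((fun a => (D.ψ₁ a, D.ψ₂ a)) '' (W : Set A)) with hSdef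
  have hWS : ∀ a ∈ W, (D.ψ₁ a, D.ψ₂ a) ∈ S := fun a ha => Submodule.subset_span ⟨a, ha, rfl⟩
  have hcomm : ∀ p r : Matrix ι ι K × Matrix ι ι K, p * r - r * p ∈ S := by
    intro p r
    induction D.mem_span p using Submodule.span_induction with
    | mem x hx =>
      obtain ⟨a, rfl⟩ := hx
      induction D.mem_span r using Submodule.span_induction with
      | mem y hy =>
        obtain ⟨b, rfl⟩ := hy
        have : a * b - b * a ∈ W := ⟨0, by
          simp only [map_sub, map_mul, Matrix.trace_sub, map_zero, zero_mul]
          exact ⟨by rw [Matrix.trace_mul_comm, sub_self], by rw [Matrix.trace_mul_comm, sub_self]⟩⟩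
        have h := hWS _ this
        simpa using h
      | zero => simp
      | add y y' _ _ hy hy' =>
        rw [mul_add, add_mul, add_sub_add_comm]; exact add_mem hy hy'
      | smul c y _ hy =>
        rw [mul_smul_comm, smul_mul_assoc, ← smul_sub]; exact S.smul_mem _ hy
    | zero => simp
    | add y y' _ _ hy hy' =>
      rw [mul_add, add_mul, add_sub_add_comm]; exact add_mem hy hy'
    | smul c y _ hy =>
      rw [mul_smul_comm, smul_mul_assoc, ← smul_sub]; exact S.smul_mem _ hy
  have hx₀ : ∀ k l : K, (k • D.ψ₁ x₀, l • D.ψ₂ x₀) ∈ S := by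
    intro k l
    obtain ⟨t, ht⟩ := D.centerLift_surjective (k, l)
    have key : ∀ t, ((D.centerLift t).1 • D.ψ₁ x₀, (D.centerLift t).2 • D.ψ₂ x₀) ∈ S := by
      intro t
      induction t with
      | zero =>
        simp only [map_zero, Prod.fst_zero, Prod.snd_zero, zero_smul]
        exact S.zero_mem
      | add x y hx hy =>
        have := add_mem hx hy
        simpa [add_smul] using this
      | tmul c z =>
        have hz : (z : A) * x₀ ∈ W := ⟨z, by simp [D.hχ₁], by simp [D.hχ₂]⟩
        have := S.smul_mem c (hWS _ hz)
        simpa [centerLift, D.hχ₁, D.hχ₂, smul_smul] using this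
    simpa [ht] using key t
  obtain ⟨i₀⟩ := ‹Nonempty ι›
  have hfst : ∀ M : Matrix ι ι K, (M, (0 : Matrix ι ι K)) ∈ S := by
    have hc := sub_trace_smul_single_mem (S.comap (LinearMap.inl K _ _))
      (fun M N => by simpa using hcomm (M, 0) (N, 0)) i₀
    have h0 : Matrix.single i₀ i₀ (1 : K) ∈ S.comap (LinearMap.inl K _ (Matrix ι ι K)) := by
      have ha : D.ψ₁ x₀ ∈ S.comap (LinearMap.inl K _ (Matrix ι ι K)) := by
        simpa using hx₀ 1 0
      have := Submodule.smul_mem _ (D.ψ₁ x₀).trace⁻¹ (sub_mem ha (hc (D.ψ₁ x₀)))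
      rwa [sub_sub_cancel, smul_smul, inv_mul_cancel₀ h₁, one_smul] at this
    intro M
    have := add_mem (hc M) (Submodule.smul_mem _ M.trace h0)
    rwa [sub_add_cancel] at this
  have hsnd : ∀ M : Matrix ι ι K, ((0 : Matrix ι ι K), M) ∈ S := by
    have hc := sub_trace_smul_single_mem (S.comap (LinearMap.inr K _ _))
      (fun M N => by simpa using hcomm (0, M) (0, N)) i₀
    have h0 : Matrix.single i₀ i₀ (1 : K) ∈ S.comap (LinearMap.inr K (Matrix ι ι K) _) := by
      have ha : D.ψ₂ x₀ ∈ S.comap (LinearMap.inr K (Matrix ι ι K) _) := by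
        simpa using hx₀ 0 1
      have := Submodule.smul_mem _ (D.ψ₂ x₀).trace⁻¹ (sub_mem ha (hc (D.ψ₂ x₀)))
      rwa [sub_sub_cancel, smul_smul, inv_mul_cancel₀ h₂, one_smul] at this
    intro M
    have := add_mem (hc M) (Submodule.smul_mem _ M.trace h0)
    rwa [sub_add_cancel] at this
  rw [eq_top_iff]
  rintro ⟨M, N⟩ _
  simpa using add_mem (hfst M) (hsnd N)

theorem exists_trace_ne_zero_fst [Nonempty ι] (D : SplitData F K ι A) :
    ∃ a, (D.ψ₁ a).trace ≠ 0 := by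
  by_contra! h
  obtain ⟨i⟩ := ‹Nonempty ι›
  have key : ∀ p : Matrix ι ι K × Matrix ι ι K, p.1.trace = 0 := by
    intro p
    induction D.mem_span p using Submodule.span_induction with
    | mem x hx => obtain ⟨a, rfl⟩ := hx; exact h a
    | zero => simp
    | add x y _ _ hx hy => simp [hx, hy]
    | smul c x _ hx => simp [hx]
  have := key (Matrix.single i i 1, 0)
  simp at this

/-- Some element has nonzero trace in both factors. -/
theorem exists_trace_ne_zero [Nonempty ι] (D : SplitData F K ι A) :
    ∃ a, (D.ψ₁ a).trace ≠ 0 ∧ (D.ψ₂ a).trace ≠ 0 := by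
  obtain ⟨a, ha⟩ := D.exists_trace_ne_zero_fst
  obtain ⟨b, hb⟩ := D.swap.exists_trace_ne_zero_fst
  change (D.ψ₂ b).trace ≠ 0 at hb
  by_cases ha' : (D.ψ₂ a).trace = 0
  · by_cases hb' : (D.ψ₁ b).trace = 0
    · exact ⟨a + b, by simpa [hb'] using ha, by simpa [ha'] using hb⟩
    · exact ⟨b, hb', hb⟩
  · exact ⟨a, ha, ha'⟩

/-- The traces of the two factors come from the centre. -/
theorem exists_center_trace [Nonempty ι] (hn : (2 : K) = 0 ∨ (Fintype.card ι : K) ≠ 0) (a : A) :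
    ∃ z : Subalgebra.center F A, D.χ₁ z = (D.ψ₁ a).trace ∧ D.χ₂ z = (D.ψ₂ a).trace := by
  suffices h : ∃ x₀ : A, ∃ z₀ : Subalgebra.center F A, (D.ψ₁ x₀).trace ≠ 0 ∧
      (D.ψ₂ x₀).trace ≠ 0 ∧ D.χ₁ z₀ = (D.ψ₁ x₀).trace ∧ D.χ₂ z₀ = (D.ψ₂ x₀).trace by
    obtain ⟨x₀, z₀, h₁, h₂, hz₁, hz₂⟩ := h
    obtain ⟨z, hz, hz'⟩ := D.exists_trace_eq h₁ h₂ a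
    exact ⟨z * z₀, by rw [map_mul, hz₁, hz], by rw [map_mul, hz₂, hz']⟩
  -- In characteristic 2 the trace of x₀² is tr(x₀)², and it is also z·tr(x₀) for a central z;
  -- cancelling tr(x₀) in each block shows that z gives the trace of `x₀`. Otherwise x₀ = 1 works,
  -- its trace being the nonzero degree.
  rcases hn with h2 | hn
  · obtain ⟨x₀, h₁, h₂⟩ := D.exists_trace_ne_zero
    obtain ⟨z, hz, hz'⟩ := D.exists_trace_eq h₁ h₂ (x₀ * x₀)
    rw [map_mul, trace_mul_self_of_char_two h2] at hz hz'
    exact ⟨x₀, z, h₁, h₂, (mul_right_cancel₀ h₁ hz).symm, (mul_right_cancel₀ h₂ hz').symm⟩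
  · exact ⟨1, (Fintype.card ι : Subalgebra.center F A), by simpa using hn, by simpa using hn,
      by simp, by simp⟩

/-- The trace of `A` with values in its centre. -/
theorem exists_centerTrace [Nonempty ι] (hn : (2 : K) = 0 ∨ (Fintype.card ι : K) ≠ 0) :
    ∃ t : A →ₗ[Subalgebra.center F A] Subalgebra.center F A,
      ∀ a, D.χ₁ (t a) = (D.ψ₁ a).trace ∧ D.χ₂ (t a) = (D.ψ₂ a).trace := by
  choose t ht₁ ht₂ using D.exists_center_trace hn
  refine ⟨{ toFun := t, map_add' := fun a b => D.center_ext ?_ ?_,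
            map_smul' := fun z a => D.center_ext ?_ ?_ }, fun a => ⟨ht₁ a, ht₂ a⟩⟩
  · simp [ht₁]
  · simp [ht₂]
  · have : z • a = (z : A) * a := rfl
    simp [ht₁, this, D.hχ₁]
  · have : z • a = (z : A) * a := rfl
    simp [ht₂, this, D.hχ₂]

end SplitData

/-! ### Geometric points of the centre and the reduced trace -/

namespace SplitData

section BaseChange

variable {F : Type u} {K : Type w} {ι : Type} {A : Type v} [Field F] [Field K]
    [Algebra F K] [Fintype ι] [DecidableEq ι] [Ring A] [Algebra F A] (D : SplitData F K ι A)

/-- Extension of scalars of a splitting. -/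
theorem exists_baseChange [Nonempty ι] {L : Type*} [Field L] [Algebra F L] (j : K →ₐ[F] L) :
    ∃ D' : SplitData F L ι A, (∀ a, D'.ψ₁ a = (D.ψ₁ a).map j) ∧ (∀ a, D'.ψ₂ a = (D.ψ₂ a).map j) ∧
      (∀ z, D'.χ₁ z = j (D.χ₁ z)) ∧ (∀ z, D'.χ₂ z = j (D.χ₂ z)) := by
  have := D.module_finite
  let ψ₁ := j.mapMatrix.comp D.ψ₁
  let ψ₂ := j.mapMatrix.comp D.ψ₂
  set S := Submodule.span L (Set.range fun a => (ψ₁ a, ψ₂ a))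
  have hmap : ∀ p : Matrix ι ι K × Matrix ι ι K, (p.1.map j, p.2.map j) ∈ S := by
    intro p
    induction D.mem_span p using Submodule.span_induction with
    | mem x hx => obtain ⟨a, rfl⟩ := hx; exact Submodule.subset_span ⟨a, rfl⟩
    | zero => simp only [Prod.fst_zero, Prod.snd_zero, Matrix.map_zero _ (map_zero j)]; exact S.zero_mem
    | add x y _ _ hx hy =>
      have := add_mem hx hy
      simpa only [Prod.fst_add, Prod.snd_add, Matrix.map_add _ (map_add j), Prod.mk_add_mk] using this
    | smul c x _ hx =>
      have := S.smul_mem (j c) hx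
      rw [Prod.smul_mk] at this
      convert this using 2 <;> · ext; simp
  have hspan : ∀ p : Matrix ι ι L × Matrix ι ι L, p ∈ S := by
    have h1 : ∀ i k, (Matrix.single i k (1 : L), (0 : Matrix ι ι L)) ∈ S := fun i k => by
      have := hmap (Matrix.single i k 1, 0)
      simpa [Matrix.map_single, Matrix.map_zero _ (map_zero j)] using this
    have h2 : ∀ i k, ((0 : Matrix ι ι L), Matrix.single i k (1 : L)) ∈ S := fun i k => by
      have := hmap (0, Matrix.single i k 1)
      simpa [Matrix.map_single, Matrix.map_zero _ (map_zero j)] using this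
    have h1' : ∀ M : Matrix ι ι L, M ∈ S.comap (LinearMap.inl L _ (Matrix ι ι L)) := fun M => by
      rw [Matrix.matrix_eq_sum_single M]
      refine Submodule.sum_mem _ fun i _ => Submodule.sum_mem _ fun k _ => ?_
      have := Submodule.smul_mem _ (M i k) (h1 i k : _ ∈ S.comap (LinearMap.inl L _ (Matrix ι ι L)))
      simpa [Matrix.smul_single] using this
    have h2' : ∀ M : Matrix ι ι L, M ∈ S.comap (LinearMap.inr L (Matrix ι ι L) _) := fun M => by
      rw [Matrix.matrix_eq_sum_single M]
      refine Submodule.sum_mem _ fun i _ => Submodule.sum_mem _ fun k _ => ?_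
      have := Submodule.smul_mem _ (M i k) (h2 i k : _ ∈ S.comap (LinearMap.inr L (Matrix ι ι L) _))
      simpa [Matrix.smul_single] using this
    rintro ⟨M, N⟩
    have h1M : (M, (0 : Matrix ι ι L)) ∈ S := h1' M
    have h2N : ((0 : Matrix ι ι L), N) ∈ S := h2' N
    simpa using add_mem h1M h2N
  obtain ⟨E, hE⟩ := exists_splitting ψ₁ ψ₂ hspan D.finrank_eq.le
  refine ⟨⟨ψ₁, ψ₂, E, hE, j.comp D.χ₁, j.comp D.χ₂, ?_, ?_⟩, fun _ => rfl, fun _ => rfl,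
    fun _ => rfl, fun _ => rfl⟩
  · intro z
    change (D.ψ₁ z).map j = _
    rw [D.hχ₁]
    ext i k
    simp [Matrix.one_apply, apply_ite j]
  · intro z
    change (D.ψ₂ z).map j = _
    rw [D.hχ₂]
    ext i k
    simp [Matrix.one_apply, apply_ite j]

/-- If `K` is an algebra over the centre by the first character, then the first representation
splits `A` over the centre. -/
theorem exists_algEquiv_of_eq [Nonempty ι] [Algebra (Subalgebra.center F A) K]
    [IsScalarTower F (Subalgebra.center F A) K]
    (h : ∀ z, algebraMap (Subalgebra.center F A) K z = D.χ₁ z) :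
    ∃ φ : K ⊗[Subalgebra.center F A] A ≃ₐ[K] Matrix ι ι K, ∀ a, φ (1 ⊗ₜ a) = D.ψ₁ a := by
  let ψ : A →ₐ[Subalgebra.center F A] Matrix ι ι K :=
    { D.ψ₁ with
      commutes' := fun z => by
        change D.ψ₁ (z : A) = _
        rw [D.hχ₁, ← h, Matrix.smul_one_eq_diagonal]
        rfl }
  let φ : K ⊗[Subalgebra.center F A] A →ₐ[K] Matrix ι ι K :=
    Algebra.TensorProduct.lift (Algebra.ofId K _) ψ (fun k a => Algebra.commutes k _)
  have hφ : ∀ (k : K) (a : A), φ (k ⊗ₜ a) = k • D.ψ₁ a := fun k a =>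
    (Algebra.TensorProduct.lift_tmul _ _ _ _ _).trans (Algebra.smul_def k _).symm
  have hsurj : Function.Surjective φ := by
    intro M
    have hM := mem_span_range_fst D.mem_span M
    induction hM using Submodule.span_induction with
    | mem x hx => obtain ⟨a, rfl⟩ := hx; exact ⟨1 ⊗ₜ a, by rw [hφ, one_smul]⟩
    | zero => exact ⟨0, map_zero _⟩
    | add x y _ _ hx hy =>
      obtain ⟨a, rfl⟩ := hx; obtain ⟨b, rfl⟩ := hy; exact ⟨a + b, map_add _ _ _⟩
    | smul c x _ hx => obtain ⟨a, rfl⟩ := hx; exact ⟨c • a, map_smul _ _ _⟩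
  let π : K ⊗[F] A →+ K ⊗[Subalgebra.center F A] A :=
    TensorProduct.liftAddHom
      { toFun := fun k =>
          { toFun := fun a => k ⊗ₜ a
            map_zero' := TensorProduct.tmul_zero _ _
            map_add' := TensorProduct.tmul_add _ }
        map_zero' := by ext a; exact TensorProduct.zero_tmul _ _
        map_add' := fun k l => by ext a; exact TensorProduct.add_tmul _ _ _ }
      (fun c k a => by
        change (c • k) ⊗ₜ[Subalgebra.center F A] a = k ⊗ₜ[Subalgebra.center F A] (c • a)
        rw [← algebraMap_smul (Subalgebra.center F A) c k, TensorProduct.smul_tmul]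
        exact congrArg _ (Algebra.smul_def c a).symm)
  have hπ : ∀ (k : K) (a : A), π (k ⊗ₜ a) = k ⊗ₜ a := fun k a => rfl
  have hπsurj : Function.Surjective π := by
    intro y
    induction y with
    | zero => exact ⟨0, map_zero _⟩
    | add x y hx hy => obtain ⟨a, rfl⟩ := hx; obtain ⟨b, rfl⟩ := hy; exact ⟨a + b, map_add _ _ _⟩
    | tmul k a => exact ⟨k ⊗ₜ a, rfl⟩
  have hπsmul : ∀ (k : K) (x), π (k • x) = k • π x := by
    intro k x
    induction x with
    | zero => simp
    | add x y hx hy => rw [smul_add, map_add, hx, hy, map_add, smul_add]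
    | tmul l a => rw [TensorProduct.smul_tmul', hπ, hπ, TensorProduct.smul_tmul']
  have hfst : ∀ x, (D.E x).1 = φ (π x) := by
    intro x
    induction x with
    | zero => simp
    | add x y hx hy => rw [map_add, Prod.fst_add, hx, hy, map_add, map_add]
    | tmul k a =>
      rw [hπ, hφ, ← mul_one k, ← smul_eq_mul, ← TensorProduct.smul_tmul', map_smul, D.hE]
      simp
  obtain ⟨z₀, hz₀⟩ := D.exists_ne
  have hinj : Function.Injective φ := by
    rw [injective_iff_map_eq_zero]
    intro y hy
    obtain ⟨x, rfl⟩ := hπsurj y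
    have hx : (D.E x).1 = 0 := by rw [hfst, hy]
    -- `x` lies in the second block, where `z₀` acts by χ₂(z₀), whereas on K ⊗_Z A it acts by
    -- χ₁(z₀). These scalars differ, so the image of `x` there is zero.
    have h1 : (1 : K) ⊗ₜ[F] (z₀ : A) * x - D.χ₁ z₀ • x = (D.χ₂ z₀ - D.χ₁ z₀) • x := by
      apply D.E.injective
      rw [map_sub, map_mul, D.hE, map_smul, map_smul, D.hχ₁, D.hχ₂]
      ext1
      · simp [hx]
      · simp [sub_smul]
    have h2 : ∀ x, π ((1 : K) ⊗ₜ[F] (z₀ : A) * x) = D.χ₁ z₀ • π x := by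
      intro x
      induction x with
      | zero => simp
      | add x y hx hy => rw [mul_add, map_add, hx, hy, map_add, smul_add]
      | tmul l a =>
        rw [Algebra.TensorProduct.tmul_mul_tmul, hπ, hπ, one_mul, ← h,
          algebraMap_smul, TensorProduct.smul_tmul', TensorProduct.smul_tmul]
        rfl
    have h3 := congrArg π h1
    rw [map_sub, h2, hπsmul, sub_self, hπsmul] at h3
    exact (smul_eq_zero.1 h3.symm).resolve_left (sub_ne_zero.2 hz₀.symm)
  exact ⟨AlgEquiv.ofBijective φ ⟨hinj, hsurj⟩, fun a => (hφ 1 a).trans (one_smul _ _)⟩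

/-- Every homomorphism from the centre to a field extension of `K` comes from one of the two
characters. -/
theorem character_eq [Nonempty ι] {L : Type*} [Field L] [Algebra F L] (j : K →ₐ[F] L)
    (χ : Subalgebra.center F A →ₐ[F] L) :
    (∀ z, χ z = j (D.χ₁ z)) ∨ (∀ z, χ z = j (D.χ₂ z)) := by
  obtain ⟨z₀, h⟩ := D.exists_ne
  obtain ⟨T, N, hz, hT, hN⟩ := D.exists_quadratic h
  have h0 := congrArg χ hz
  rw [map_mul, map_sub, map_smul, AlgHom.commutes, Algebra.smul_def, ← j.commutes T,
    ← j.commutes N, hT, hN, map_add, map_mul] at h0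
  have h1 : (χ z₀ - j (D.χ₁ z₀)) * (χ z₀ - j (D.χ₂ z₀)) = 0 := by linear_combination h0
  rcases mul_eq_zero.1 h1 with h2 | h2
  · left
    intro z
    obtain ⟨a, b, rfl⟩ := D.eq_add_smul h z
    simp [sub_eq_zero.1 h2]
  · right
    intro z
    obtain ⟨a, b, rfl⟩ := D.eq_add_smul h z
    simp [sub_eq_zero.1 h2]

/-- As `K` is algebraic over `F`, it embeds in any algebraically closed `L` over the centre. The
structure map from the centre to `L` then extends one of the two characters, and the corresponding
block splits A there; `swap` reduces the second case to the first. -/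
theorem isReducedTrace [Nonempty ι] [Algebra.IsAlgebraic F K]
    {t : A →ₗ[Subalgebra.center F A] Subalgebra.center F A}
    (ht : ∀ a, D.χ₁ (t a) = (D.ψ₁ a).trace ∧ D.χ₂ (t a) = (D.ψ₂ a).trace) :
    IsReducedTrace (Subalgebra.center F A) A (Fintype.card ι) t := by
  intro L _ _ _
  let _ : Algebra F L := ((algebraMap (Subalgebra.center F A) L).comp (algebraMap F _)).toAlgebra
  have : IsScalarTower F (Subalgebra.center F A) L := .of_algebraMap_eq fun _ => rfl
  let j : K →ₐ[F] L := IsAlgClosed.lift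
  let e : Matrix ι ι L ≃ₐ[L] Matrix (Fin (Fintype.card ι)) (Fin (Fintype.card ι)) L :=
    Matrix.reindexAlgEquiv L L (Fintype.equivFin ι)
  have he : ∀ M, (e M).trace = M.trace := fun M => by
    simp only [e, Matrix.coe_reindexAlgEquiv, Matrix.trace, Matrix.diag_apply,
      Matrix.reindex_apply, Matrix.submatrix_apply]
    exact Equiv.sum_comp (Fintype.equivFin ι).symm (fun i => M i i)
  have main : ∀ D : SplitData F K ι A, (∀ a, D.χ₁ (t a) = (D.ψ₁ a).trace) →
      (∀ z, algebraMap (Subalgebra.center F A) L z = j (D.χ₁ z)) →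
      ∃ φ : L ⊗[Subalgebra.center F A] A ≃ₐ[L]
        Matrix (Fin (Fintype.card ι)) (Fin (Fintype.card ι)) L,
      ∀ a : A, (φ (1 ⊗ₜ a)).trace = algebraMap (Subalgebra.center F A) L (t a) := by
    intro D hD hχ
    obtain ⟨D', h₁, -, hc, -⟩ := D.exists_baseChange j
    obtain ⟨φ, hφ⟩ := D'.exists_algEquiv_of_eq (fun z => by rw [hc, hχ])
    refine ⟨φ.trans e, fun a => ?_⟩
    rw [AlgEquiv.trans_apply, he, hφ, h₁, hχ, hD]
    exact (AddMonoidHom.map_trace (j : K →+ L) (D.ψ₁ a)).symm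
  rcases D.character_eq j (Algebra.ofId _ L |>.restrictScalars F) with h | h
  · exact main D (fun a => (ht a).1) h
  · exact main D.swap (fun a => (ht a).2) h

/-- The reduced trace is computed in the two factors. -/
theorem isReducedTrace_reducedTrace [Nonempty ι] [Algebra.IsAlgebraic F K]
    (hn : (2 : K) = 0 ∨ (Fintype.card ι : K) ≠ 0) :
    IsReducedTrace (Subalgebra.center F A) A (Fintype.card ι)
        (reducedTrace (Subalgebra.center F A) A) ∧
      ∀ a, D.χ₁ (reducedTrace (Subalgebra.center F A) A a) = (D.ψ₁ a).trace ∧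
        D.χ₂ (reducedTrace (Subalgebra.center F A) A a) = (D.ψ₂ a).trace := by
  obtain ⟨t, ht⟩ := D.exists_centerTrace hn
  have h := D.isReducedTrace ht
  have := D.center_reduced
  rw [h.reducedTrace_eq]
  exact ⟨h, ht⟩

end BaseChange

end SplitData

/-! ### Orthogonal involutions: freeness of the symmetric elements, and semi-traces -/

/-- The space of symmetric matrices. -/
def symMatrices (K : Type*) (ι : Type*) [Field K] : Submodule K (Matrix ι ι K) where
  carrier := {M | M.transpose = M}
  zero_mem' := Matrix.transpose_zero
  add_mem' {M N} hM hN := by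
    change (M + N).transpose = M + N
    rw [Matrix.transpose_add, show M.transpose = M from hM, show N.transpose = N from hN]
  smul_mem' c M hM := by
    change (c • M).transpose = c • M
    rw [Matrix.transpose_smul, show M.transpose = M from hM]

theorem mem_symMatrices {K ι : Type*} [Field K] {M : Matrix ι ι K} :
    M ∈ symMatrices K ι ↔ M.transpose = M := Iff.rfl

/-- Symmetric matrices are functions on unordered pairs. -/
def symMatricesEquiv (K : Type*) (ι : Type*) [Field K] : symMatrices K ι ≃ₗ[K] (Sym2 ι → K) where
  toFun M := Sym2.lift ⟨fun i j => (M : Matrix ι ι K) i j,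
    fun i j => congrFun (congrFun (mem_symMatrices.1 M.2) j) i⟩
  invFun f := ⟨Matrix.of fun i j => f s(i, j), by
    rw [mem_symMatrices]; ext i j; simp [Sym2.eq_swap]⟩
  left_inv M := by ext i j; simp
  right_inv f := by ext s; induction s with | _ i j => simp
  map_add' M N := by ext s; induction s with | _ i j => simp
  map_smul' c M := by ext s; induction s with | _ i j => simp

theorem finrank_symMatrices (K : Type*) (ι : Type*) [Field K] [Fintype ι] [DecidableEq ι] :
    Module.finrank K (symMatrices K ι) = (Fintype.card ι + 1).choose 2 := by
  rw [(symMatricesEquiv K ι).finrank_eq, Module.finrank_fintype_fun_eq_card, Sym2.card]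

namespace SplitData

variable {F : Type u} {K : Type w} {ι : Type} {A : Type v} [Field F] [Field K]
    [Algebra F K] [Fintype ι] [DecidableEq ι] [Ring A] [Algebra F A] (D : SplitData F K ι A)

theorem reducedTrace_mul_comm [Nonempty ι] [Algebra.IsAlgebraic F K] (D : SplitData F K ι A)
    (hn : (2 : K) = 0 ∨ (Fintype.card ι : K) ≠ 0) (a b : A) :
    reducedTrace (Subalgebra.center F A) A (a * b) =
      reducedTrace (Subalgebra.center F A) A (b * a) := by
  have h := (D.isReducedTrace_reducedTrace hn).2
  apply D.center_ext
  · rw [(h _).1, (h _).1, map_mul, map_mul, Matrix.trace_mul_comm]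
  · rw [(h _).2, (h _).2, map_mul, map_mul, Matrix.trace_mul_comm]

/-- The involution `σ` is given, in both factors, by the adjunction with respect to symmetric
invertible matrices. -/
structure IsOrthogonal (σ : AlgInvolution F A) (C₁ C₂ : Matrix ι ι K) : Prop where
  isUnit₁ : IsUnit C₁
  isUnit₂ : IsUnit C₂
  symm₁ : C₁.transpose = C₁
  symm₂ : C₂.transpose = C₂
  apply₁ : ∀ a, C₁ * D.ψ₁ (σ a) = (D.ψ₁ a).transpose * C₁
  apply₂ : ∀ a, C₂ * D.ψ₂ (σ a) = (D.ψ₂ a).transpose * C₂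

namespace IsOrthogonal

variable {D} {σ : AlgInvolution F A} {C₁ C₂ : Matrix ι ι K}

theorem swap (h : D.IsOrthogonal σ C₁ C₂) : D.swap.IsOrthogonal σ C₂ C₁ :=
  ⟨h.isUnit₂, h.isUnit₁, h.symm₂, h.symm₁, h.apply₂, h.apply₁⟩

theorem map_center (h : D.IsOrthogonal σ C₁ C₂) {z : A} (hz : z ∈ Subalgebra.center F A) :
    σ z = z := by
  apply D.ext_of_eq
  · apply h.isUnit₁.mul_left_cancel
    rw [h.apply₁, D.hχ₁ ⟨z, hz⟩]
    simp
  · apply h.isUnit₂.mul_left_cancel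
    rw [h.apply₂, D.hχ₂ ⟨z, hz⟩]
    simp

theorem trace_apply₁ (h : D.IsOrthogonal σ C₁ C₂) (a : A) :
    (D.ψ₁ (σ a)).trace = (D.ψ₁ a).trace := by
  obtain ⟨u, hu⟩ := h.isUnit₁
  have h1 := h.apply₁ a
  rw [← hu] at h1
  rw [← Units.inv_mul_cancel_left u (D.ψ₁ (σ a)), h1, Matrix.trace_mul_comm,
    Units.mul_inv_cancel_right, Matrix.trace_transpose]

theorem trace_apply₂ (h : D.IsOrthogonal σ C₁ C₂) (a : A) :
    (D.ψ₂ (σ a)).trace = (D.ψ₂ a).trace := h.swap.trace_apply₁ a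

/-- As C is symmetric, Cψ(σ(a)) = ψ(a)ᵀC = (Cψ(a))ᵀ: multiplication by C turns the involution into
transposition in each block. The fixed space of a linear map commutes with extension of scalars. -/
theorem finrank_symElts (h : D.IsOrthogonal σ C₁ C₂) :
    Module.finrank F (symElts σ) = 2 * (Fintype.card ι + 1).choose 2 := by
  let m₁ : Matrix ι ι K ≃ₗ[K] Matrix ι ι K := LinearEquiv.ofBijective
    (LinearMap.mulLeft K C₁) ((Module.End.isUnit_iff _).1 (h.isUnit₁.map (Algebra.lmul K _)))
  let m₂ : Matrix ι ι K ≃ₗ[K] Matrix ι ι K := LinearEquiv.ofBijective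
    (LinearMap.mulLeft K C₂) ((Module.End.isUnit_iff _).1 (h.isUnit₂.map (Algebra.lmul K _)))
  have hm₁ : ∀ M, m₁ M = C₁ * M := fun _ => rfl
  have hm₂ : ∀ M, m₂ M = C₂ * M := fun _ => rfl
  let G : K ⊗[F] A ≃ₗ[K] Matrix ι ι K × Matrix ι ι K :=
    D.E.toLinearEquiv.trans (m₁.prodCongr m₂)
  have hG : ∀ x, G x = (C₁ * (D.E x).1, C₂ * (D.E x).2) := fun _ => rfl
  let s := TensorProduct.AlgebraTensorModule.lTensor K K σ.toLinearMap
  have hs : ∀ x, G (s x) = ((G x).1.transpose, (G x).2.transpose) := by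
    intro x
    induction x with
    | zero =>
      simp only [map_zero, Prod.fst_zero, Prod.snd_zero, Matrix.transpose_zero]
      rfl
    | add x y hx hy => rw [map_add, map_add, hx, hy, map_add]; simp
    | tmul k a =>
      have e : ∀ a : A, k ⊗ₜ[F] a = k • ((1 : K) ⊗ₜ[F] a) := by simp [TensorProduct.smul_tmul']
      change G (k ⊗ₜ σ a) = _
      rw [e, e a, map_smul, map_smul, hG, hG, D.hE, D.hE]
      simp [h.apply₁, h.apply₂, h.symm₁, h.symm₂, Matrix.transpose_mul]
  let W := LinearMap.eqLocus s (TensorProduct.AlgebraTensorModule.lTensor K K LinearMap.id)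
  have hW : ∀ x, x ∈ W ↔ (G x).1 ∈ symMatrices K ι ∧ (G x).2 ∈ symMatrices K ι := by
    intro x
    have : x ∈ W ↔ s x = x := by simp [W, LinearMap.mem_eqLocus]
    rw [this, ← G.injective.eq_iff, hs, Prod.ext_iff]
    rfl
  let e : W ≃ₗ[K] symMatrices K ι × symMatrices K ι :=
    { toFun := fun x => (⟨(G x).1, ((hW x).1 x.2).1⟩, ⟨(G x).2, ((hW x).1 x.2).2⟩)
      invFun := fun p => ⟨G.symm (p.1, p.2), by simp [hW]⟩
      left_inv := fun x => by simp
      right_inv := fun p => by simp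
      map_add' := fun x y => by ext <;> simp
      map_smul' := fun c x => by ext <;> simp }
  rw [← Module.finrank_baseChange (R := K)]
  have h1 := (LinearMap.tensorEqLocusEquiv K K σ.toLinearMap LinearMap.id).finrank_eq
  refine h1.trans (e.finrank_eq.trans ?_)
  rw [Module.finrank_prod, finrank_symMatrices]
  ring

theorem reducedTrace_apply [Nonempty ι] [Algebra.IsAlgebraic F K]
    (hn : (2 : K) = 0 ∨ (Fintype.card ι : K) ≠ 0) (h : D.IsOrthogonal σ C₁ C₂) (a : A) :
    reducedTrace (Subalgebra.center F A) A (σ a) =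
      reducedTrace (Subalgebra.center F A) A a := by
  have h' := (D.isReducedTrace_reducedTrace hn).2
  apply D.center_ext
  · rw [(h' _).1, (h' _).1, h.trace_apply₁]
  · rw [(h' _).2, (h' _).2, h.trace_apply₂]

/-- An involutive automorphism which exchanges the two characters of the centre and commutes
with `σ` makes the symmetric elements free over the centre. -/
theorem exists_basis [Nonempty ι] (h : D.IsOrthogonal σ C₁ C₂) (θ : A →ₐ[F] A)
    (hθ : ∀ a, θ (θ a) = a) (hσθ : ∀ a, σ (θ a) = θ (σ a))
    (hχ : ∀ z z' : Subalgebra.center F A, (z' : A) = θ z → D.χ₁ z' = D.χ₂ z ∧ D.χ₂ z' = D.χ₁ z) :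
    ∃ b : Fin (Fintype.card ι * (Fintype.card ι + 1) / 2) → A,
      LinearIndependent (Subalgebra.center F A) b ∧
      ∀ x : A, x ∈ Submodule.span (Subalgebra.center F A) (Set.range b) ↔ σ x = x := by
  have := D.module_finite
  have hθc : ∀ z ∈ Subalgebra.center F A, θ z ∈ Subalgebra.center F A := by
    intro z hz
    rw [Subalgebra.mem_center_iff] at hz ⊢
    intro b
    rw [← hθ b, ← map_mul, hz, map_mul]
  obtain ⟨z₀, hz₀⟩ := D.exists_ne
  let z₁ : Subalgebra.center F A := ⟨θ z₀, hθc _ z₀.2⟩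
  have hz₁ : θ (z₀ : A) = z₁ := rfl
  obtain ⟨e₁, e₂⟩ := hχ z₀ z₁ rfl
  -- Since `θ` exchanges the characters, they take z₀ - θ(z₀) to χ₁(z₀) - χ₂(z₀) and to its
  -- negative. The inverse `d` is therefore changed into its negative by `θ`.
  have hu : IsUnit (z₀ - z₁) := by
    apply D.isUnit_of_ne_zero
    · rw [map_sub, e₁]; exact sub_ne_zero.2 hz₀
    · rw [map_sub, e₂]; exact sub_ne_zero.2 hz₀.symm
  obtain ⟨d, hd⟩ := hu.exists_left_inv
  have hd' : (d : A) * (z₀ - z₁) = 1 := congrArg Subtype.val hd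
  have hcomm : ∀ (z : Subalgebra.center F A) (x : A), x * z = z * x :=
    fun z x => Subalgebra.mem_center_iff.1 z.2 x
  have hθd : θ (d : A) = -d := by
    have h1 := congrArg θ hd'
    rw [map_mul, map_sub, ← hz₁, hθ, hz₁, map_one] at h1
    have h2 : θ (d : A) * (z₁ - z₀) * d = d := by rw [h1, one_mul]
    rw [mul_assoc, hcomm d, ← neg_sub, mul_neg, hd', mul_neg, mul_one] at h2
    rw [← neg_eq_iff_eq_neg, h2]
  -- `P` is an F-structure on Sym: every symmetric x is uniquely p + z₀r with p, r in `P`. Here r =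
  -- d(x - θ(x)), which `θ` fixes because it changes the sign of both factors. So Sym = P ⊕ z₀P, and
  -- an F-basis of `P` is a Z-basis of Sym.
  let P : Submodule F A := symElts σ ⊓ LinearMap.eqLocus θ.toLinearMap LinearMap.id
  have hP : ∀ x, x ∈ P ↔ σ x = x ∧ θ x = x := fun x => Iff.rfl
  have hσz : ∀ (z : Subalgebra.center F A) (x : A), σ (z * x) = z * σ x := fun z x => by
    rw [σ.map_mul_rev, h.map_center z.2, hcomm]
  have hzero : ∀ p ∈ P, ∀ r ∈ P, p + z₀ * r = 0 → p = 0 ∧ r = 0 := by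
    intro p hp r hr hpr
    rw [hP] at hp hr
    have h1 := congrArg θ hpr
    rw [map_add, map_mul, hp.2, hr.2, hz₁, map_zero] at h1
    have hr0 : r = 0 := by
      rw [← one_mul r, ← hd', mul_assoc, sub_mul, ← add_sub_add_left_eq_sub _ _ p, hpr, h1,
        sub_zero, mul_zero]
    rw [hr0, mul_zero, add_zero] at hpr
    exact ⟨hpr, hr0⟩
  have hdecomp : ∀ x, σ x = x → ∃ p ∈ P, ∃ r ∈ P, x = p + z₀ * r := by
    intro x hx
    have hr : d * (x - θ x) ∈ P := by
      rw [hP, hσz, map_sub, hσθ, hx, map_mul, map_sub, hθ, hθd, neg_mul, ← mul_neg, neg_sub]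
      exact ⟨rfl, rfl⟩
    refine ⟨x - z₀ * (d * (x - θ x)), ?_, _, hr, by abel⟩
    rw [hP] at hr ⊢
    refine ⟨by rw [map_sub, hx, hσz, hr.1], ?_⟩
    have h1 : (z₀ : A) * (d * (x - θ x)) - z₁ * (d * (x - θ x)) = x - θ x := by
      rw [← sub_mul, ← mul_assoc, hcomm d, hd', one_mul]
    rw [map_sub, map_mul, hr.2, hz₁]
    rw [sub_eq_sub_iff_sub_eq_sub, ← neg_sub x]
    exact (neg_sub _ _).symm.trans (congrArg Neg.neg h1) |>.symm
  let T : P × P →ₗ[F] symElts σ := LinearMap.codRestrict (symElts σ)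
    (LinearMap.coprod P.subtype ((LinearMap.mulLeft F (z₀ : A)).comp P.subtype))
    (by
      rintro ⟨p, r⟩
      change σ (p + z₀ * r) = p + z₀ * r
      rw [map_add, hσz, ((hP _).1 p.2).1, ((hP _).1 r.2).1])
  have hT : ∀ p r, (T (p, r) : A) = p + z₀ * r := fun _ _ => rfl
  have hTbij : Function.Bijective T := by
    constructor
    · rw [← LinearMap.ker_eq_bot, LinearMap.ker_eq_bot']
      rintro ⟨p, r⟩ hpr
      obtain ⟨h1, h2⟩ := hzero p p.2 r r.2 (congrArg Subtype.val hpr)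
      exact Prod.ext (Subtype.ext h1) (Subtype.ext h2)
    · intro x
      obtain ⟨p, hp, r, hr, hx⟩ := hdecomp x x.2
      exact ⟨(⟨p, hp⟩, ⟨r, hr⟩), Subtype.ext hx.symm⟩
  have hfin : Module.finrank F P = Fintype.card ι * (Fintype.card ι + 1) / 2 := by
    have h1 := (LinearEquiv.ofBijective T hTbij).finrank_eq
    rw [Module.finrank_prod, h.finrank_symElts, Nat.choose_two_right] at h1
    rw [Nat.add_sub_cancel, mul_comm (_ + 1)] at h1
    omega
  let b := Module.finBasisOfFinrankEq F P hfin
  refine ⟨fun i => b i, ?_, fun x => ⟨fun hx => ?_, fun hx => ?_⟩⟩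
  · rw [Fintype.linearIndependent_iff]
    intro g hg
    choose a c hac using fun i => D.eq_add_smul hz₀ (g i)
    have h1 : ((∑ i, a i • b i : P) : A) + z₀ * (∑ i, c i • b i : P) = 0 := by
      rw [← hg]
      simp only [Submodule.coe_sum, Submodule.coe_smul, Finset.mul_sum, ← Finset.sum_add_distrib]
      refine Finset.sum_congr rfl fun i _ => ?_
      change _ = (g i : A) * b i
      rw [hac i, Subalgebra.coe_add, add_mul, Subalgebra.coe_algebraMap, ← Algebra.smul_def,
        Subalgebra.coe_smul, smul_mul_assoc, mul_smul_comm]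
    obtain ⟨h2, h3⟩ := hzero _ (Subtype.mem _) _ (Subtype.mem _) h1
    have h2' := Fintype.linearIndependent_iff.1 b.linearIndependent a (Subtype.ext h2)
    have h3' := Fintype.linearIndependent_iff.1 b.linearIndependent c (Subtype.ext h3)
    intro i
    rw [hac, h2', h3', map_zero, zero_smul, add_zero]
  · induction hx using Submodule.span_induction with
    | mem x hx => obtain ⟨i, rfl⟩ := hx; exact ((hP _).1 (b i).2).1
    | zero => exact map_zero _
    | add x y _ _ hx hy => rw [map_add, hx, hy]
    | smul z x _ hx => exact (hσz z x).trans (by rw [hx]; rfl)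
  · have hPspan : ∀ p ∈ P, p ∈ Submodule.span (Subalgebra.center F A)
        (Set.range fun i => (b i : A)) := by
      intro p hp
      have h1 := congrArg Subtype.val (b.sum_repr ⟨p, hp⟩)
      simp only [Submodule.coe_sum, Submodule.coe_smul] at h1
      rw [← h1]
      refine Submodule.sum_mem _ fun i _ => ?_
      have h2 := Submodule.smul_mem (Submodule.span (Subalgebra.center F A)
        (Set.range fun i => (b i : A))) (algebraMap F (Subalgebra.center F A) (b.repr ⟨p, hp⟩ i))
        (Submodule.subset_span ⟨i, rfl⟩)
      convert h2 using 1
      rw [Algebra.smul_def]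
      rfl
    obtain ⟨p, hp, r, hr, rfl⟩ := hdecomp x hx
    exact add_mem (hPspan p hp) (Submodule.smul_mem _ z₀ (hPspan r hr))

/-- The involution `σ` and the map `s ↦ Trd(u s)`, for `u + σ(u) = 1`, form a quadratic pair. -/
theorem isQuadraticPair [Nonempty ι] [Algebra.IsAlgebraic F K]
    (hn : (2 : K) = 0 ∨ (Fintype.card ι : K) ≠ 0)
    (h : D.IsOrthogonal σ C₁ C₂) (θ : A →ₐ[F] A)
    (hθ : ∀ a, θ (θ a) = a) (hσθ : ∀ a, σ (θ a) = θ (σ a))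
    (hχ : ∀ z z' : Subalgebra.center F A, (z' : A) = θ z → D.χ₁ z' = D.χ₂ z ∧ D.χ₂ z' = D.χ₁ z)
    {u : A} (hu : u + σ u = 1) : IsQuadraticPair σ (semitraceOf σ u) where
  center_etale := D.center_etale
  map_center _ := h.map_center
  degree := ⟨_, (D.isReducedTrace_reducedTrace hn).1, h.exists_basis θ hθ hσθ hχ⟩
  map_smul_center z s hs := by
    rw [semitraceOf_apply, semitraceOf_apply, ← mul_assoc, Subalgebra.mem_center_iff.1 z.2 u,
      mul_assoc]
    exact map_smul (reducedTrace (Subalgebra.center F A) A) z (u * s)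
  semitrace x := by
    rw [semitraceOf_apply]
    change reducedTrace (Subalgebra.center F A) A (u * (x + σ x)) = _
    -- Trd is invariant under σ and under exchange of factors, so Trd(uσ(x)) = Trd(xσ(u)) =
    -- Trd(σ(u)x), and u + σ(u) = 1.
    rw [mul_add, map_add, ← h.reducedTrace_apply hn (u * σ x), σ.map_mul_rev, σ.apply_apply,
      D.reducedTrace_mul_comm hn x, ← map_add, ← add_mul, hu, one_mul]

end IsOrthogonal

end SplitData

/-! ### Half-spin representations of a hyperbolic space and their invariant forms -/

section HyperbolicRepresentation

variable {K : Type*} [Field K]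

/-- The hyperbolic quadratic form. -/
def hypForm {K : Type*} [Field K] {m : ℕ} (x : Fin m → K × K) : K := ∑ i, (x i).1 * (x i).2

variable {ι H : Type*} [DecidableEq ι] [AddCommGroup H] [Module K H]

/-- The half-spin representation of the orthogonal sum with a hyperbolic plane. -/
def addPlane {k : ℕ} (α β : (Fin k → K × K) →ₗ[K] Matrix ι ι K) :
    (Fin (k + 1) → K × K) →ₗ[K] Matrix (ι ⊕ ι) (ι ⊕ ι) K where
  toFun z := Matrix.fromBlocks (α fun i => z i.succ) ((z 0).1 • 1) ((z 0).2 • 1)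
    (-β fun i => z i.succ)
  map_add' y z := by
    rw [Matrix.fromBlocks_add, ← map_add, ← neg_add, ← map_add, ← add_smul, ← add_smul]
    rfl
  map_smul' c z := by
    rw [RingHom.id_apply, Matrix.fromBlocks_smul, ← map_smul, smul_neg, ← map_smul, smul_smul,
      smul_smul]
    rfl

theorem addPlane_apply {k : ℕ} (α β : (Fin k → K × K) →ₗ[K] Matrix ι ι K)
    (z : Fin (k + 1) → K × K) :
    addPlane α β z = Matrix.fromBlocks (α fun i => z i.succ) ((z 0).1 • 1) ((z 0).2 • 1)
      (-β fun i => z i.succ) := rfl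

theorem addPlane_cons {k : ℕ} (α β : (Fin k → K × K) →ₗ[K] Matrix ι ι K) (p : K × K)
    (z : Fin k → K × K) :
    addPlane α β (Fin.cons p z : Fin (k + 1) → K × K) =
      Matrix.fromBlocks (α z) (p.1 • 1) (p.2 • 1) (-β z) := by
  rw [addPlane_apply]; simp

variable [Fintype ι]

/-- The matrices `C₁`, `C₂` define a form on each of the two half-spin representations. -/
structure IsEvenForm (α β : H →ₗ[K] Matrix ι ι K) (C₁ C₂ : Matrix ι ι K) (ε : K) : Prop where
  isUnit₁ : IsUnit C₁
  isUnit₂ : IsUnit C₂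
  symm₁ : C₁.transpose = ε • C₁
  symm₂ : C₂.transpose = ε • C₂
  apply₁ : ∀ x, (α x).transpose * C₁ = C₂ * β x
  apply₂ : ∀ x, (β x).transpose * C₂ = C₁ * α x

/-- The matrices `C₁`, `C₂` define a pairing between the two half-spin representations. -/
structure IsOddForm (α β : H →ₗ[K] Matrix ι ι K) (C₁ C₂ : Matrix ι ι K) (ε : K) : Prop where
  isUnit₁ : IsUnit C₁
  isUnit₂ : IsUnit C₂
  symm₁ : C₁.transpose = ε • C₂
  symm₂ : C₂.transpose = ε • C₁
  apply₁ : ∀ x, (α x).transpose * C₁ = C₂ * α x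
  apply₂ : ∀ x, (β x).transpose * C₂ = C₁ * β x

/-- The sign in the lower right block of `addPlane` makes the off-diagonal entries cancel, while the
new plane contributes its norm to both diagonal blocks. -/
theorem addPlane_mul {k : ℕ} {α β : (Fin k → K × K) →ₗ[K] Matrix ι ι K}
    (h₁ : ∀ x, α x * β x = hypForm x • 1) (h₂ : ∀ x, β x * α x = hypForm x • 1)
    (x : Fin (k + 1) → K × K) : addPlane α β x * addPlane β α x = hypForm x • 1 := by
  rw [addPlane_apply, addPlane_apply, Matrix.fromBlocks_multiply, ← Matrix.fromBlocks_one,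
    Matrix.fromBlocks_smul]
  have h : hypForm x = (x 0).1 * (x 0).2 + hypForm fun i => x i.succ := by
    rw [hypForm, Fin.sum_univ_succ]; rfl
  congr 1
  · rw [h₁, h, smul_mul_smul_comm, mul_one, add_comm, add_smul]
  · simp
  · simp
  · rw [neg_mul_neg, h₂, h, smul_mul_smul_comm, mul_one, add_smul, mul_comm]

theorem isUnit_antidiagonal {C D : Matrix ι ι K} (hC : IsUnit C) (hD : IsUnit D) :
    IsUnit (Matrix.fromBlocks 0 C D 0) := by
  obtain ⟨c, rfl⟩ := hC
  obtain ⟨d, rfl⟩ := hD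
  refine ⟨⟨Matrix.fromBlocks 0 c d 0, Matrix.fromBlocks 0 ↑d⁻¹ ↑c⁻¹ 0, ?_, ?_⟩, rfl⟩ <;>
  · rw [Matrix.fromBlocks_multiply, ← Matrix.fromBlocks_one]
    simp

/-- Adding a plane turns forms on the two half-spin spaces into a pairing between them, and the next
plane turns the pairing back into forms. The sign survives the first step and changes in the second,
whence the period 4 of the symmetry type in the number of planes. -/
theorem IsEvenForm.addPlane {k : ℕ} {α β : (Fin k → K × K) →ₗ[K] Matrix ι ι K}
    {C₁ C₂ : Matrix ι ι K} {ε : K} (h : IsEvenForm α β C₁ C₂ ε) :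
    IsOddForm (addPlane α β) (addPlane β α) (Matrix.fromBlocks 0 C₁ (-C₂) 0)
      (Matrix.fromBlocks 0 (-C₂) C₁ 0) ε where
  isUnit₁ := isUnit_antidiagonal h.isUnit₁ h.isUnit₂.neg
  isUnit₂ := isUnit_antidiagonal h.isUnit₂.neg h.isUnit₁
  symm₁ := by simp [Matrix.fromBlocks_transpose, Matrix.fromBlocks_smul, h.symm₁, h.symm₂]
  symm₂ := by simp [Matrix.fromBlocks_transpose, Matrix.fromBlocks_smul, h.symm₁, h.symm₂]
  apply₁ x := by
    simp [addPlane_apply, Matrix.fromBlocks_transpose, Matrix.fromBlocks_multiply, h.apply₁,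
      h.apply₂]
  apply₂ x := by
    simp [addPlane_apply, Matrix.fromBlocks_transpose, Matrix.fromBlocks_multiply, h.apply₁,
      h.apply₂]

theorem IsOddForm.addPlane {k : ℕ} {α β : (Fin k → K × K) →ₗ[K] Matrix ι ι K}
    {C₁ C₂ : Matrix ι ι K} {ε : K} (h : IsOddForm α β C₁ C₂ ε) :
    IsEvenForm (addPlane α β) (addPlane β α) (Matrix.fromBlocks 0 (-C₁) C₂ 0)
      (Matrix.fromBlocks 0 C₂ (-C₁) 0) (-ε) where
  isUnit₁ := isUnit_antidiagonal h.isUnit₁.neg h.isUnit₂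
  isUnit₂ := isUnit_antidiagonal h.isUnit₂ h.isUnit₁.neg
  symm₁ := by simp [Matrix.fromBlocks_transpose, Matrix.fromBlocks_smul, h.symm₁, h.symm₂,
    Matrix.fromBlocks_neg]
  symm₂ := by simp [Matrix.fromBlocks_transpose, Matrix.fromBlocks_smul, h.symm₁, h.symm₂,
    Matrix.fromBlocks_neg]
  apply₁ x := by
    simp [addPlane_apply, Matrix.fromBlocks_transpose, Matrix.fromBlocks_multiply, h.apply₁,
      h.apply₂]
  apply₂ x := by
    simp [addPlane_apply, Matrix.fromBlocks_transpose, Matrix.fromBlocks_multiply, h.apply₁,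
      h.apply₂]

/-- The subalgebra generated by the products of two vectors in the half-spin representations. -/
def spinAlgebra (α β : H →ₗ[K] Matrix ι ι K) : Subalgebra K (Matrix ι ι K × Matrix ι ι K) :=
  Algebra.adjoin K (Set.range fun p : H × H => (α p.1 * β p.2, β p.1 * α p.2))

theorem mem_spinAlgebra (α β : H →ₗ[K] Matrix ι ι K) (v w : H) :
    (α v * β w, β v * α w) ∈ spinAlgebra α β := Algebra.subset_adjoin ⟨(v, w), rfl⟩

/-- The products of the two isotropic basis vectors of the new plane are diagonal idempotents, so
both diagonal corners contain the old spin algebra, which is everything. A vector of norm 1 in the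
old space is invertible in both representations and carries the corners off the diagonal; one old
plane is needed for it, whence the index k + 1. -/
theorem spinAlgebra_addPlane {k : ℕ} {α β : (Fin (k + 1) → K × K) →ₗ[K] Matrix ι ι K}
    (h₁ : ∀ x, α x * β x = hypForm x • 1) (h₂ : ∀ x, β x * α x = hypForm x • 1)
    (h : spinAlgebra α β = ⊤) : spinAlgebra (addPlane α β) (addPlane β α) = ⊤ := by
  set T := spinAlgebra (addPlane α β) (addPlane β α) with hT
  have gen : ∀ (p r : K × K) (v w : Fin (k + 1) → K × K), _ ∈ T := fun p r v w =>
    mem_spinAlgebra (addPlane α β) (addPlane β α) (Fin.cons p v) (Fin.cons r w)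
  simp only [addPlane_cons, Matrix.fromBlocks_multiply] at gen
  have hP : (Matrix.fromBlocks 1 0 0 0, Matrix.fromBlocks 1 0 0 0) ∈ T := by
    simpa using gen (1, 0) (0, 1) 0 0
  have hP' : (Matrix.fromBlocks 0 0 0 1, Matrix.fromBlocks 0 0 0 1) ∈ T := by
    simpa using gen (0, 1) (1, 0) 0 0
  have hd₁ : ∀ a b : Matrix ι ι K,
      (Matrix.fromBlocks a 0 0 0, Matrix.fromBlocks b 0 0 0) ∈ T := by
    suffices ∀ s ∈ spinAlgebra α β,
        (Matrix.fromBlocks s.1 0 0 0, Matrix.fromBlocks s.2 0 0 0) ∈ T from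
      fun a b => this (a, b) (h ▸ Algebra.mem_top)
    intro s hs
    induction hs using Algebra.adjoin_induction with
    | mem x hx =>
      obtain ⟨⟨v, w⟩, rfl⟩ := hx
      simpa [Matrix.fromBlocks_multiply] using T.mul_mem hP (gen 0 0 v w)
    | algebraMap r =>
      simpa [Matrix.fromBlocks_smul, Algebra.algebraMap_eq_smul_one] using T.smul_mem hP r
    | add x y _ _ hx hy => simpa [Matrix.fromBlocks_add] using T.add_mem hx hy
    | mul x y _ _ hx hy => simpa [Matrix.fromBlocks_multiply] using T.mul_mem hx hy
  have hd₂ : ∀ a b : Matrix ι ι K,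
      (Matrix.fromBlocks 0 0 0 a, Matrix.fromBlocks 0 0 0 b) ∈ T := by
    -- In the lower corner the two representations occur in the opposite order.
    suffices ∀ s ∈ spinAlgebra α β,
        (Matrix.fromBlocks 0 0 0 s.2, Matrix.fromBlocks 0 0 0 s.1) ∈ T from
      fun a b => this (b, a) (h ▸ Algebra.mem_top)
    intro s hs
    induction hs using Algebra.adjoin_induction with
    | mem x hx =>
      obtain ⟨⟨v, w⟩, rfl⟩ := hx
      simpa [Matrix.fromBlocks_multiply] using T.mul_mem hP' (gen 0 0 v w)
    | algebraMap r =>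
      simpa [Matrix.fromBlocks_smul, Algebra.algebraMap_eq_smul_one] using T.smul_mem hP' r
    | add x y _ _ hx hy => simpa [Matrix.fromBlocks_add] using T.add_mem hx hy
    | mul x y _ _ hx hy => simpa [Matrix.fromBlocks_multiply] using T.mul_mem hx hy
  let v : Fin (k + 1) → K × K := Fin.cons (1, 1) 0
  have hv : hypForm v = 1 := by simp [v, hypForm, Fin.sum_univ_succ]
  have hα : α v * β v = 1 := by rw [h₁, hv, one_smul]
  have hβ : β v * α v = 1 := by rw [h₂, hv, one_smul]
  have hu : ∀ a b : Matrix ι ι K,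
      (Matrix.fromBlocks 0 a 0 0, Matrix.fromBlocks 0 b 0 0) ∈ T := by
    intro a b
    have h3 := T.mul_mem (hd₁ (a * β v) (b * α v)) (gen 0 (1, 0) v 0)
    simpa [Matrix.fromBlocks_multiply, mul_assoc, hα, hβ] using h3
  have hl : ∀ a b : Matrix ι ι K,
      (Matrix.fromBlocks 0 0 a 0, Matrix.fromBlocks 0 0 b 0) ∈ T := by
    intro a b
    have h3 := T.mul_mem (hd₂ (a * -α v) (b * -β v)) (gen 0 (0, 1) v 0)
    simpa [Matrix.fromBlocks_multiply, mul_assoc, hα, hβ] using h3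
  rw [eq_top_iff]
  rintro ⟨M, N⟩ -
  have h4 := T.add_mem (T.add_mem (hd₁ M.toBlocks₁₁ N.toBlocks₁₁) (hu M.toBlocks₁₂ N.toBlocks₁₂))
    (T.add_mem (hl M.toBlocks₂₁ N.toBlocks₂₁) (hd₂ M.toBlocks₂₂ N.toBlocks₂₂))
  simpa [Matrix.fromBlocks_add, Matrix.fromBlocks_toBlocks] using h4

variable (K) in
/-- The half-spin representations of a hyperbolic space of dimension `2 (k + 1)`. -/
theorem exists_halfSpin (k : ℕ) : ∃ (ι : Type) (_ : Fintype ι) (_ : DecidableEq ι),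
    Fintype.card ι = 2 ^ k ∧ ∃ α β : (Fin (k + 1) → K × K) →ₗ[K] Matrix ι ι K,
      (∀ x, α x * β x = hypForm x • 1) ∧ (∀ x, β x * α x = hypForm x • 1) ∧
      spinAlgebra α β = ⊤ ∧ ∃ C₁ C₂ : Matrix ι ι K,
        (Even (k + 1) → IsEvenForm α β C₁ C₂ ((-1) ^ ((k + 1) / 2))) ∧
        (Odd (k + 1) → IsOddForm α β C₁ C₂ ((-1) ^ ((k + 1) / 2))) := by
  induction k with
  | zero =>
    -- For a single plane the half-spin spaces are lines, and the two maps are the isotropic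
    -- coordinates.
    let α : (Fin 1 → K × K) →ₗ[K] Matrix Unit Unit K :=
      (LinearMap.toSpanSingleton K _ 1).comp ((LinearMap.fst K K K).comp (LinearMap.proj 0))
    let β : (Fin 1 → K × K) →ₗ[K] Matrix Unit Unit K :=
      (LinearMap.toSpanSingleton K _ 1).comp ((LinearMap.snd K K K).comp (LinearMap.proj 0))
    have hα : ∀ x, α x = (x 0).1 • 1 := fun _ => rfl
    have hβ : ∀ x, β x = (x 0).2 • 1 := fun _ => rfl
    refine ⟨Unit, inferInstance, inferInstance, rfl, α, β, ?_, ?_, ?_, 1, 1, ?_, ?_⟩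
    · intro x; simp [hα, hβ, hypForm, smul_smul, mul_comm]
    · intro x; simp [hα, hβ, hypForm, smul_smul]
    · rw [eq_top_iff]
      rintro ⟨M, N⟩ -
      have hM : M = M () () • 1 := by ext i j; simp
      have hN : N = N () () • 1 := by ext i j; simp
      have h1 := mem_spinAlgebra α β (fun _ => (1, 0)) (fun _ => (0, 1))
      have h2 := mem_spinAlgebra α β (fun _ => (0, 1)) (fun _ => (1, 0))
      simp only [hα, hβ, one_smul, zero_smul, mul_one, mul_zero] at h1 h2
      have h3 := (spinAlgebra α β).add_mem ((spinAlgebra α β).smul_mem h1 (M () ()))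
        ((spinAlgebra α β).smul_mem h2 (N () ()))
      rw [hM, hN]
      simpa using h3
    · intro h; exact absurd h (by decide)
    · intro _
      exact ⟨isUnit_one, isUnit_one, by simp, by simp, by simp [hα], by simp [hβ]⟩
  | succ k ih =>
    obtain ⟨ι, _, _, hcard, α, β, h₁, h₂, hT, C₁, C₂, he, ho⟩ := ih
    refine ⟨ι ⊕ ι, inferInstance, inferInstance, ?_, addPlane α β, addPlane β α,
      addPlane_mul h₁ h₂, addPlane_mul h₂ h₁, spinAlgebra_addPlane h₁ h₂ hT, ?_⟩
    · rw [Fintype.card_sum, hcard]; ring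
    · rcases Nat.even_or_odd (k + 1) with hk | hk
      · have h := (he hk).addPlane
        rw [show (k + 1) / 2 = (k + 1 + 1) / 2 by obtain ⟨r, hr⟩ := hk; omega] at h
        exact ⟨_, _, fun h' => absurd hk.add_one (Nat.not_odd_iff_even.2 h'), fun _ => h⟩
      · have h := (ho hk).addPlane
        rw [show -(-1 : K) ^ ((k + 1) / 2) = (-1) ^ ((k + 1) / 2 + 1) by rw [pow_succ, mul_neg_one],
          show (k + 1) / 2 + 1 = (k + 1 + 1) / 2 by obtain ⟨r, hr⟩ := hk; omega] at h
        exact ⟨_, _, fun _ => h, fun h' => absurd hk.add_one (Nat.not_even_iff_odd.2 h')⟩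

end HyperbolicRepresentation

/-! ### Hyperbolic coordinates over an algebraically closed field -/

section HyperbolicCoordinates

variable {K : Type w} [Field K]

/-- On an affine line whose direction is anisotropic, Q is a polynomial of degree 2 in the
parameter, so it has a root; independence keeps the line away from 0. -/
theorem exists_isotropic [IsAlgClosed K] {U : Type v} [AddCommGroup U] [Module K U]
    (Q : QuadraticForm K U) (h : 2 ≤ Module.finrank K U) : ∃ e : U, e ≠ 0 ∧ Q e = 0 := by
  obtain ⟨v, hv⟩ := exists_linearIndependent_of_le_finrank h
  by_cases hy : Q (v 1) = 0
  · exact ⟨v 1, hv.ne_zero 1, hy⟩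
  let p : Polynomial K := .C (Q (v 1)) * .X ^ 2 + .C (QuadraticMap.polar Q (v 0) (v 1)) * .X +
    .C (Q (v 0))
  have hp : p.degree = 2 := Polynomial.degree_quadratic hy
  obtain ⟨t, ht⟩ := IsAlgClosed.exists_root p (by rw [hp]; decide)
  refine ⟨v 0 + t • v 1, fun h0 => ?_, ?_⟩
  · have := hv
    rw [show v = ![v 0, v 1] by ext i; fin_cases i <;> rfl, LinearIndependent.pair_iff] at this
    have := (this 1 t (by rw [one_smul, h0])).1
    exact one_ne_zero this
  · rw [QuadraticMap.map_add Q, QuadraticMap.map_smul, QuadraticMap.polar_smul_right]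
    simp only [p, Polynomial.IsRoot.def, Polynomial.eval_add, Polynomial.eval_mul,
      Polynomial.eval_pow, Polynomial.eval_C, Polynomial.eval_X] at ht
    simp only [smul_eq_mul]
    linear_combination ht

theorem exists_hyperbolicPair [IsAlgClosed K] {U : Type v} [AddCommGroup U] [Module K U]
    (Q : QuadraticForm K U) (hQ : ∀ x, (∀ y, QuadraticMap.polar Q x y = 0) → x = 0)
    (h : 2 ≤ Module.finrank K U) :
    ∃ e f : U, Q e = 0 ∧ Q f = 0 ∧ QuadraticMap.polar Q e f = 1 := by
  obtain ⟨e, he, hQe⟩ := exists_isotropic Q h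
  obtain ⟨f₁, h1⟩ : ∃ f₁, QuadraticMap.polar Q e f₁ = 1 := by
    obtain ⟨f, hf⟩ : ∃ f, QuadraticMap.polar Q e f ≠ 0 := by
      by_contra! h0
      exact he (hQ e h0)
    exact ⟨(QuadraticMap.polar Q e f)⁻¹ • f, by
      rw [QuadraticMap.polar_smul_right, smul_eq_mul, inv_mul_cancel₀ hf]⟩
  have hee : QuadraticMap.polar Q e e = 0 := by
    rw [QuadraticMap.polar_self, hQe, smul_zero]
  -- The correction by a multiple of the isotropic vector `e` kills Q(f₁) and preserves the pairing
  -- with `e`.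
  refine ⟨e, f₁ + (-Q f₁) • e, hQe, ?_, ?_⟩
  · rw [QuadraticMap.map_add Q, QuadraticMap.map_smul, hQe, QuadraticMap.polar_smul_right,
      QuadraticMap.polar_comm, h1]
    simp
  · rw [QuadraticMap.polar_add_right, QuadraticMap.polar_smul_right, hee, h1]
    simp

/-- Over an algebraically closed field a nonsingular quadratic form of even dimension is
hyperbolic. -/
theorem exists_hyperbolicCoordinates [IsAlgClosed K] (m : ℕ) :
    ∀ {U : Type v} [AddCommGroup U] [Module K U] [FiniteDimensional K U] (Q : QuadraticForm K U),
      (∀ x, (∀ y, QuadraticMap.polar Q x y = 0) → x = 0) → Module.finrank K U = 2 * m →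
      ∃ j : U →ₗ[K] (Fin m → K × K), ∀ x, Q x = hypForm (j x) := by
  induction m with
  | zero =>
    intro U _ _ _ Q _ hdim
    have := Module.finrank_zero_iff.1 hdim
    exact ⟨0, fun x => by rw [Subsingleton.elim x 0]; simp [hypForm]⟩
  | succ m ih =>
    intro U _ _ _ Q hQ hdim
    obtain ⟨e, f, he, hf, hef⟩ := exists_hyperbolicPair Q hQ (by omega)
    have hee : QuadraticMap.polar Q e e = 0 := by rw [QuadraticMap.polar_self, he, smul_zero]
    have hff : QuadraticMap.polar Q f f = 0 := by rw [QuadraticMap.polar_self, hf, smul_zero]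
    have hfe : QuadraticMap.polar Q f e = 1 := by rw [QuadraticMap.polar_comm, hef]
    let W : Submodule K U := LinearMap.ker (Q.polarBilin e) ⊓ LinearMap.ker (Q.polarBilin f)
    have hW : ∀ x, x ∈ W ↔ QuadraticMap.polar Q e x = 0 ∧ QuadraticMap.polar Q f x = 0 :=
      fun x => Iff.rfl
    let p : U →ₗ[K] W := LinearMap.codRestrict W
      (LinearMap.id - (Q.polarBilin f).smulRight e - (Q.polarBilin e).smulRight f) (fun x => by
        rw [hW]
        simp [QuadraticMap.polar_sub_right, QuadraticMap.polar_smul_right, hee, hef, hfe, hff])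
    have hp : ∀ x, x = p x + (QuadraticMap.polar Q f x • e + QuadraticMap.polar Q e x • f) := by
      intro x
      change x = (x - QuadraticMap.polar Q f x • e - QuadraticMap.polar Q e x • f) + _
      abel
    let g : U ≃ₗ[K] W × K × K :=
      { toFun := fun x => (p x, QuadraticMap.polar Q f x, QuadraticMap.polar Q e x)
        invFun := fun y => y.1 + (y.2.1 • e + y.2.2 • f)
        left_inv := fun x => (hp x).symm
        right_inv := by
          rintro ⟨⟨y, hy⟩, a, b⟩
          obtain ⟨h1, h2⟩ := (hW y).1 hy
          have h3 : QuadraticMap.polar Q f (y + (a • e + b • f)) = a := by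
            simp [QuadraticMap.polar_add_right, QuadraticMap.polar_smul_right, h2, hfe, hff]
          have h4 : QuadraticMap.polar Q e (y + (a • e + b • f)) = b := by
            simp [QuadraticMap.polar_add_right, QuadraticMap.polar_smul_right, h1, hef, hee]
          refine Prod.ext (Subtype.ext ?_) (Prod.ext h3 h4)
          have h5 := hp (y + (a • e + b • f))
          rw [h3, h4] at h5
          exact (add_right_cancel h5).symm
        map_add' := fun x y => by
          rw [map_add, QuadraticMap.polar_add_right, QuadraticMap.polar_add_right]; rfl
        map_smul' := fun c x => by
          rw [map_smul, QuadraticMap.polar_smul_right, QuadraticMap.polar_smul_right]; rfl }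
    have hWdim : Module.finrank K W = 2 * m := by
      have := g.finrank_eq
      rw [Module.finrank_prod, Module.finrank_prod, Module.finrank_self] at this
      omega
    have hpol : ∀ x y : W, QuadraticMap.polar (Q.comp W.subtype) x y =
        QuadraticMap.polar Q x y := fun _ _ => rfl
    obtain ⟨j, hj⟩ := ih (Q.comp W.subtype) (fun x hx => Subtype.ext (hQ x fun y => by
      rw [hp y, QuadraticMap.polar_add_right, ← hpol, hx, QuadraticMap.polar_add_right,
        QuadraticMap.polar_smul_right, QuadraticMap.polar_smul_right,
        QuadraticMap.polar_comm Q x e, QuadraticMap.polar_comm Q x f, ((hW _).1 x.2).1,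
        ((hW _).1 x.2).2]
      simp)) hWdim
    let j' : U →ₗ[K] (Fin (m + 1) → K × K) := LinearMap.pi
      (Fin.cons ((Q.polarBilin f).prod (Q.polarBilin e))
        fun i => (LinearMap.proj i).comp (j.comp p))
    have h0 : ∀ x, j' x 0 = (QuadraticMap.polar Q f x, QuadraticMap.polar Q e x) := fun _ => rfl
    have hs : ∀ x i, j' x (Fin.succ i) = j (p x) i := fun _ _ => rfl
    refine ⟨j', fun x => ?_⟩
    have h1 := hj (p x)
    rw [QuadraticMap.comp_apply, Submodule.subtype_apply] at h1
    have h2 : QuadraticMap.polar Q (p x : U)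
        (QuadraticMap.polar Q f x • e + QuadraticMap.polar Q e x • f) = 0 := by
      rw [QuadraticMap.polar_add_right, QuadraticMap.polar_smul_right,
        QuadraticMap.polar_smul_right, QuadraticMap.polar_comm Q _ e,
        QuadraticMap.polar_comm Q _ f, ((hW _).1 (p x).2).1, ((hW _).1 (p x).2).2]
      simp
    rw [hypForm, Fin.sum_univ_succ, h0]
    simp only [hs]
    conv_lhs => rw [hp x]
    rw [QuadraticMap.map_add Q, h2, h1, QuadraticMap.map_add Q, QuadraticMap.map_smul,
      QuadraticMap.map_smul, he, hf, QuadraticMap.polar_smul_right, QuadraticMap.polar_smul_left,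
      hef, hypForm]
    simp
    ring

/-- After extension of scalars to an algebraically closed field, a nonsingular quadratic form of
even dimension has hyperbolic coordinates. -/
theorem exists_hyperbolicCoordinates_extension {F : Type u} [Field F] [IsAlgClosed K] [Algebra F K]
    {V : Type v} [AddCommGroup V] [Module F V] [FiniteDimensional F V] (q : QuadraticForm F V)
    (hq : LinearMap.BilinForm.Nondegenerate q.polarBilin) {m : ℕ}
    (hdim : Module.finrank F V = 2 * m) :
    ∃ j : V →ₗ[F] (Fin m → K × K), (∀ v, algebraMap F K (q v) = hypForm (j v)) ∧
      Submodule.span K (Set.range j) = ⊤ := by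
  -- Scalars are extended through a bilinear form with β(v, v) = q(v), available in every
  -- characteristic; in characteristic 2 the polar form would not recover q.
  obtain ⟨β, hβ⟩ := LinearMap.BilinMap.toQuadraticMap_surjective q
  let βK := LinearMap.BilinForm.baseChange K β
  let Q : QuadraticForm K (K ⊗[F] V) := LinearMap.BilinMap.toQuadraticMap βK
  have hQ1 : ∀ v, Q (1 ⊗ₜ v) = algebraMap F K (q v) := by
    intro v
    rw [← hβ]
    simp [Q, βK, Algebra.algebraMap_eq_smul_one]
  have hpol : ∀ v w, QuadraticMap.polar Q (1 ⊗ₜ v) (1 ⊗ₜ w) =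
      algebraMap F K (QuadraticMap.polar q v w) := by
    intro v w
    simp only [QuadraticMap.polar, ← TensorProduct.tmul_add, hQ1, map_sub]
  let b := Module.finBasis F V
  have hmat : LinearMap.BilinForm.toMatrix (b.baseChange K) Q.polarBilin =
      (LinearMap.BilinForm.toMatrix b q.polarBilin).map (algebraMap F K) := by
    ext i k
    rw [LinearMap.BilinForm.toMatrix_apply, Matrix.map_apply, LinearMap.BilinForm.toMatrix_apply,
      Module.Basis.baseChange_apply, Module.Basis.baseChange_apply]
    exact hpol _ _
  have hQ : LinearMap.BilinForm.Nondegenerate Q.polarBilin := by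
    rw [LinearMap.BilinForm.nondegenerate_iff_det_ne_zero (b.baseChange K), hmat]
    have := (LinearMap.BilinForm.nondegenerate_iff_det_ne_zero b).1 hq
    rw [← RingHom.mapMatrix_apply, ← RingHom.map_det]
    exact (map_ne_zero _).2 this
  obtain ⟨j, hj⟩ := exists_hyperbolicCoordinates m Q (fun x hx => hQ.1 x hx)
    (by rw [Module.finrank_baseChange, hdim])
  refine ⟨(j.restrictScalars F).comp (TensorProduct.mk F K V 1), fun v => ?_, ?_⟩
  · rw [← hQ1, hj]; rfl
  · have hinj : Function.Injective j := by
      rw [← LinearMap.ker_eq_bot, LinearMap.ker_eq_bot']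
      intro x hx
      refine hQ.1 x fun y => ?_
      change QuadraticMap.polar Q x y = 0
      rw [QuadraticMap.polar, hj, hj, hj, map_add, hx]
      simp [hypForm]
    have hsurj : Function.Surjective j := by
      refine (LinearMap.injective_iff_surjective_of_finrank_eq_finrank ?_).1 hinj
      rw [Module.finrank_baseChange, hdim, Module.finrank_pi_fintype]
      simp [mul_comm]
    rw [eq_top_iff]
    rintro y -
    obtain ⟨x, rfl⟩ := hsurj y
    induction x with
    | zero => simp
    | add x y hx hy => rw [map_add]; exact add_mem hx hy
    | tmul k v =>
      have : k ⊗ₜ[F] v = k • ((1 : K) ⊗ₜ[F] v) := by simp [TensorProduct.smul_tmul']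
      rw [this, map_smul]
      exact Submodule.smul_mem _ _ (Submodule.subset_span ⟨v, rfl⟩)

end HyperbolicCoordinates

/-! ### Split algebras with involution, and transport along isomorphisms -/

section SplitPair

theorem smul_one_injective {K ι : Type*} [Field K] [DecidableEq ι] [Nonempty ι] {k l : K}
    (h : k • (1 : Matrix ι ι K) = l • (1 : Matrix ι ι K)) : k = l := by
  obtain ⟨i⟩ := ‹Nonempty ι›
  simpa using congrFun (congrFun h i) i

/-- A splitting of an algebra with involution, of orthogonal type, together with an involutive
automorphism which exchanges the two factors. -/
structure SplitPair (F : Type u) (K : Type w) (ι : Type) {A : Type v} [Field F] [Field K]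
    [Algebra F K] [Fintype ι] [DecidableEq ι] [Ring A] [Algebra F A] (σ : AlgInvolution F A)
    extends SplitData F K ι A where
  C₁ : Matrix ι ι K
  C₂ : Matrix ι ι K
  isOrthogonal : toSplitData.IsOrthogonal σ C₁ C₂
  θ : A →ₐ[F] A
  θ_θ : ∀ a, θ (θ a) = a
  σ_θ : ∀ a, σ (θ a) = θ (σ a)
  P : Matrix ι ι K
  R : Matrix ι ι K
  P_mul_R : P * R = 1
  R_mul_P : R * P = 1
  ψ₁_θ : ∀ a, ψ₁ (θ a) = P * ψ₂ a * R
  ψ₂_θ : ∀ a, ψ₂ (θ a) = R * ψ₁ a * P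

variable {F : Type u} {K : Type w} {ι : Type} {A : Type v} [Field F] [Field K]
    [Algebra F K] [Fintype ι] [DecidableEq ι] [Ring A] [Algebra F A]

namespace SplitPair

variable {σ : AlgInvolution F A}

theorem χ_θ [Nonempty ι] (S : SplitPair F K ι σ) (z z' : Subalgebra.center F A)
    (h : (z' : A) = S.θ z) : S.χ₁ z' = S.χ₂ z ∧ S.χ₂ z' = S.χ₁ z := by
  constructor
  · apply smul_one_injective (ι := ι)
    rw [← S.hχ₁, h, S.ψ₁_θ, S.hχ₂, mul_smul_comm, mul_one, smul_mul_assoc, S.P_mul_R]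
  · apply smul_one_injective (ι := ι)
    rw [← S.hχ₂, h, S.ψ₂_θ, S.hχ₁, mul_smul_comm, mul_one, smul_mul_assoc, S.R_mul_P]

theorem isQuadraticPair [Nonempty ι] [Algebra.IsAlgebraic F K] (S : SplitPair F K ι σ)
    (hn : (2 : K) = 0 ∨ (Fintype.card ι : K) ≠ 0) {u : A} (hu : u + σ u = 1) :
    IsQuadraticPair σ (semitraceOf σ u) :=
  S.isOrthogonal.isQuadraticPair hn S.θ S.θ_θ S.σ_θ S.χ_θ hu

/-- Transport of a splitting along an isomorphism of algebras with involution. -/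
theorem exists_congr [Nonempty ι] (S : SplitPair F K ι σ) {B : Type*} [Ring B] [Algebra F B]
    (Φ : A ≃ₐ[F] B) {τ : AlgInvolution F B} (hΦ : ∀ a, Φ (σ a) = τ (Φ a)) :
    ∃ S' : SplitPair F K ι τ, (∀ a, S'.ψ₁ (Φ a) = S.ψ₁ a) ∧ (∀ a, S'.ψ₂ (Φ a) = S.ψ₂ a) := by
  have := S.module_finite
  have : Module.Finite F B := Module.Finite.equiv Φ.toLinearEquiv
  let ψ₁ := S.ψ₁.comp Φ.symm.toAlgHom
  let ψ₂ := S.ψ₂.comp Φ.symm.toAlgHom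
  have h₁ : ∀ a, ψ₁ (Φ a) = S.ψ₁ a := fun a => congrArg S.ψ₁ (Φ.symm_apply_apply a)
  have h₂ : ∀ a, ψ₂ (Φ a) = S.ψ₂ a := fun a => congrArg S.ψ₂ (Φ.symm_apply_apply a)
  obtain ⟨D, hD₁, hD₂⟩ := exists_splitData ψ₁ ψ₂
    (fun p => by
      have := S.mem_span p
      rwa [← Φ.symm.surjective.range_comp] at this)
    (by rw [← Φ.toLinearEquiv.finrank_eq]; exact S.finrank_eq.le)
  have hD₁' : ∀ a, D.ψ₁ (Φ a) = S.ψ₁ a := fun a => by rw [hD₁, h₁]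
  have hD₂' : ∀ a, D.ψ₂ (Φ a) = S.ψ₂ a := fun a => by rw [hD₂, h₂]
  refine ⟨{ D with
    C₁ := S.C₁
    C₂ := S.C₂
    isOrthogonal := ⟨S.isOrthogonal.isUnit₁, S.isOrthogonal.isUnit₂, S.isOrthogonal.symm₁,
      S.isOrthogonal.symm₂, Φ.surjective.forall.2 fun a => ?_, Φ.surjective.forall.2 fun a => ?_⟩
    θ := Φ.toAlgHom.comp (S.θ.comp Φ.symm.toAlgHom)
    θ_θ := fun a => ?_
    σ_θ := Φ.surjective.forall.2 fun a => ?_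
    P := S.P
    R := S.R
    P_mul_R := S.P_mul_R
    R_mul_P := S.R_mul_P
    ψ₁_θ := Φ.surjective.forall.2 fun a => ?_
    ψ₂_θ := Φ.surjective.forall.2 fun a => ?_ }, hD₁', hD₂'⟩
  · rw [← hΦ, hD₁', hD₁', S.isOrthogonal.apply₁]
  · rw [← hΦ, hD₂', hD₂', S.isOrthogonal.apply₂]
  · change Φ (S.θ (Φ.symm (Φ (S.θ (Φ.symm a))))) = a
    rw [Φ.symm_apply_apply, S.θ_θ, Φ.apply_symm_apply]
  · change τ (Φ (S.θ (Φ.symm (Φ a)))) = Φ (S.θ (Φ.symm (τ (Φ a))))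
    rw [← hΦ, ← hΦ, Φ.symm_apply_apply, Φ.symm_apply_apply, S.σ_θ]
  · change D.ψ₁ (Φ (S.θ (Φ.symm (Φ a)))) = S.P * D.ψ₂ (Φ a) * S.R
    rw [Φ.symm_apply_apply, hD₁', hD₂', S.ψ₁_θ]
  · change D.ψ₂ (Φ (S.θ (Φ.symm (Φ a)))) = S.R * D.ψ₁ (Φ a) * S.P
    rw [Φ.symm_apply_apply, hD₁', hD₂', S.ψ₂_θ]

end SplitPair

/-- Compatible splittings of two isomorphic algebras compute the same reduced trace. -/
theorem SplitData.map_reducedTrace [Nonempty ι] [Algebra.IsAlgebraic F K]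
    (hn : (2 : K) = 0 ∨ (Fintype.card ι : K) ≠ 0) (D : SplitData F K ι A) {B : Type*} [Ring B]
    [Algebra F B] (D' : SplitData F K ι B) (Φ : A ≃ₐ[F] B) (h₁ : ∀ a, D'.ψ₁ (Φ a) = D.ψ₁ a)
    (h₂ : ∀ a, D'.ψ₂ (Φ a) = D.ψ₂ a) (a : A) :
    Φ (reducedTrace (Subalgebra.center F A) A a) =
      (reducedTrace (Subalgebra.center F B) B (Φ a) : B) := by
  have h := (D.isReducedTrace_reducedTrace hn).2 a
  have h' := (D'.isReducedTrace_reducedTrace hn).2 (Φ a)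
  apply D'.ext_of_eq
  · rw [h₁, D.hχ₁, D'.hχ₁, h.1, h'.1, h₁]
  · rw [h₂, D.hχ₂, D'.hχ₂, h.2, h'.2, h₂]

end SplitPair

/-! ### Upper bounds for the dimension of Clifford algebras -/

section CliffordDimension

variable {F : Type u} [Field F] {V : Type v} [AddCommGroup V] [Module F V]
  (q : QuadraticForm F V)

theorem ι_mul_ι_comm (v w : V) :
    CliffordAlgebra.ι q v * CliffordAlgebra.ι q w =
      algebraMap F _ (QuadraticMap.polar q v w) -
        CliffordAlgebra.ι q w * CliffordAlgebra.ι q v := by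
  rw [← CliffordAlgebra.ι_mul_ι_add_swap, add_sub_cancel_right]

/-- The subalgebra generated by `n` vectors has dimension at most `2 ^ n`. -/
theorem finrank_adjoin_le (s : Finset V) :
    Module.Finite F (Algebra.adjoin F (CliffordAlgebra.ι q '' s)) ∧
      Module.finrank F (Algebra.adjoin F (CliffordAlgebra.ι q '' s)) ≤ 2 ^ s.card := by
  classical
  induction s using Finset.induction_on with
  | empty =>
    rw [Finset.coe_empty, Set.image_empty, Algebra.adjoin_empty]
    have hsurj : Function.Surjective
        (Algebra.linearMap F (⊥ : Subalgebra F (CliffordAlgebra q))) := by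
      rintro ⟨_, hx⟩
      obtain ⟨r, rfl⟩ := Algebra.mem_bot.1 hx
      exact ⟨r, rfl⟩
    refine ⟨inferInstance, (LinearMap.finrank_le_finrank_of_surjective hsurj).trans ?_⟩
    simp
  | insert e s he ih =>
    obtain ⟨hfin, hle⟩ := ih
    set A := Algebra.adjoin F (CliffordAlgebra.ι q '' s) with hA
    let A' : Submodule F (CliffordAlgebra q) := Subalgebra.toSubmodule A
    -- A + A·e is stable under right multiplication by e, whose square is a scalar, and by the
    -- earlier vectors, which anticommute with e up to scalars. It contains 1, hence the enlarged
    -- subalgebra, so each new vector at most doubles the dimension.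
    let T : Submodule F (CliffordAlgebra q) :=
      A' ⊔ A'.map (LinearMap.mulRight F (CliffordAlgebra.ι q e))
    have hAT : ∀ a ∈ A, a ∈ T := fun a ha => Submodule.mem_sup_left ha
    have hAeT : ∀ a ∈ A, a * CliffordAlgebra.ι q e ∈ T := fun a ha =>
      Submodule.mem_sup_right ⟨a, ha, rfl⟩
    have hTe : ∀ t ∈ T, t * CliffordAlgebra.ι q e ∈ T := by
      intro t ht
      obtain ⟨a, ha, _, ⟨b, hb, rfl⟩, rfl⟩ := Submodule.mem_sup.1 ht
      rw [LinearMap.mulRight_apply, add_mul, mul_assoc, CliffordAlgebra.ι_sq_scalar,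
        ← Algebra.commutes, ← Algebra.smul_def]
      exact T.add_mem (hAeT a ha) (T.smul_mem _ (hAT b hb))
    have hTw : ∀ w ∈ s, ∀ t ∈ T, t * CliffordAlgebra.ι q w ∈ T := by
      intro w hw t ht
      have hw' : CliffordAlgebra.ι q w ∈ A := Algebra.subset_adjoin ⟨w, hw, rfl⟩
      obtain ⟨a, ha, _, ⟨b, hb, rfl⟩, rfl⟩ := Submodule.mem_sup.1 ht
      rw [LinearMap.mulRight_apply, add_mul, mul_assoc, ι_mul_ι_comm, mul_sub,
        ← Algebra.commutes, ← Algebra.smul_def, ← mul_assoc]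
      exact T.add_mem (hAT _ (A.mul_mem ha hw'))
        (T.sub_mem (T.smul_mem _ (hAT b hb)) (hAeT _ (A.mul_mem hb hw')))
    let N : Subalgebra F (CliffordAlgebra q) :=
      { carrier := {x | ∀ t ∈ T, t * x ∈ T}
        mul_mem' := fun {x y} hx hy t ht => by rw [← mul_assoc]; exact hy _ (hx t ht)
        add_mem' := fun {x y} hx hy t ht => by
          rw [mul_add]; exact T.add_mem (hx t ht) (hy t ht)
        algebraMap_mem' := fun r t ht => by
          rw [← Algebra.commutes, ← Algebra.smul_def]; exact T.smul_mem r ht }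
    have hN : Algebra.adjoin F (CliffordAlgebra.ι q '' (insert e s : Finset V)) ≤ N := by
      rw [Algebra.adjoin_le_iff]
      rintro _ ⟨w, hw, rfl⟩
      rw [Finset.coe_insert, Set.mem_insert_iff] at hw
      rcases hw with rfl | hw
      · exact hTe
      · exact hTw w hw
    have hT : Subalgebra.toSubmodule
        (Algebra.adjoin F (CliffordAlgebra.ι q '' (insert e s : Finset V))) ≤ T := by
      intro x hx
      rw [← one_mul x]
      exact hN hx 1 (hAT 1 A.one_mem)
    have hfin' : Module.Finite F A' := hfin
    have hle' : Module.finrank F A' ≤ 2 ^ s.card := hle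
    refine ⟨Submodule.finiteDimensional_of_le hT, ?_⟩
    rw [Finset.card_insert_of_notMem he, pow_succ]
    calc Module.finrank F (Subalgebra.toSubmodule
        (Algebra.adjoin F (CliffordAlgebra.ι q '' (insert e s : Finset V))))
        ≤ Module.finrank F T := Submodule.finrank_mono hT
      _ ≤ Module.finrank F A' + Module.finrank F
          (A'.map (LinearMap.mulRight F (CliffordAlgebra.ι q e))) :=
        Submodule.finrank_add_le_finrank_add_finrank _ _
      _ ≤ Module.finrank F A' + Module.finrank F A' :=
        Nat.add_le_add_left (Submodule.finrank_map_le _ _) _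
      _ ≤ 2 ^ s.card * 2 := by omega

theorem finrank_cliffordAlgebra_le [FiniteDimensional F V] :
    Module.Finite F (CliffordAlgebra q) ∧
      Module.finrank F (CliffordAlgebra q) ≤ 2 ^ Module.finrank F V := by
  classical
  let b := Module.finBasis F V
  let s : Finset V := Finset.univ.image b
  have htop : Algebra.adjoin F (CliffordAlgebra.ι q '' s) = ⊤ := by
    rw [eq_top_iff, ← CliffordAlgebra.adjoin_range_ι, Algebra.adjoin_le_iff]
    rintro _ ⟨v, rfl⟩
    rw [← b.sum_repr v, map_sum]
    refine Subalgebra.sum_mem _ fun i _ => ?_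
    rw [map_smul]
    exact Subalgebra.smul_mem _ (Algebra.subset_adjoin (Set.mem_image_of_mem _ (by simp [s]))) _
  obtain ⟨h1, h2⟩ := finrank_adjoin_le q s
  rw [htop] at h1 h2
  refine ⟨Module.Finite.equiv Subalgebra.topEquiv.toLinearEquiv, ?_⟩
  rw [← (Subalgebra.topEquiv (R := F) (A := CliffordAlgebra q)).toLinearEquiv.finrank_eq]
  refine h2.trans (Nat.pow_le_pow_right two_pos (Finset.card_image_le.trans ?_))
  simp

/-- Left multiplication by an anisotropic vector embeds the even part in the odd part. The reverse
bound comes from the half-spin representations. -/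
theorem finrank_even_le [FiniteDimensional F V] {v : V} (hv : q v ≠ 0) :
    Module.Finite F (CliffordAlgebra.even q) ∧
      2 * Module.finrank F (CliffordAlgebra.even q) ≤ 2 ^ Module.finrank F V := by
  obtain ⟨h1, h2⟩ := finrank_cliffordAlgebra_le q
  refine ⟨inferInstance, ?_⟩
  have h3 := Submodule.finrank_add_eq_of_isCompl (CliffordAlgebra.evenOdd_isCompl (Q := q))
  have h4 : Module.finrank F (CliffordAlgebra.evenOdd q 0) ≤
      Module.finrank F (CliffordAlgebra.evenOdd q 1) := by
    let f : CliffordAlgebra.evenOdd q 0 →ₗ[F] CliffordAlgebra.evenOdd q 1 :=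
      (LinearMap.mulLeft F (CliffordAlgebra.ι q v)).restrict fun x hx => by
        have := SetLike.mul_mem_graded (CliffordAlgebra.ι_mem_evenOdd_one q v) hx
        rwa [add_zero] at this
    refine LinearMap.finrank_le_finrank_of_injective (f := f) fun x y hxy => Subtype.ext ?_
    have h5 : CliffordAlgebra.ι q v * (x : CliffordAlgebra q) = CliffordAlgebra.ι q v * y :=
      congrArg Subtype.val hxy
    have h6 := congrArg (CliffordAlgebra.ι q v * ·) h5
    simp only [← mul_assoc, CliffordAlgebra.ι_sq_scalar, ← Algebra.smul_def] at h6
    exact smul_right_injective _ hv h6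
  change 2 * Module.finrank F (CliffordAlgebra.evenOdd q 0) ≤ _
  omega

end CliffordDimension

/-! ### The even Clifford algebra: conjugation by a vector, and its splitting -/

section EvenClifford

variable {F : Type u} [Field F] {V : Type v} [AddCommGroup V] [Module F V]
  (q : QuadraticForm F V)

variable {q} in
theorem even_induction {P : CliffordAlgebra.even q → Prop} (halg : ∀ r, P (algebraMap F _ r))
    (hadd : ∀ x y, P x → P y → P (x + y)) (hmul : ∀ v w x, P x → P (evenMul q v w * x))
    (x : CliffordAlgebra.even q) : P x := by
  obtain ⟨x, hx⟩ := x
  induction x, hx using CliffordAlgebra.even_induction q with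
  | algebraMap r => exact halg r
  | add x y hx hy ihx ihy => exact hadd _ _ ihx ihy
  | ι_mul_ι_mul v w x hx ih => exact hmul v w _ ih

theorem evenInvolution_evenMul (v w : V) :
    evenInvolution q (evenMul q v w) = evenMul q w v := by
  apply Subtype.ext
  rw [coe_evenInvolution, coe_evenMul, coe_evenMul, CliffordAlgebra.reverse.map_mul,
    CliffordAlgebra.reverse_ι, CliffordAlgebra.reverse_ι]

theorem evenMul_self (v : V) : evenMul q v v = algebraMap F _ (q v) :=
  Subtype.ext (CliffordAlgebra.ι_sq_scalar q v)

theorem evenMul_add_swap (v w : V) :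
    evenMul q v w + evenMul q w v = algebraMap F _ (QuadraticMap.polar q v w) :=
  Subtype.ext (CliffordAlgebra.ι_mul_ι_add_swap v w)

theorem evenMul_mul_evenMul (u v w : V) :
    evenMul q u v * evenMul q v w = q v • evenMul q u w :=
  (CliffordAlgebra.even.ι q).contract_mid u v w

theorem evenInvolution_algebraMap (r : F) :
    evenInvolution q (algebraMap F _ r) = algebraMap F _ r :=
  Subtype.ext (CliffordAlgebra.reverse.commutes r)

section Conjugation

variable {q} {v : V} (hv : q v ≠ 0)

/-- Conjugation of the even Clifford algebra by an anisotropic vector. -/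
def evenConj : CliffordAlgebra.even q →ₐ[F] CliffordAlgebra.even q :=
  CliffordAlgebra.even.lift q
    { bilin := (q v)⁻¹ • ((LinearMap.mul F (CliffordAlgebra.even q)).compl₁₂
        ((CliffordAlgebra.even.ι q).bilin v) ((CliffordAlgebra.even.ι q).bilin.flip v))
      contract := fun a => by
        change (q v)⁻¹ • (evenMul q v a * evenMul q a v) = _
        rw [evenMul_mul_evenMul, evenMul_self, Algebra.smul_def, Algebra.smul_def, ← map_mul,
          ← map_mul, mul_comm (q a), inv_mul_cancel_left₀ hv]
      contract_mid := fun a b c => by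
        change ((q v)⁻¹ • (evenMul q v a * evenMul q b v)) *
          ((q v)⁻¹ • (evenMul q v b * evenMul q c v)) =
          q b • ((q v)⁻¹ • (evenMul q v a * evenMul q c v))
        rw [smul_mul_smul_comm, mul_assoc, ← mul_assoc (evenMul q b v), evenMul_mul_evenMul,
          evenMul_self, smul_mul_assoc, ← Algebra.smul_def, mul_smul_comm, mul_smul_comm,
          smul_smul, smul_smul, smul_smul]
        congr 1
        field_simp }

theorem evenConj_evenMul (a b : V) :
    evenConj hv (evenMul q a b) = (q v)⁻¹ • (evenMul q v a * evenMul q b v) :=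
  CliffordAlgebra.even.lift_ι q _ a b

theorem ι_mul_ι_mul_cancel (v : V) (x : CliffordAlgebra q) :
    CliffordAlgebra.ι q v * (CliffordAlgebra.ι q v * x) = q v • x := by
  rw [← mul_assoc, CliffordAlgebra.ι_sq_scalar, Algebra.smul_def]

theorem coe_evenConj (x : CliffordAlgebra.even q) :
    (evenConj hv x : CliffordAlgebra q) =
      (q v)⁻¹ • (CliffordAlgebra.ι q v * x * CliffordAlgebra.ι q v) := by
  induction x using even_induction with
  | halg r =>
    rw [AlgHom.commutes]
    change algebraMap F (CliffordAlgebra q) r =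
      (q v)⁻¹ • (CliffordAlgebra.ι q v * algebraMap F (CliffordAlgebra q) r * CliffordAlgebra.ι q v)
    rw [mul_assoc, Algebra.commutes, ι_mul_ι_mul_cancel, inv_smul_smul₀ hv]
  | hadd x y hx hy =>
    rw [map_add, Subalgebra.coe_add, hx, hy, Subalgebra.coe_add, mul_add, add_mul, smul_add]
  | hmul a b x ih =>
    rw [map_mul, Subalgebra.coe_mul, ih, evenConj_evenMul, Subalgebra.coe_smul, Subalgebra.coe_mul,
      Subalgebra.coe_mul, coe_evenMul, coe_evenMul, coe_evenMul]
    simp only [smul_mul_assoc, mul_smul_comm, mul_assoc, ι_mul_ι_mul_cancel, smul_smul]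
    rw [inv_mul_cancel₀ hv, mul_one]

theorem evenConj_evenConj (x : CliffordAlgebra.even q) : evenConj hv (evenConj hv x) = x := by
  apply Subtype.ext
  rw [coe_evenConj, coe_evenConj, mul_smul_comm, smul_mul_assoc, mul_assoc,
    mul_assoc _ (CliffordAlgebra.ι q v) (CliffordAlgebra.ι q v), CliffordAlgebra.ι_sq_scalar,
    mul_assoc, ← Algebra.commutes, ← Algebra.smul_def, mul_smul_comm, mul_smul_comm,
    ι_mul_ι_mul_cancel, smul_smul, smul_smul, smul_smul]
  rw [show (q v)⁻¹ * (q v)⁻¹ * q v * q v = 1 by field_simp, one_smul]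

theorem evenInvolution_evenConj (x : CliffordAlgebra.even q) :
    evenInvolution q (evenConj hv x) = evenConj hv (evenInvolution q x) := by
  apply Subtype.ext
  rw [coe_evenInvolution, coe_evenConj, coe_evenConj, coe_evenInvolution, map_smul,
    CliffordAlgebra.reverse.map_mul, CliffordAlgebra.reverse.map_mul, CliffordAlgebra.reverse_ι,
    mul_assoc]

end Conjugation

section Spin

variable {K : Type w} [Field K] [Algebra F K] {ι : Type} [Fintype ι] [DecidableEq ι]

variable {q} in
/-- The half-spin representation of the even Clifford algebra. -/
def halfSpin (α β : V →ₗ[F] Matrix ι ι K) (h₁ : ∀ v, α v * β v = algebraMap F K (q v) • 1)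
    (h₂ : ∀ v, β v * α v = algebraMap F K (q v) • 1) :
    CliffordAlgebra.even q →ₐ[F] Matrix ι ι K :=
  CliffordAlgebra.even.lift q
    { bilin := (LinearMap.mul F (Matrix ι ι K)).compl₁₂ α β
      contract := fun v => by
        change α v * β v = _
        rw [h₁, Matrix.smul_one_eq_diagonal]; rfl
      contract_mid := fun a b c => by
        change α a * β b * (α b * β c) = q b • (α a * β c)
        rw [mul_assoc, ← mul_assoc (β b), h₂, smul_one_mul, mul_smul_comm, algebraMap_smul] }

variable {q} in
theorem halfSpin_evenMul {α β : V →ₗ[F] Matrix ι ι K}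
    (h₁ : ∀ v, α v * β v = algebraMap F K (q v) • 1)
    (h₂ : ∀ v, β v * α v = algebraMap F K (q v) • 1) (a b : V) :
    halfSpin α β h₁ h₂ (evenMul q a b) = α a * β b :=
  CliffordAlgebra.even.lift_ι q _ a b

-- Conjugation by v exchanges the two half-spin representations up to the intertwiners α(v) and
-- β(v); this is how it comes to exchange the two characters of the centre.
variable {q} in
theorem halfSpin_evenConj {α β : V →ₗ[F] Matrix ι ι K}
    (h₁ : ∀ v, α v * β v = algebraMap F K (q v) • 1)
    (h₂ : ∀ v, β v * α v = algebraMap F K (q v) • 1) {v : V} (hv : q v ≠ 0)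
    (x : CliffordAlgebra.even q) :
    halfSpin α β h₁ h₂ (evenConj hv x) = (q v)⁻¹ • (α v * halfSpin β α h₂ h₁ x * β v) := by
  have hv' : ∀ M : Matrix ι ι K, β v * (α v * M) = q v • M := fun M => by
    rw [← mul_assoc, h₂, smul_one_mul, algebraMap_smul]
  induction x using even_induction with
  | halg r =>
    rw [AlgHom.commutes, AlgHom.commutes, AlgHom.commutes, ← Algebra.commutes, mul_assoc, h₁,
      algebraMap_smul, mul_smul_comm, mul_one, inv_smul_smul₀ hv]
  | hadd x y hx hy => rw [map_add, map_add, hx, hy, map_add, mul_add, add_mul, smul_add]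
  | hmul a b x ih =>
    rw [map_mul, map_mul, ih, evenConj_evenMul, map_smul, map_mul, map_mul, halfSpin_evenMul,
      halfSpin_evenMul, halfSpin_evenMul]
    simp only [smul_mul_assoc, mul_smul_comm, mul_assoc, hv', smul_smul]
    rw [inv_mul_cancel₀ hv, mul_one]

-- The compatibilities of C₁ and C₂ with vectors carry the factors of a product past the Gram
-- matrices one at a time, alternating between the two and reversing the order.
variable {q} in
theorem halfSpin_evenInvolution {α β : V →ₗ[F] Matrix ι ι K}
    (h₁ : ∀ v, α v * β v = algebraMap F K (q v) • 1)
    (h₂ : ∀ v, β v * α v = algebraMap F K (q v) • 1) {C₁ C₂ : Matrix ι ι K}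
    (hα : ∀ x, (α x).transpose * C₁ = C₂ * β x) (hβ : ∀ x, (β x).transpose * C₂ = C₁ * α x)
    (x : CliffordAlgebra.even q) :
    C₁ * halfSpin α β h₁ h₂ (evenInvolution q x) = (halfSpin α β h₁ h₂ x).transpose * C₁ := by
  induction x using even_induction with
  | halg r =>
    rw [evenInvolution_algebraMap, AlgHom.commutes, ← Algebra.commutes,
      Matrix.algebraMap_eq_diagonal, Matrix.diagonal_transpose]
  | hadd x y hx hy =>
    rw [map_add, map_add, mul_add, hx, hy, map_add, Matrix.transpose_add, add_mul]
  | hmul a b x ih =>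
    rw [AlgInvolution.map_mul_rev, map_mul, map_mul, ← mul_assoc, ih, evenInvolution_evenMul,
      halfSpin_evenMul, halfSpin_evenMul, Matrix.transpose_mul, Matrix.transpose_mul, mul_assoc,
      mul_assoc, mul_assoc, hα, ← mul_assoc C₁, ← hβ, mul_assoc]

/-- The span is closed under multiplication because the image is, and by bilinearity it contains the
products for all vectors of the extended space, so it contains the spin algebra. -/
theorem halfSpin_mem_span {H : Type*} [AddCommGroup H] [Module K H] [Module F H]
    [IsScalarTower F K H] (j : V →ₗ[F] H) (hj : Submodule.span K (Set.range j) = ⊤)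
    (α β : H →ₗ[K] Matrix ι ι K) (h : spinAlgebra α β = ⊤)
    {ψ₁ ψ₂ : CliffordAlgebra.even q →ₐ[F] Matrix ι ι K}
    (hψ₁ : ∀ v w, ψ₁ (evenMul q v w) = α (j v) * β (j w))
    (hψ₂ : ∀ v w, ψ₂ (evenMul q v w) = β (j v) * α (j w)) (p : Matrix ι ι K × Matrix ι ι K) :
    p ∈ Submodule.span K (Set.range fun a => (ψ₁ a, ψ₂ a)) := by
  set S := Submodule.span K (Set.range fun a => (ψ₁ a, ψ₂ a)) with hS
  have hψ : ∀ a, (ψ₁ a, ψ₂ a) ∈ S := fun a => Submodule.subset_span ⟨a, rfl⟩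
  have hgen : ∀ x y : H, (α x * β y, β x * α y) ∈ S := by
    intro x y
    have hx : x ∈ Submodule.span K (Set.range j) := hj ▸ Submodule.mem_top
    have hy : y ∈ Submodule.span K (Set.range j) := hj ▸ Submodule.mem_top
    induction hx using Submodule.span_induction with
    | mem x hx =>
      obtain ⟨v, rfl⟩ := hx
      induction hy using Submodule.span_induction with
      | mem y hy =>
        obtain ⟨w, rfl⟩ := hy
        rw [← hψ₁, ← hψ₂]
        exact hψ _
      | zero =>
        simp only [map_zero, mul_zero]
        exact S.zero_mem
      | add y y' _ _ hy hy' => simpa [mul_add] using S.add_mem hy hy'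
      | smul c y _ hy => simpa using S.smul_mem c hy
    | zero =>
      simp only [map_zero, zero_mul]
      exact S.zero_mem
    | add y y' _ _ hy hy' => simpa [add_mul] using S.add_mem hy hy'
    | smul c y _ hy => simpa using S.smul_mem c hy
  have hmul : ∀ x y, x ∈ S → y ∈ S → x * y ∈ S := by
    intro x y hx hy
    induction hx using Submodule.span_induction with
    | mem x hx =>
      obtain ⟨v, rfl⟩ := hx
      induction hy using Submodule.span_induction with
      | mem y hy =>
        obtain ⟨w, rfl⟩ := hy
        have := hψ (v * w)
        rwa [map_mul, map_mul] at this
      | zero => rw [mul_zero]; exact S.zero_mem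
      | add y y' _ _ hy hy' => rw [mul_add]; exact S.add_mem hy hy'
      | smul c y _ hy => rw [mul_smul_comm]; exact S.smul_mem c hy
    | zero => rw [zero_mul]; exact S.zero_mem
    | add y y' _ _ hy hy' => rw [add_mul]; exact S.add_mem hy hy'
    | smul c y _ hy => rw [smul_mul_assoc]; exact S.smul_mem c hy
  have hone : (1 : Matrix ι ι K × Matrix ι ι K) ∈ S := by
    have := hψ 1
    rwa [map_one, map_one] at this
  have hle : spinAlgebra α β ≤ S.toSubalgebra hone hmul := by
    rw [spinAlgebra, Algebra.adjoin_le_iff]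
    rintro _ ⟨⟨x, y⟩, rfl⟩
    exact hgen x y
  exact hle (h ▸ Algebra.mem_top)

/-- The even Clifford algebra of a nonsingular quadratic space of dimension `2 m` is split by an
algebraically closed field, and its canonical involution is orthogonal if `m` is even and
`(-1) ^ (m / 2) = 1`. -/
theorem exists_splitPair_even [IsAlgClosed K] [FiniteDimensional F V]
    (hq : LinearMap.BilinForm.Nondegenerate q.polarBilin) {k : ℕ}
    (hdim : Module.finrank F V = 2 * (k + 1)) (heven : Even (k + 1))
    (hε : (-1 : K) ^ ((k + 1) / 2) = 1) {v : V} (hv : q v ≠ 0) :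
    ∃ (ι : Type) (_ : Fintype ι) (_ : DecidableEq ι), Fintype.card ι = 2 ^ k ∧
      Nonempty (SplitPair F K ι (evenInvolution q)) := by
  obtain ⟨j, hj, hjtop⟩ := exists_hyperbolicCoordinates_extension (K := K) q hq hdim
  obtain ⟨ι, _, _, hcard, α, β, h₁, h₂, hspin, C₁, C₂, hC, -⟩ := exists_halfSpin K k
  refine ⟨ι, inferInstance, inferInstance, hcard, ?_⟩
  have hC := hC heven
  rw [hε] at hC
  have : Nonempty ι := Fintype.card_pos_iff.1 (by rw [hcard]; positivity)
  let a : V →ₗ[F] Matrix ι ι K := (α.restrictScalars F).comp j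
  let b : V →ₗ[F] Matrix ι ι K := (β.restrictScalars F).comp j
  have hab : ∀ v, a v * b v = algebraMap F K (q v) • 1 := fun v => by rw [hj]; exact h₁ (j v)
  have hba : ∀ v, b v * a v = algebraMap F K (q v) • 1 := fun v => by rw [hj]; exact h₂ (j v)
  have hfin := finrank_even_le q hv
  have := hfin.1
  obtain ⟨D, hD₁, hD₂⟩ := exists_splitData (halfSpin a b hab hba) (halfSpin b a hba hab)
    (halfSpin_mem_span q j hjtop α β hspin (halfSpin_evenMul hab hba) (halfSpin_evenMul hba hab))
    (by
      have h := hfin.2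
      rw [hdim] at h
      rw [hcard]
      have : 2 ^ (2 * (k + 1)) = 2 * (2 * (2 ^ k) ^ 2) := by ring
      omega)
  exact ⟨{ D with
    C₁ := C₁
    C₂ := C₂
    isOrthogonal := ⟨hC.isUnit₁, hC.isUnit₂, by rw [hC.symm₁, one_smul],
      by rw [hC.symm₂, one_smul],
      fun x => by
        rw [hD₁]
        exact halfSpin_evenInvolution hab hba (fun x => hC.apply₁ (j x))
          (fun x => hC.apply₂ (j x)) x,
      fun x => by
        rw [hD₂]
        exact halfSpin_evenInvolution hba hab (fun x => hC.apply₂ (j x))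
          (fun x => hC.apply₁ (j x)) x⟩
    θ := evenConj hv
    θ_θ := evenConj_evenConj hv
    σ_θ := evenInvolution_evenConj hv
    P := a v
    R := (q v)⁻¹ • b v
    P_mul_R := by
      rw [mul_smul_comm, hab, algebraMap_smul, inv_smul_smul₀ hv]
    R_mul_P := by
      rw [smul_mul_assoc, hba, algebraMap_smul, inv_smul_smul₀ hv]
    ψ₁_θ := fun x => by
      rw [hD₁, hD₂, halfSpin_evenConj, mul_smul_comm]
    ψ₂_θ := fun x => by
      rw [hD₁, hD₂, halfSpin_evenConj, smul_mul_assoc, smul_mul_assoc] }⟩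

end Spin

end EvenClifford

/-! ### Testing linear maps on symmetric tensors -/

section SymmetricTensors

variable {F : Type u} [Field F] {V : Type v} [AddCommGroup V] [Module F V]
  {M : Type w} [AddCommGroup M] [Module F M]

/-- Terms exchanged by the involution have equal coefficients and cancel. Fixed indices need their
own hypothesis, because in characteristic 2 the cancellation says nothing about them. -/
theorem linearMap_eq_zero_of_repr_involution {W : Type*} [AddCommGroup W] [Module F W]
    {κ : Type*} [Fintype κ] (B : Module.Basis κ F W) (G : W →ₗ[F] M) (g : κ → κ)
    (hg : ∀ i, g (g i) = i) (h₁ : ∀ i, G (B i) + G (B (g i)) = 0)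
    (h₂ : ∀ i, g i = i → G (B i) = 0) (t : W) (ht : ∀ i, B.repr t (g i) = B.repr t i) :
    G t = 0 := by
  rw [← B.sum_repr t, map_sum]
  refine Finset.sum_ninvolution g (fun i => ?_) (fun i hi hgi => hi ?_)
    (fun _ => Finset.mem_univ _) hg
  · rw [map_smul, map_smul, ht, ← smul_add, h₁, smul_zero]
  · rw [map_smul, h₂ i hgi, smul_zero]

/-- A linear map that kills the squares `v ⊗ v` kills all the symmetric tensors. -/
theorem map_symmetricTensor_eq_zero [FiniteDimensional F V] (G : V ⊗[F] V →ₗ[F] M) (hG : ∀ v, G (v ⊗ₜ v) = 0)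
    (t : V ⊗[F] V) (ht : TensorProduct.comm F V V t = t) : G t = 0 := by
  let b := Module.finBasis F V
  have hadd : ∀ v w, G (v ⊗ₜ w) + G (w ⊗ₜ v) = 0 := fun v w => by
    have := hG (v + w)
    rw [TensorProduct.add_tmul, TensorProduct.tmul_add, TensorProduct.tmul_add] at this
    simpa [hG] using this
  refine linearMap_eq_zero_of_repr_involution (b.tensorProduct b) G Prod.swap Prod.swap_swap
    (fun i => ?_) (fun i hi => ?_) t fun i => ?_
  · rw [Module.Basis.tensorProduct_apply', Module.Basis.tensorProduct_apply']
    exact hadd _ _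
  · rw [Module.Basis.tensorProduct_apply']
    have : i.2 = i.1 := congrArg Prod.fst hi
    rw [this]
    exact hG _
  · have key : ∀ t : V ⊗[F] V, (b.tensorProduct b).repr t i.swap =
        (b.tensorProduct b).repr (TensorProduct.comm F V V t) i := by
      intro t
      induction t with
      | zero => simp
      | add x y hx hy => simp only [map_add, Finsupp.add_apply, hx, hy]
      | tmul v w =>
        rw [TensorProduct.comm_tmul, ← Prod.mk.eta (p := i), Prod.swap_prod_mk,
          Module.Basis.tensorProduct_repr_tmul_apply, Module.Basis.tensorProduct_repr_tmul_apply,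
          smul_eq_mul, smul_eq_mul, mul_comm]
    rw [key, ht]

/-- A linear map that kills the tensors `a ⊗ v ⊗ v ⊗ d` kills all the tensors which are symmetric
with respect to the two factors in the middle. -/
theorem map_middleSymmetric_eq_zero {κ : Type*} [Fintype κ] (b : Module.Basis κ F V)
    (G : (V ⊗[F] V) ⊗[F] (V ⊗[F] V) →ₗ[F] M)
    (hG : ∀ a v d, G ((a ⊗ₜ v) ⊗ₜ (v ⊗ₜ d)) = 0) (t : (V ⊗[F] V) ⊗[F] (V ⊗[F] V))
    (ht : ∀ i j k l, ((b.tensorProduct b).tensorProduct (b.tensorProduct b)).repr t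
      ((i, k), (j, l)) = ((b.tensorProduct b).tensorProduct (b.tensorProduct b)).repr t
      ((i, j), (k, l))) : G t = 0 := by
  have hadd : ∀ a v w d, G ((a ⊗ₜ v) ⊗ₜ (w ⊗ₜ d)) + G ((a ⊗ₜ w) ⊗ₜ (v ⊗ₜ d)) = 0 :=
    fun a v w d => by
    have := hG a (w + v) d
    simpa [TensorProduct.add_tmul, TensorProduct.tmul_add, hG] using this
  refine linearMap_eq_zero_of_repr_involution
    ((b.tensorProduct b).tensorProduct (b.tensorProduct b)) G
    (fun p => ((p.1.1, p.2.1), (p.1.2, p.2.2))) (fun _ => rfl) ?_ ?_ t ?_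
  · rintro ⟨⟨i, j⟩, ⟨k, l⟩⟩
    simp only [Module.Basis.tensorProduct_apply]
    exact hadd _ _ _ _
  · rintro ⟨⟨i, j⟩, ⟨k, l⟩⟩ h
    simp only [Prod.mk.injEq, true_and, and_true] at h
    rw [h.1]
    simp only [Module.Basis.tensorProduct_apply]
    exact hG _ _ _
  · rintro ⟨⟨i, j⟩, ⟨k, l⟩⟩
    exact ht i j k l

end SymmetricTensors

/-! ### The isomorphism C₀(q) ≃ C(Ad_q) -/

section CliffordIso

variable {F : Type u} [Field F] {V : Type v} [AddCommGroup V] [Module F V]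
  [FiniteDimensional F V] (q : QuadraticForm F V)
  (hq : LinearMap.BilinForm.Nondegenerate q.polarBilin)

theorem trace_stdIdent (v w : V) :
    LinearMap.trace F V (stdIdent q hq (v ⊗ₜ w)) = QuadraticMap.polar q w v := by
  have h : stdIdent q hq (v ⊗ₜ w) = dualTensorHom F V V ((q.polarBilin w) ⊗ₜ v) := by
    ext x
    rw [stdIdent_tmul, dualTensorHom_apply]
    rfl
  rw [h, LinearMap.trace_eq_contract_apply, contractLeft_apply]
  rfl

theorem mul_stdIdent (a : Module.End F V) (v w : V) :
    a * stdIdent q hq (v ⊗ₜ w) = stdIdent q hq (a v ⊗ₜ w) := by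
  ext x
  rw [Module.End.mul_apply, stdIdent_tmul, stdIdent_tmul, map_smul]

theorem stdIdent_mul_stdIdent (a b c d : V) :
    stdIdent q hq (a ⊗ₜ b) * stdIdent q hq (c ⊗ₜ d) =
      QuadraticMap.polar q b c • stdIdent q hq (a ⊗ₜ d) := by
  rw [mul_stdIdent, stdIdent_tmul, ← TensorProduct.smul_tmul', map_smul]

theorem sand_stdIdent (a b c d : V) (x : Module.End F V) :
    sand F (Module.End F V) (stdIdent q hq (a ⊗ₜ b) ⊗ₜ stdIdent q hq (c ⊗ₜ d)) x =
      QuadraticMap.polar q b (x c) • stdIdent q hq (a ⊗ₜ d) := by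
  rw [sand_tmul, mul_assoc, mul_stdIdent, stdIdent_mul_stdIdent]

/-- The sandwich map of this tensor sends x to b(v, x v) times a ⊗ d, and b(v, x v) = b(v, σ(x) v)
by adjunction and symmetry of b. -/
theorem isSigmaTwo_stdIdent (a v d : V) :
    IsSigmaTwo (adjointInvolution q hq) (stdIdent q hq (a ⊗ₜ v) ⊗ₜ[F] stdIdent q hq (v ⊗ₜ d))
      (stdIdent q hq (a ⊗ₜ v) ⊗ₜ[F] stdIdent q hq (v ⊗ₜ d)) := fun x => by
  rw [sand_stdIdent, sand_stdIdent, QuadraticMap.polar_comm q v (adjointInvolution q hq x v)]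
  exact congrArg (· • _) (polar_adjointMap q hq x v v).symm

/-- Both sides compute f_q(φ_q(v ⊗ v)), the left one as the trace of ℓφ_q(v ⊗ v). -/
theorem polar_eq_of_determines {l : Module.End F V}
    (hl : Determines (adjointInvolution q hq) (adjointSemitrace q hq) l) (v : V) :
    QuadraticMap.polar q v (l v) = q v := by
  rw [← adjointSemitrace_stdIdent q hq v, hl.2, reducedTrace_end, mul_stdIdent, trace_stdIdent]

/-- Take for ℓ the endomorphism with b(ℓ v, w) = β(v, w), where β is the bilinear form defining the
semi-trace. Then ℓ + σ(ℓ) = 1 says that β(v, w) + β(w, v) = b(v, w). -/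
theorem exists_determines :
    ∃ l, Determines (adjointInvolution q hq) (adjointSemitrace q hq) l := by
  obtain ⟨β, hβ, hf⟩ : ∃ β : LinearMap.BilinForm F V, β.toQuadraticMap = q ∧
      adjointSemitrace q hq = (TensorProduct.lift β).comp
        ((stdIdent q hq).symm.toLinearMap.comp (symElts (adjointInvolution q hq)).subtype) :=
    ⟨_, (LinearMap.BilinMap.toQuadraticMap_surjective q).choose_spec, rfl⟩
  let l : Module.End F V := (LinearMap.BilinForm.toDual q.polarBilin hq).symm.toLinearMap.comp β
  have hl : ∀ v w, QuadraticMap.polar q (l v) w = β v w := fun v w =>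
    LinearMap.BilinForm.apply_toDual_symm_apply (B := q.polarBilin) (hB := hq) (β v) w
  refine ⟨l, ?_, fun s => ?_⟩
  · rw [← eq_sub_iff_add_eq']
    refine eq_adjointMap q hq _ _ fun x y => ?_
    rw [LinearMap.sub_apply, Module.End.one_apply, sub_eq_add_neg, QuadraticMap.polar_add_left,
      QuadraticMap.polar_neg_left, hl, QuadraticMap.polar_comm q x (l y), hl, ← hβ]
    simp [QuadraticMap.polar]
    abel
  · rw [hf, reducedTrace_end]
    obtain ⟨t, ht⟩ := (stdIdent q hq).surjective s
    change TensorProduct.lift β ((stdIdent q hq).symm s) = _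
    rw [← ht, LinearEquiv.symm_apply_apply]
    clear ht
    induction t with
    | zero => simp
    | add x y hx hy => simp only [map_add, mul_add, hx, hy]
    | tmul v w =>
      rw [TensorProduct.lift.tmul, mul_stdIdent, trace_stdIdent, QuadraticMap.polar_comm, hl]

/-- The linear map `End V → C₀(q)` that maps `v ⊗ w` to `v w`. -/
def evenLinear : Module.End F V →ₗ[F] CliffordAlgebra.even q :=
  (TensorProduct.lift (CliffordAlgebra.even.ι q).bilin).comp (stdIdent q hq).symm.toLinearMap

theorem evenLinear_stdIdent (v w : V) :
    evenLinear q hq (stdIdent q hq (v ⊗ₜ w)) = evenMul q v w := by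
  simp only [evenLinear, LinearMap.comp_apply, LinearEquiv.coe_coe, LinearEquiv.symm_apply_apply,
    TensorProduct.lift.tmul]
  rfl

theorem adjointInvolution_stdIdent_eq_comm (t : V ⊗[F] V) :
    adjointInvolution q hq (stdIdent q hq t) = stdIdent q hq (TensorProduct.comm F V V t) := by
  induction t with
  | zero => simp
  | add x y hx hy => simp only [map_add, hx, hy]
  | tmul v w => rw [adjointInvolution_stdIdent, TensorProduct.comm_tmul]

theorem evenLinear_symmetric (s : symElts (adjointInvolution q hq)) :
    evenLinear q hq s = algebraMap F _ (adjointSemitrace q hq s) := by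
  obtain ⟨l, hl⟩ := exists_determines q hq
  rw [hl.2 s]
  obtain ⟨t, ht⟩ := (stdIdent q hq).surjective s
  have hs : TensorProduct.comm F V V t = t := (stdIdent q hq).injective (by
    rw [← adjointInvolution_stdIdent_eq_comm, ht]
    exact mem_symElts.1 s.2)
  rw [← ht, ← sub_eq_zero]
  refine map_symmetricTensor_eq_zero ((evenLinear q hq - (Algebra.linearMap F _).comp
    ((reducedTrace F (Module.End F V)).comp (LinearMap.mulLeft F l))).comp
      (stdIdent q hq).toLinearMap) (fun v => ?_) t hs
  change evenLinear q hq (stdIdent q hq (v ⊗ₜ v)) -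
    algebraMap F _ (reducedTrace F _ (l * stdIdent q hq (v ⊗ₜ v))) = 0
  rw [evenLinear_stdIdent, evenMul_self, reducedTrace_end, mul_stdIdent, trace_stdIdent,
    polar_eq_of_determines q hq hl, sub_self]

/-- The coordinates of a tensor can be read from its sandwich map, evaluated at tensors of dual
basis vectors. As σ exchanges the two factors of such an argument, σ₂-symmetry becomes symmetry in
the middle indices j and k. -/
theorem repr_sand_stdIdent {κ : Type*} [Fintype κ] [DecidableEq κ] (b : Module.Basis κ F V)
    (t : (V ⊗[F] V) ⊗[F] (V ⊗[F] V)) (i j k l : κ) :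
    ((b.tensorProduct b).tensorProduct (b.tensorProduct b)).repr t ((i, j), (k, l)) =
      (b.tensorProduct b).repr ((stdIdent q hq).symm (sand F (Module.End F V)
        (TensorProduct.congr (stdIdent q hq) (stdIdent q hq) t)
        (stdIdent q hq (LinearMap.BilinForm.dualBasis q.polarBilin hq b j ⊗ₜ
          LinearMap.BilinForm.dualBasis q.polarBilin hq b k)))) (i, l) := by
  have hd : ∀ x i, QuadraticMap.polar q (LinearMap.BilinForm.dualBasis q.polarBilin hq b i) x =
      b.repr x i := fun x i => by
    conv_lhs => rw [← b.sum_repr x]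
    change q.polarBilin _ _ = _
    rw [map_sum]
    simp [LinearMap.BilinForm.apply_dualBasis_left]
  induction t with
  | zero => simp
  | add x y hx hy => simp only [map_add, Finsupp.add_apply, LinearMap.add_apply, hx, hy]
  | tmul x y =>
    induction x with
    | zero => simp
    | add x x' hx hx' =>
      simp only [TensorProduct.add_tmul, map_add, Finsupp.add_apply, LinearMap.add_apply, hx, hx']
    | tmul p r =>
      induction y with
      | zero => simp
      | add y y' hy hy' =>
        simp only [TensorProduct.tmul_add, map_add, Finsupp.add_apply, LinearMap.add_apply, hy,
          hy']
      | tmul s t =>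
        rw [TensorProduct.congr_tmul, sand_stdIdent, stdIdent_tmul, map_smul,
          LinearEquiv.symm_apply_apply, map_smul, Finsupp.smul_apply,
          Module.Basis.tensorProduct_repr_tmul_apply, Module.Basis.tensorProduct_repr_tmul_apply,
          Module.Basis.tensorProduct_repr_tmul_apply, Module.Basis.tensorProduct_repr_tmul_apply,
          QuadraticMap.polar_smul_right, QuadraticMap.polar_comm q r, hd, hd]
        simp only [smul_eq_mul]
        ring

/-- It suffices to test tensors (a ⊗ v) ⊗ (v ⊗ d), where both sides are q(v)·ad: the left by
contraction of v·v, the right because b(v, ℓ v) = q(v). -/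
theorem evenLinear_sandwich {l : Module.End F V}
    (hl : Determines (adjointInvolution q hq) (adjointSemitrace q hq) l)
    {u : Module.End F V ⊗[F] Module.End F V} (hu : IsSigmaTwo (adjointInvolution q hq) u u) :
    LinearMap.mul' F _ (TensorProduct.map (evenLinear q hq) (evenLinear q hq) u) =
      evenLinear q hq (sand F _ u l) := by
  let b := Module.finBasis F V
  obtain ⟨t, rfl⟩ := (TensorProduct.congr (stdIdent q hq) (stdIdent q hq)).surjective u
  rw [← sub_eq_zero]
  refine map_middleSymmetric_eq_zero b
    (((LinearMap.mul' F _).comp (TensorProduct.map (evenLinear q hq) (evenLinear q hq)) -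
      (evenLinear q hq).comp ((sand F _).flip l)).comp
        (TensorProduct.congr (stdIdent q hq) (stdIdent q hq)).toLinearMap)
    (fun a v d => ?_) t fun i j k l => ?_
  · change LinearMap.mul' F _ (TensorProduct.map (evenLinear q hq) (evenLinear q hq)
      (TensorProduct.congr (stdIdent q hq) (stdIdent q hq) ((a ⊗ₜ v) ⊗ₜ (v ⊗ₜ d)))) -
      evenLinear q hq (sand F _
        (TensorProduct.congr (stdIdent q hq) (stdIdent q hq) ((a ⊗ₜ v) ⊗ₜ (v ⊗ₜ d))) l) = 0
    rw [TensorProduct.congr_tmul, TensorProduct.map_tmul, LinearMap.mul'_apply, sand_stdIdent,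
      map_smul, evenLinear_stdIdent, evenLinear_stdIdent, evenLinear_stdIdent,
      evenMul_mul_evenMul, polar_eq_of_determines q hq hl, sub_self]
  · rw [repr_sand_stdIdent q hq, repr_sand_stdIdent q hq, hu, adjointInvolution_stdIdent]

/-- The homomorphism `C(Ad_q) → C₀(q)` that maps `c(v ⊗ w)` to `v w`. -/
def pairCliffordToEven :
    PairClifford (adjointInvolution q hq) (adjointSemitrace q hq) →ₐ[F]
      CliffordAlgebra.even q :=
  RingQuot.liftAlgHom F ⟨TensorAlgebra.lift F (evenLinear q hq), fun x y h => by
    cases h with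
    | symmetric s => rw [TensorAlgebra.lift_ι_apply, AlgHom.commutes, evenLinear_symmetric]
    | sandwich l hl u hu =>
      rw [TensorAlgebra.lift_ι_apply, ← evenLinear_sandwich q hq hl hu]
      clear hu
      induction u with
      | zero => simp
      | add x y hx hy => simp only [map_add, hx, hy]
      | tmul a b =>
        rw [degreeTwo_tmul, map_mul, TensorAlgebra.lift_ι_apply, TensorAlgebra.lift_ι_apply,
          TensorProduct.map_tmul, LinearMap.mul'_apply]⟩

theorem pairCliffordToEven_canonicalMap (a : Module.End F V) :
    pairCliffordToEven q hq (canonicalMap _ _ a) = evenLinear q hq a :=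
  (RingQuot.liftAlgHom_mkAlgHom_apply F _ _ _).trans (TensorAlgebra.lift_ι_apply _ _)

theorem canonicalMap_symmetric (s : symElts (adjointInvolution q hq)) :
    canonicalMap (adjointInvolution q hq) (adjointSemitrace q hq) s =
      algebraMap F _ (adjointSemitrace q hq s) :=
  (RingQuot.mkAlgHom_rel F (CliffordRel.symmetric s)).trans (AlgHom.commutes _ _)

/-- This is the sandwich relation of a σ₂-symmetric decomposable tensor; it becomes the second
defining relation of C₀(q). -/
theorem canonicalMap_sandwich {l : Module.End F V}
    (hl : Determines (adjointInvolution q hq) (adjointSemitrace q hq) l) (a v d : V) :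
    canonicalMap (adjointInvolution q hq) (adjointSemitrace q hq) (stdIdent q hq (a ⊗ₜ v)) *
      canonicalMap _ _ (stdIdent q hq (v ⊗ₜ d)) =
        q v • canonicalMap _ _ (stdIdent q hq (a ⊗ₜ d)) := by
  have h := RingQuot.mkAlgHom_rel F (CliffordRel.sandwich l hl _ (isSigmaTwo_stdIdent q hq a v d))
  rw [degreeTwo_tmul, map_mul, sand_stdIdent, polar_eq_of_determines q hq hl, map_smul,
    map_smul] at h
  exact h

/-- The homomorphism `C₀(q) → C(Ad_q)` that maps `v w` to `c(v ⊗ w)`. -/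
def evenToPairClifford :
    CliffordAlgebra.even q →ₐ[F]
      PairClifford (adjointInvolution q hq) (adjointSemitrace q hq) :=
  CliffordAlgebra.even.lift q
    { bilin := (TensorProduct.mk F V V).compr₂
        ((canonicalMap (adjointInvolution q hq) (adjointSemitrace q hq)).comp
          (stdIdent q hq).toLinearMap)
      contract := fun v =>
        (canonicalMap_symmetric q hq
          ⟨stdIdent q hq (v ⊗ₜ v), adjointInvolution_stdIdent q hq v v⟩).trans
          (congrArg _ (adjointSemitrace_stdIdent q hq v))
      contract_mid := fun a v d =>
        canonicalMap_sandwich q hq (exists_determines q hq).choose_spec a v d }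

theorem evenToPairClifford_evenMul (v w : V) :
    evenToPairClifford q hq (evenMul q v w) = canonicalMap _ _ (stdIdent q hq (v ⊗ₜ w)) :=
  CliffordAlgebra.even.lift_ι q _ v w

theorem evenToPairClifford_evenLinear (a : Module.End F V) :
    evenToPairClifford q hq (evenLinear q hq a) = canonicalMap _ _ a := by
  obtain ⟨t, rfl⟩ := (stdIdent q hq).surjective a
  induction t with
  | zero => simp only [map_zero]
  | add x y hx hy => simp only [map_add, hx, hy]
  | tmul v w => rw [evenLinear_stdIdent, evenToPairClifford_evenMul]

/-- The standard isomorphism `C₀(q) ≃ C(Ad_q)`. -/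
def evenEquivPairClifford :
    CliffordAlgebra.even q ≃ₐ[F]
      PairClifford (adjointInvolution q hq) (adjointSemitrace q hq) :=
  AlgEquiv.ofAlgHom (evenToPairClifford q hq) (pairCliffordToEven q hq)
    (RingQuot.ringQuot_ext' F _ _ (TensorAlgebra.hom_ext (LinearMap.ext fun a => by
      change evenToPairClifford q hq (pairCliffordToEven q hq (canonicalMap _ _ a)) =
        canonicalMap _ _ a
      rw [pairCliffordToEven_canonicalMap, evenToPairClifford_evenLinear])))
    (CliffordAlgebra.even.algHom_ext q (CliffordAlgebra.EvenHom.ext (LinearMap.ext₂ fun v w => by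
      change pairCliffordToEven q hq (evenToPairClifford q hq (evenMul q v w)) = evenMul q v w
      rw [evenToPairClifford_evenMul, pairCliffordToEven_canonicalMap, evenLinear_stdIdent])))

theorem evenEquivPairClifford_evenMul (v w : V) :
    evenEquivPairClifford q hq (evenMul q v w) = canonicalMap _ _ (stdIdent q hq (v ⊗ₜ w)) :=
  evenToPairClifford_evenMul q hq v w

theorem evenEquivPairClifford_evenInvolution (x : CliffordAlgebra.even q) :
    evenEquivPairClifford q hq (evenInvolution q x) =
      cliffordInvolution _ _ (evenEquivPairClifford q hq x) := by
  induction x using even_induction with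
  | halg r =>
    rw [evenInvolution_algebraMap, AlgEquiv.commutes]
    exact (congrArg MulOpposite.unop (AlgHom.commutes (cliffordReverse
      (adjointInvolution q hq) (adjointSemitrace q hq)) r)).symm
  | hadd x y hx hy => rw [map_add, map_add, map_add, hx, hy, map_add]
  | hmul v w x ih =>
    rw [AlgInvolution.map_mul_rev, map_mul, map_mul, AlgInvolution.map_mul_rev, ih,
      evenInvolution_evenMul, evenEquivPairClifford_evenMul, evenEquivPairClifford_evenMul,
      cliffordInvolution_canonicalMap, adjointInvolution_stdIdent]

end CliffordIso

/-! ### Comparison of the two semi-traces -/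

section CanonicalSemitrace

variable {F : Type u} [Field F] {V : Type v} [AddCommGroup V] [Module F V]
  (q : QuadraticForm F V)

/-- A bilinear map that vanishes on orthogonal pairs is a multiple of the polar form. -/
theorem eq_polar_smul_of_orthogonal (hq : LinearMap.BilinForm.Nondegenerate q.polarBilin)
    {M : Type*} [AddCommGroup M] [Module F M]
    (ψ : V →ₗ[F] V →ₗ[F] M) (hψ : ∀ v w, QuadraticMap.polar q v w = 0 → ψ v w = 0)
    {e e' : V} (he : QuadraticMap.polar q e e' = 1) (v w : V) :
    ψ v w = QuadraticMap.polar q v w • ψ e e' := by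
  -- The vector b(v, x)w - b(v, w)x is orthogonal to v.
  have hr : ∀ v w x, QuadraticMap.polar q v x • ψ v w = QuadraticMap.polar q v w • ψ v x := by
    intro v w x
    have := hψ v (QuadraticMap.polar q v x • w - QuadraticMap.polar q v w • x) (by
      rw [sub_eq_add_neg, QuadraticMap.polar_add_right, QuadraticMap.polar_neg_right,
        QuadraticMap.polar_smul_right, QuadraticMap.polar_smul_right, smul_eq_mul, smul_eq_mul]
      ring)
    rwa [map_sub, map_smul, map_smul, sub_eq_zero] at this
  have hl : ∀ v w x, QuadraticMap.polar q x w • ψ v w = QuadraticMap.polar q v w • ψ x w := by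
    intro v w x
    have := hψ (QuadraticMap.polar q x w • v - QuadraticMap.polar q v w • x) w (by
      rw [sub_eq_add_neg, QuadraticMap.polar_add_left, QuadraticMap.polar_neg_left,
        QuadraticMap.polar_smul_left, QuadraticMap.polar_smul_left, smul_eq_mul, smul_eq_mul]
      ring)
    rwa [map_sub, map_smul, map_smul, LinearMap.sub_apply, LinearMap.smul_apply,
      LinearMap.smul_apply, sub_eq_zero] at this
  by_cases hv : v = 0
  · simp [hv]
  obtain ⟨x₁, hx₁⟩ : ∃ x, QuadraticMap.polar q v x ≠ 0 := by
    by_contra! h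
    exact hv (hq.1 v h)
  -- A vector orthogonal to neither v nor e links ψ(v, w) to ψ(e, e') through ψ(v, x) and ψ(e, x),
  -- with coefficients that can be cancelled.
  obtain ⟨x, hvx, hex⟩ :
      ∃ x, QuadraticMap.polar q v x ≠ 0 ∧ QuadraticMap.polar q e x ≠ 0 := by
    by_cases h₁ : QuadraticMap.polar q v e' = 0
    · by_cases h₂ : QuadraticMap.polar q e x₁ = 0
      · refine ⟨x₁ + e', ?_, ?_⟩
        · rwa [QuadraticMap.polar_add_right, h₁, add_zero]
        · rw [QuadraticMap.polar_add_right, h₂, zero_add, he]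
          exact one_ne_zero
      · exact ⟨x₁, hx₁, h₂⟩
    · exact ⟨e', h₁, by rw [he]; exact one_ne_zero⟩
  have h₁ := hr v w x
  have h₂ := hl v x e
  have h₃ := hr e e' x
  rw [he, one_smul] at h₃
  refine smul_right_injective M (mul_ne_zero hvx hex) ?_
  change (_ * _) • ψ v w = (_ * _) • (_ • ψ e e')
  rw [mul_comm, mul_smul, h₁, smul_comm, h₂, ← h₃]
  simp only [smul_smul]
  congr 1
  ring

/-- The orthogonal complement W of U = ⟨v, w⟩ has dimension above 2, so it is not contained in U,
which is the orthogonal complement of W. Hence the polar form is not zero on W. -/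
theorem exists_polar_eq_one_orthogonal [FiniteDimensional F V]
    (hq : LinearMap.BilinForm.Nondegenerate q.polarBilin)
    (hdim : 4 < Module.finrank F V) (v w : V) :
    ∃ x y : V, QuadraticMap.polar q x y = 1 ∧
      QuadraticMap.polar q x v = 0 ∧ QuadraticMap.polar q x w = 0 ∧
      QuadraticMap.polar q y v = 0 ∧ QuadraticMap.polar q y w = 0 := by
  classical
  have hrefl : LinearMap.IsRefl q.polarBilin := fun x y h =>
    (QuadraticMap.polar_comm q y x).trans h
  let U := Submodule.span F ({v, w} : Set V)
  let W := LinearMap.BilinForm.orthogonal q.polarBilin U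
  have hU : Module.finrank F U ≤ 2 := by
    have h := finrank_span_finset_le_card (R := F) ({v, w} : Finset V)
    rw [Finset.coe_pair] at h
    exact h.trans Finset.card_le_two
  have hW := LinearMap.BilinForm.finrank_orthogonal hq U
  have hWU := LinearMap.BilinForm.orthogonal_orthogonal hq hrefl U
  have hle : ¬ W ≤ U := fun h => by
    have := Submodule.finrank_mono h
    change Module.finrank F W = _ at hW
    omega
  have hperp : ∀ x ∈ W, QuadraticMap.polar q x v = 0 ∧ QuadraticMap.polar q x w = 0 :=
    fun x hx => ⟨(QuadraticMap.polar_comm q x v).trans (hx v (Submodule.subset_span (by simp))),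
      (QuadraticMap.polar_comm q x w).trans (hx w (Submodule.subset_span (by simp)))⟩
  obtain ⟨y, hy, hyU⟩ := SetLike.not_le_iff_exists.1 hle
  rw [← hWU, LinearMap.BilinForm.mem_orthogonal_iff] at hyU
  push Not at hyU
  obtain ⟨x, hx, hxy⟩ := hyU
  have hxy : QuadraticMap.polar q x y ≠ 0 := hxy
  obtain ⟨h₁, h₂⟩ := hperp _ (W.smul_mem (QuadraticMap.polar q x y)⁻¹ hx)
  obtain ⟨h₃, h₄⟩ := hperp y hy
  refine ⟨(QuadraticMap.polar q x y)⁻¹ • x, y, ?_, h₁, h₂, h₃, h₄⟩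
  rw [QuadraticMap.polar_smul_left, smul_eq_mul, inv_mul_cancel₀ hxy]

/-- By orthogonality yx commutes with vw, and wv = -vw, so σ(vwxy) = yx·wv = -vw·yx; now use yx = 1
- xy. -/
theorem evenMul_eq_sub_evenInvolution {v w x y : V} (hvw : QuadraticMap.polar q v w = 0)
    (hxy : QuadraticMap.polar q x y = 1) (hxv : QuadraticMap.polar q x v = 0)
    (hxw : QuadraticMap.polar q x w = 0) (hyv : QuadraticMap.polar q y v = 0)
    (hyw : QuadraticMap.polar q y w = 0) :
    evenMul q v w =
      evenMul q v w * evenMul q x y - evenInvolution q (evenMul q v w * evenMul q x y) := by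
  have hanti : ∀ {a b : V}, QuadraticMap.polar q a b = 0 → CliffordAlgebra.ι q a *
      CliffordAlgebra.ι q b = -(CliffordAlgebra.ι q b * CliffordAlgebra.ι q a) := fun h => by
    rw [ι_mul_ι_comm, h, map_zero, zero_sub]
  have hcomm : ∀ {z : V}, QuadraticMap.polar q z v = 0 → QuadraticMap.polar q z w = 0 →
      Commute (CliffordAlgebra.ι q z) (CliffordAlgebra.ι q v * CliffordAlgebra.ι q w) :=
    fun hv hw => by
    rw [commute_iff_eq, ← mul_assoc, hanti hv, neg_mul, mul_assoc, hanti hw, mul_neg, neg_neg,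
      mul_assoc]
  have hyx : evenMul q y x = 1 - evenMul q x y := by
    rw [eq_sub_iff_add_eq', evenMul_add_swap, hxy, map_one]
  have hwv : evenMul q w v = -evenMul q v w := by
    rw [eq_neg_iff_add_eq_zero, add_comm, evenMul_add_swap, hvw, map_zero]
  have h : evenMul q y x * evenMul q v w = evenMul q v w * evenMul q y x :=
    Subtype.ext ((hcomm hyv hyw).mul_left (hcomm hxv hxw)).eq
  rw [AlgInvolution.map_mul_rev, evenInvolution_evenMul, evenInvolution_evenMul, hwv, mul_neg, h,
    hyx]
  noncomm_ring

variable {K : Type w} [Field K] [Algebra F K] {ι : Type} [Fintype ι] [DecidableEq ι]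
  [Nonempty ι] [Algebra.IsAlgebraic F K]

/-- For orthogonal v, w one has vw = z - σ(z), and for symmetric s the traces Trd(zs) and Trd(σ(z)s)
agree. A bilinear map vanishing on orthogonal pairs is a multiple of the polar form. -/
theorem reducedTrace_evenMul_mul (hq : LinearMap.BilinForm.Nondegenerate q.polarBilin)
    [FiniteDimensional F V] (hdim : 4 < Module.finrank F V)
    (S : SplitPair F K ι (evenInvolution q))
    (hn : (2 : K) = 0 ∨ (Fintype.card ι : K) ≠ 0) {e e' : V} (he : QuadraticMap.polar q e e' = 1)
    {s : CliffordAlgebra.even q} (hs : evenInvolution q s = s) (v w : V) :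
    reducedTrace (Subalgebra.center F (CliffordAlgebra.even q)) (CliffordAlgebra.even q)
      (evenMul q v w * s) = QuadraticMap.polar q v w •
        reducedTrace (Subalgebra.center F (CliffordAlgebra.even q)) (CliffordAlgebra.even q)
          (evenMul q e e' * s) := by
  refine eq_polar_smul_of_orthogonal q hq ((CliffordAlgebra.even.ι q).bilin.compr₂
    (((reducedTrace (Subalgebra.center F (CliffordAlgebra.even q))
      (CliffordAlgebra.even q)).restrictScalars F).comp (LinearMap.mulRight F s)))
    (fun v w hvw => ?_) he v w
  obtain ⟨x, y, hxy, hxv, hxw, hyv, hyw⟩ := exists_polar_eq_one_orthogonal q hq hdim v w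
  change reducedTrace (Subalgebra.center F (CliffordAlgebra.even q)) (CliffordAlgebra.even q)
    (evenMul q v w * s) = 0
  rw [evenMul_eq_sub_evenInvolution q hvw hxy hxv hxw hyv hyw]
  set z := evenMul q v w * evenMul q x y
  rw [sub_mul, map_sub, ← S.isOrthogonal.reducedTrace_apply hn (z * s),
    AlgInvolution.map_mul_rev, hs, S.reducedTrace_mul_comm hn, sub_self]

theorem reducedTrace_evenLinear_mul (hq : LinearMap.BilinForm.Nondegenerate q.polarBilin)
    [FiniteDimensional F V] (hdim : 4 < Module.finrank F V)
    (S : SplitPair F K ι (evenInvolution q))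
    (hn : (2 : K) = 0 ∨ (Fintype.card ι : K) ≠ 0) {e e' : V} (he : QuadraticMap.polar q e e' = 1)
    {s : CliffordAlgebra.even q} (hs : evenInvolution q s = s) (a : Module.End F V) :
    reducedTrace (Subalgebra.center F (CliffordAlgebra.even q)) (CliffordAlgebra.even q)
      (evenLinear q hq a * s) = LinearMap.trace F V a •
        reducedTrace (Subalgebra.center F (CliffordAlgebra.even q)) (CliffordAlgebra.even q)
          (evenMul q e e' * s) := by
  obtain ⟨t, rfl⟩ := (stdIdent q hq).surjective a
  induction t with
  | zero => simp only [map_zero, zero_mul, zero_smul]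
  | add x y hx hy => simp only [map_add, add_mul, add_smul, hx, hy]
  | tmul v w =>
    rw [evenLinear_stdIdent, trace_stdIdent, QuadraticMap.polar_comm,
      reducedTrace_evenMul_mul q hq hdim S hn he hs]

theorem exists_anisotropic {e e' : V} (he : QuadraticMap.polar q e e' = 1) :
    ∃ v, q v ≠ 0 := by
  by_contra! h
  rw [QuadraticMap.polar, h, h, h] at he
  simp at he

end CanonicalSemitrace

end QuadPair

end

/-! ### The theorem -/

theorem mainTheorem8 {F : Type*} [Field F] {V : Type*} [AddCommGroup V] [Module F V]
    [FiniteDimensional F V] (q : QuadraticForm F V)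
    (hq : LinearMap.BilinForm.Nondegenerate q.polarBilin)
    (m : ℕ) (hdim : Module.finrank F V = 2 * m) (hm : 8 ≤ 2 * m) (heven : Even m)
    (hchar : ringChar F ≠ 2 → 4 ∣ m)
    (e e' : V) (he : QuadraticMap.polar q e e' = 1) :
    -- `(C₀(q), σ_q, f_{e,e'})` is an algebra with quadratic pair
    QuadPair.IsQuadraticPair (QuadPair.evenInvolution q) (QuadPair.evenSemitrace q e e') ∧
    -- the canonical semi-trace `g` of `C(Ad_q)` is well defined
    ∃ g : QuadPair.symElts (QuadPair.cliffordInvolution (QuadPair.adjointInvolution q hq)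
          (QuadPair.adjointSemitrace q hq)) →ₗ[F]
        Subalgebra.center F (QuadPair.PairClifford (QuadPair.adjointInvolution q hq)
          (QuadPair.adjointSemitrace q hq)),
      QuadPair.IsCanonicalSemitrace (QuadPair.adjointInvolution q hq)
        (QuadPair.adjointSemitrace q hq) g ∧
      QuadPair.IsQuadraticPair (QuadPair.cliffordInvolution (QuadPair.adjointInvolution q hq)
        (QuadPair.adjointSemitrace q hq)) g ∧
      -- the identification `V ⊗ V ≃ End V` induces an isomorphism of algebras with quadratic pair
      ∃ Φ : CliffordAlgebra.even q ≃ₐ[F] QuadPair.PairClifford (QuadPair.adjointInvolution q hq)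
          (QuadPair.adjointSemitrace q hq),
        (∀ v w : V, Φ (QuadPair.evenMul q v w) =
          QuadPair.canonicalMap (QuadPair.adjointInvolution q hq) (QuadPair.adjointSemitrace q hq)
            (QuadPair.stdIdent q hq (v ⊗ₜ[F] w))) ∧
        QuadPair.PreservesQuadraticPair Φ (QuadPair.evenInvolution q)
          (QuadPair.evenSemitrace q e e')
          (QuadPair.cliffordInvolution (QuadPair.adjointInvolution q hq)
            (QuadPair.adjointSemitrace q hq)) g := by
  let K := AlgebraicClosure F
  obtain ⟨k, rfl⟩ : ∃ k, m = k + 1 := ⟨m - 1, by omega⟩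
  obtain ⟨v, hv⟩ := QuadPair.exists_anisotropic q he
  -- This is the sign of the forms on the half-spin spaces: signs are invisible in characteristic 2,
  -- and otherwise m/2 is even.
  have hε : (-1 : K) ^ ((k + 1) / 2) = 1 := by
    by_cases h2 : ringChar F = 2
    · have : CharP F 2 := h2 ▸ ringChar.charP F
      have : CharP K 2 := charP_of_injective_algebraMap (algebraMap F K).injective 2
      rw [CharTwo.neg_eq, one_pow]
    · obtain ⟨c, hc⟩ := hchar h2
      rw [hc, show 4 * c / 2 = 2 * c by omega, pow_mul, neg_one_sq, one_pow]
  obtain ⟨ι, _, _, hcard, ⟨S⟩⟩ := QuadPair.exists_splitPair_even (K := K) q hq hdim heven hε hv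
  -- The degree is a power of 2, so it is invertible outside characteristic 2.
  have hn : (2 : K) = 0 ∨ (Fintype.card ι : K) ≠ 0 := by
    rw [hcard, or_iff_not_imp_left]
    intro h
    push_cast
    exact pow_ne_zero _ h
  have : Nonempty ι := Fintype.card_pos_iff.1 (by rw [hcard]; positivity)
  obtain ⟨S', hS₁, hS₂⟩ := S.exists_congr (QuadPair.evenEquivPairClifford q hq)
    (QuadPair.evenEquivPairClifford_evenInvolution q hq)
  have htr := QuadPair.SplitData.map_reducedTrace hn S.toSplitData S'.toSplitData
    (QuadPair.evenEquivPairClifford q hq) hS₁ hS₂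
  have hu : QuadPair.evenMul q e e' + QuadPair.evenInvolution q (QuadPair.evenMul q e e') = 1 := by
    rw [QuadPair.evenInvolution_evenMul, QuadPair.evenMul_add_swap, he, map_one]
  have hd : 4 < Module.finrank F V := by omega
  -- The semi-trace is defined by Φ(ee') = c(φ_q(e ⊗ e')), where φ_q(e ⊗ e') has trace b(e', e) = 1.
  -- Any other endomorphism of trace 1 is compared with it inside C₀(q), along compatible
  -- splittings.
  refine ⟨S.isQuadraticPair hn hu, QuadPair.semitraceOf _
    (QuadPair.evenEquivPairClifford q hq (QuadPair.evenMul q e e')),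
    ⟨⟨QuadPair.stdIdent q hq (e ⊗ₜ e'), ?_⟩, fun a ha => ?_⟩, S'.isQuadraticPair hn ?_,
    QuadPair.evenEquivPairClifford q hq, QuadPair.evenEquivPairClifford_evenMul q hq,
    ⟨QuadPair.evenEquivPairClifford_evenInvolution q hq, ?_⟩⟩
  · rw [QuadPair.reducedTrace_end, QuadPair.trace_stdIdent, QuadraticMap.polar_comm, he]
  · rw [QuadPair.reducedTrace_end] at ha
    refine LinearMap.ext fun s => Subtype.ext ?_
    obtain ⟨x, hx⟩ := (QuadPair.evenEquivPairClifford q hq).surjective s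
    have hxs : QuadPair.evenInvolution q x = x :=
      (QuadPair.evenEquivPairClifford q hq).injective (by
        rw [QuadPair.evenEquivPairClifford_evenInvolution, hx]
        exact QuadPair.mem_symElts.1 s.2)
    have hc : QuadPair.evenEquivPairClifford q hq (QuadPair.evenLinear q hq a) =
        QuadPair.canonicalMap _ _ a := QuadPair.evenToPairClifford_evenLinear q hq a
    have h := htr (QuadPair.evenLinear q hq a * x)
    have h' := htr (QuadPair.evenMul q e e' * x)
    rw [QuadPair.reducedTrace_evenLinear_mul q hq hd S hn he hxs, ha, one_smul,
      map_mul (QuadPair.evenEquivPairClifford q hq), hc, hx] at h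
    rw [map_mul (QuadPair.evenEquivPairClifford q hq), hx] at h'
    exact h'.symm.trans h
  · rw [← QuadPair.evenEquivPairClifford_evenInvolution, ← map_add, hu, map_one]
  · intro s s' hs
    rw [QuadPair.evenSemitrace, QuadPair.semitraceOf_apply, QuadPair.semitraceOf_apply, ← hs,
      ← map_mul, htr]
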